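/- A tree-like phenylene with $h\ge 1$ hexagons is a graph that consists of $h$ pairwise disjoint hexagons (6-cycles) and of $h-1$ quadrilaterals joining them in a tree-like manner. Precisely: there is a tree $T$ on the set of hexagons; for each edge $RR'$ of $T$, one side of $R$ and one side of $R'$ are opposite edges of a quadrilateral, the two remaining edges of which join $R$ to $R'$; different quadrilaterals have no common vertex (so each hexagon has at most three adjacent quadrilaterals); and all hexagons are glued consistently with a counterclockwise orientation, so that the graph is plane. (Only this combinatorial structure matters; it is not required that the picture with regular hexagons and squares is free of overlaps.) Let $\mathscr P_h$ be the set of tree-like phenylenes with $h$ hexagons; $\cong$ denotes isomorphism of graphs. A phenylene chain is a member of $\mathscr P_h$ in which each hexagon has at most two adjacent quadrilaterals. A hexagon with exactly two adjacent quadrilaterals is a turn-hexagon if these lie on non-opposite sides of it. $L_h$ is the chain with $h$ hexagons and no turn-hexagon. $C_L(j,n)$ is the chain with $j+n+1$ hexagons consisting, in this order, of a linear chain $L_j$, a turn-hexagon, and a linear chain $L_n$. $C_L(j,k,n)$ is the chain with $j+k+n+2$ hexagons consisting, in this order, of $L_j$, a turn-hexagon, $L_k$, a turn-hexagon, and $L_n$,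 where the two turns are in opposite directions (one left, one right). $P_L(j,k,n)$ is the phenylene with $j+k+n+1$ hexagons consisting of a hexagon with three adjacent quadrilaterals to which linear branches $L_j$, $L_k$ and $L_n$ are attached. For a connected graph $G$ let $$Mo(G)=\sum_{uv\in E(G)}|n_u-n_v|,$$ where $n_u$ (resp. $n_v$) is the number of vertices whose distance to $u$ (resp. $v$) is smaller than the distance to $v$ (resp. $u$). **Theorem 4.4.** (1) Let $h\ge 5$. The phenylenes $C_L(1,h-2)$ and $C_L(1,h-4,1)$ belong to $\mathscr P_h$, are not isomorphic to $L_h$, and satisfy $$Mo(C_L(1,h-2))=Mo(C_L(1,h-4,1))=72\left\lfloor\tfrac h2\right\rfloor\left\lceil\tfrac h2\right\rceil-24\left\lfloor\tfrac h2\right\rfloor+24(h-1).$$ For every $G\in\mathscr P_h$ with $G\not\cong L_h$, $$Mo(G)\ge 72\left\lfloor\tfrac h2\right\rfloor\left\lceil\tfrac h2\right\rceil-24\left\lfloor\tfrac h2\right\rfloor+24(h-1),$$ with equality if and only if $G\cong C_L(1,h-2)$ or $G\cong C_L(1,h-4,1)$. (2) The phenylene $P_L(1,1,1)$ belongs to $\mathscr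 P_4$, is not isomorphic to $L_4$, and satisfies $Mo(P_L(1,1,1))=288$. For every $G\in\mathscr P_4$ with $G\not\cong L_4$, $Mo(G)\ge 288$, with equality if and only if $G\cong P_L(1,1,1)$. -/

import Mathlib

/-- The Mostar index `Mo(G) = ∑_{uv ∈ E(G)} |n_u - n_v|`, where `n_u` (resp. `n_v`) is the number
of vertices that are closer to `u` than to `v` (resp. closer to `v` than to `u`). -/
noncomputable def mostarIndex {V : Type*} [Fintype V] (G : SimpleGraph V) : ℤ := by
  classical
  exact ∑ e ∈ G.edgeFinset,
    Sym2.lift ⟨fun u v : V =>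
      |((Finset.univ.filter fun x : V => G.dist x u < G.dist x v).card : ℤ) -
        ((Finset.univ.filter fun x : V => G.dist x v < G.dist x u).card : ℤ)|,
      fun _ _ => abs_sub_comm _ _⟩ e

/-- Hexagons joined by quadrilaterals. The vertices are the pairs `(a, i)`: the `i`-th vertex, in
counterclockwise order, of the hexagon `a`. Side `i` of a hexagon is the edge from its vertex `i`
to its vertex `i + 1`. For every pair of hexagons `a`, `b` adjacent in `T`, side `side a b` of `a`
and side `side b a` of `b` are opposite edges of a quadrilateral; as both hexagons are oriented
counterclockwise, the start of either side is joined to the end of the other one. -/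
def hexagonAssembly {ι : Type*} (T : SimpleGraph ι) (side : ι → ι → ZMod 6) :
    SimpleGraph (ι × ZMod 6) where
  Adj x y :=
    (x.1 = y.1 ∧ (y.2 = x.2 + 1 ∨ x.2 = y.2 + 1)) ∨
    (T.Adj x.1 y.1 ∧
      ((x.2 = side x.1 y.1 ∧ y.2 = side y.1 x.1 + 1) ∨
        (x.2 = side x.1 y.1 + 1 ∧ y.2 = side y.1 x.1)))
  symm := ⟨by
    rintro x y (⟨h, h'⟩ | ⟨h, h'⟩)
    · exact Or.inl ⟨h.symm, h'.symm⟩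
    · exact Or.inr ⟨h.symm, h'.symm.imp And.symm And.symm⟩⟩
  loopless := ⟨by
    rintro x (⟨-, h⟩ | ⟨h, -⟩)
    · have h1 : (1 : ZMod 6) = 0 := by simpa using h
      exact absurd h1 (by decide)
    · exact T.irrefl h⟩

/-- `G` is (isomorphic to) a tree-like phenylene with `h` hexagons: `h` pairwise disjoint hexagons
that are joined in a tree-like manner by `h - 1` quadrilaterals, where distinct quadrilaterals at
the same hexagon `a` use sides of `a` without a common vertex (so that every hexagon has at most
three adjacent quadrilaterals, and every vertex has degree 2 or 3). -/
def IsTreelikePhenylene (h : ℕ) {V : Type*} (G : SimpleGraph V) : Prop :=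
  ∃ (T : SimpleGraph (Fin h)) (side : Fin h → Fin h → ZMod 6),
    T.IsTree ∧
    (∀ a b c, T.Adj a b → T.Adj a c → b ≠ c →
      side a b ≠ side a c ∧ side a b ≠ side a c + 1 ∧ side a c ≠ side a b + 1) ∧
    Nonempty (G ≃g hexagonAssembly T side)

/-- The phenylene chain with turn word `w`: its hexagons are numbered `0, 1, …, w.length - 1`,
consecutive hexagons are joined, each hexagon is entered through its side `0`, and hexagon `a` is
left through its side `3 + w[a]`. So the letter `0` goes straight on (the two sides are opposite),
and the letters `1` and `-1` are the turn-hexagons of the two orientations. The first and the last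
letter have no effect on the isomorphism type. -/
def phenyleneChain (w : List (ZMod 6)) : SimpleGraph (Fin w.length × ZMod 6) :=
  hexagonAssembly (SimpleGraph.pathGraph w.length)
    (fun a b => if b.val = a.val + 1 then 3 + w.get a else 0)

/-- The linear phenylene chain `L_h`: no turn-hexagons. -/
abbrev linearChain (h : ℕ) :=
  phenyleneChain (List.replicate h 0)

/-- The phenylene chain `C_L(j, n)` with `j + n + 1` hexagons: two linear chains `L_j` and `L_n`
attached to one turn-hexagon. -/
abbrev chainCL₂ (j n : ℕ) :=
  phenyleneChain (List.replicate j 0 ++ [1] ++ List.replicate n 0)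

/-- The phenylene chain `C_L(j, k, n)` with `j + k + n + 2` hexagons: linear chains `L_j`, `L_k`
and `L_n`, separated by two turn-hexagons. The turns are in opposite directions, so the middle
segment is a zigzag segment (the neighbouring segments lie on different sides of it). -/
abbrev chainCL₃ (j k n : ℕ) :=
  phenyleneChain (List.replicate j 0 ++ [1] ++ List.replicate k 0 ++ [-1] ++ List.replicate n 0)

/-- The index type of the hexagons of `P_L(j, k, n)`: the central full-hexagon `none`, and the
`i`-th hexagon `some ⟨b, i⟩` of the branch `b`, counted from the centre. -/
abbrev PLIndex (j k n : ℕ) : Type :=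
  Option (Σ b : Fin 3, Fin (![j, k, n] b))

/-- The tree of hexagons of `P_L(j, k, n)`: three paths attached to the centre. -/
def treePL (j k n : ℕ) : SimpleGraph (PLIndex j k n) :=
  SimpleGraph.fromRel fun x y =>
    match x, y with
    | none, some ⟨_, i⟩ => i.val = 0
    | some ⟨b, i⟩, some ⟨c, l⟩ => b = c ∧ l.val = i.val + 1
    | _, _ => False

/-- Branch `b` is attached to side `2 * b` of the central hexagon; the hexagons in the branches
are entered through side `0` and left through the opposite side `3`. -/
def sidePL (j k n : ℕ) : PLIndex j k n → PLIndex j k n → ZMod 6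
  | none, some ⟨b, _⟩ => 2 * (b.val : ZMod 6)
  | some ⟨_, i⟩, some ⟨_, l⟩ => if l.val = i.val + 1 then 3 else 0
  | _, _ => 0

/-- The phenylene `P_L(j, k, n)` with `j + k + n + 1` hexagons: three linear branches `L_j`, `L_k`
and `L_n` attached to one full-hexagon. -/
def branchedPL (j k n : ℕ) : SimpleGraph (PLIndex j k n × ZMod 6) :=
  hexagonAssembly (treePL j k n) (sidePL j k n)

/-!
The Mostar index of a tree-like phenylene is computed from its edge cuts. Every edge belongs to
one of two kinds of cuts: the two edges of a quadrilateral that join its hexagons, and the edges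
met by a straight line that enters a hexagon through a side, leaves it through the opposite side,
and goes on through the quadrilaterals it meets. For each such cut the graph can be folded onto
one of the two parts by a map that respects adjacency and identifies the ends of the cut edges
(`exists_shorter_walk_of_fold`). So a vertex in a part is closer to the end, in that part, of every
edge of the cut, and `|n_u - n_v|` is the difference of the sizes of the two parts
(`imbalance_link`, `imbalance_hexagon`). These differences are multiples of 6, since the hexagons
that a cut passes through are divided evenly, and they can be read off from the tree of hexagons
with the turns at each hexagon.

What hangs at a side of a hexagon is recorded as a ternary tree, a `Branch`. Cutting the phenylene
between two adjacent hexagons leaves two branches `p` and `q`. They determine the phenylene up to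
isomorphism (`nonempty_iso_of_splitsAs`), and its Mostar index is `12 * mostar p q`
(`mostarIndex_eq`), where `mostar` is a recursively defined function of branches. The rest is a
study of this function.

Choose the place of the cut so that `p` and `q` are balanced (`exists_balanced_split`). As long as
`p` is not larger than `q`, what `p` contributes is a term that depends only on the sizes, plus a
term for the straight cut through the joining quadrilateral, plus an excess. The excess is `0` if
`p` is straight, `N - 1` if `p` is straight up to one turn before its last hexagon (`N` is the
number of hexagons), at least `N` for other chains, and at least `2 * N` otherwise (`excessType`).
If `p` and `q` differ in size by at most one, adding up gives the linear chain, or a value at least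
`2 * (N - 1)` above that of the linear chain; this is attained only if one of `p` and `q` is
straight and the other one turns before its end, or if both do so in such a manner that the
straight cut between them is balanced (`excess_add_bound`). The first case is `C_L(1, N - 2)` and
the second one is `C_L(1, N - 4, 1)`. There remain the phenylenes with a central hexagon at which
each branch has fewer than half of the hexagons, and which is not passed straight. These are
estimated directly (`lt_mostar_of_center_turn`, `mostar_bound_of_center_branching`); only
`P_L(1, 1, 1)` does not exceed the bound.
-/

namespace Phenylene

/-! ### Branches and their numerical functions -/

/-- What hangs at a side of a hexagon of a tree-like phenylene: nothing, or a hexagon. If that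
hexagon is entered through its side `e`, then `l`, `m` and `r` are what hangs at its sides `e + 2`,
`e + 3` and `e + 4`. Nothing can hang at `e + 1` and `e + 5`, as quadrilaterals have no common
vertex. The names left (for `e + 2`), middle and right (for `e + 4`) are mere labels: reflecting
the plane exchanges left and right. -/
inductive Branch : Type
  | nil : Branch
  | node (l m r : Branch) : Branch

namespace Branch

/-- The number of hexagons of a branch. -/
def size : Branch → ℤ
  | nil => 0
  | node l m r => 1 + size l + size m + size r

/-- The number of hexagons of a branch that are divided by the straight cut that enters the branch
through its first hexagon. -/
def run : Branch → ℤ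
  | nil => 0
  | node _ m _ => 1 + run m

/-- The number of hexagons of a branch that lie on the left of the straight cut that enters the
branch through its first hexagon. -/
def left : Branch → ℤ
  | nil => 0
  | node l m _ => size l + left m

/-- The number of hexagons of a branch that lie on the right of the straight cut that enters the
branch through its first hexagon. -/
def right : Branch → ℤ
  | nil => 0
  | node _ m r => size r + right m

/-- The branches that can occur: if something hangs at the side opposite to the entry, then the
sides `e + 2` and `e + 4`, which have a vertex in common with it, are free. -/
def Wf : Branch → Prop
  | nil => True
  | node l m r => (m ≠ nil → l = nil ∧ r = nil) ∧ Wf l ∧ Wf m ∧ Wf r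

/-- The reflected branch. -/
def mirror : Branch → Branch
  | nil => nil
  | node l m r => node (mirror r) (mirror m) (mirror l)

/-- `straight n p` is a linear chain of `n` hexagons, continued straight on by `p`. -/
def straight : ℕ → Branch → Branch
  | 0, p => p
  | n + 1, p => node nil (straight n p) nil

/-- The linear chain of `n` hexagons, as a branch. -/
abbrev line (n : ℕ) : Branch := straight n nil

/-- A linear chain of `j` hexagons, a hexagon at which the branch turns left, and one further
hexagon. It has `j + 2` hexagons. -/
def bentLeft (j : ℕ) : Branch := straight j (node (line 1) nil nil)

/-- The reflection of `bentLeft j`. -/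
def bentRight (j : ℕ) : Branch := straight j (node nil nil (line 1))

/-- A sixth of `|n_u - n_v|` for either of the two edges that join the first hexagon of `p` to the
hexagon at which `p` hangs, where `q` is the rest of the phenylene. It is `0` if there is no such
quadrilateral. -/
def edge : Branch → Branch → ℤ
  | nil, _ => 0
  | p, q => |size p - size q|

/-- If a phenylene is cut between two adjacent hexagons into the branches `p` and `q`, then
`tilt p q` is the difference of the numbers of hexagons on the two sides of the straight cut that
passes through both hexagons along the joining quadrilateral. The left of `p` and the right of `q`
are on the same side, since the two branches are entered in opposite directions. -/
def tilt (p q : Branch) : ℤ := |left p - right p + right q - left q|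

/-- For a hexagon with the branches `q`, `l`, `m`, `r` at its sides `e`, `e + 2`, `e + 3` and
`e + 4`, the sum over the three straight cuts through this hexagon of the difference of the numbers
of hexagons on the two sides of the cut. -/
def cell (q l m r : Branch) : ℤ :=
  |size l + left m + right q - size r - right m - left q| +
    |size l + size m + left r - size q - right r| +
    |size m + size r + right l - size q - left l|

/-- The sum of the contributions of the hexagons of `p`, and of the quadrilaterals between hexagons
of `p`, to the Mostar index of the phenylene in which `q` is the rest, divided by 12. In the
recursion, the second argument is always the rest of the phenylene as a branch, seen from the
branch in the first argument. -/
def innerSum : Branch → Branch → ℤ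
  | nil, _ => 0
  | node l m r, q => cell q l m r +
      (edge l (node r nil q) + innerSum l (node r nil q)) +
      (edge m (node nil q nil) + innerSum m (node nil q nil)) +
      (edge r (node q nil l) + innerSum r (node q nil l))

/-- A twelfth of the Mostar index of the phenylene that is cut into `p` and `q` between two
adjacent hexagons; see `mostarIndex_eq`. -/
def mostar (p q : Branch) : ℤ := |size p - size q| + innerSum p q + innerSum q p

theorem size_nonneg : ∀ p : Branch, 0 ≤ size p
  | nil => le_rfl
  | node l m r => by
    have := size_nonneg l; have := size_nonneg m; have := size_nonneg r
    simp only [size]; omega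

theorem size_pos {p : Branch} (hp : p ≠ nil) : 0 < size p := by
  cases p with
  | nil => exact absurd rfl hp
  | node l m r =>
    have := size_nonneg l; have := size_nonneg m; have := size_nonneg r
    simp only [size]; omega

theorem left_nonneg : ∀ p : Branch, 0 ≤ left p
  | nil => le_rfl
  | node l m r => by
    have := size_nonneg l; have := left_nonneg m
    simp only [left]; omega

theorem right_nonneg : ∀ p : Branch, 0 ≤ right p
  | nil => le_rfl
  | node l m r => by
    have := size_nonneg r; have := right_nonneg m
    simp only [right]; omega

theorem run_pos {p : Branch} (hp : p ≠ nil) : 0 < run p := by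
  have h0 : ∀ p : Branch, 0 ≤ run p := by
    intro p
    induction p with
    | nil => exact le_rfl
    | node l m r _ ih _ => simp only [run]; omega
  cases p with
  | nil => exact absurd rfl hp
  | node l m r => have := h0 m; simp only [run]; omega

theorem size_eq : ∀ p : Branch, size p = run p + left p + right p
  | nil => rfl
  | node l m r => by
    have := size_eq m
    simp only [size, run, left, right]; omega

theorem size_line (n : ℕ) : size (line n) = n := by
  induction n with
  | zero => rfl
  | succ n ih =>
    simp only [line, straight, size] at ih ⊢
    rw [ih]; push_cast; ring

@[simp] theorem edge_nil (q : Branch) : edge nil q = 0 := rfl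

theorem edge_of_ne {p : Branch} (hp : p ≠ nil) (q : Branch) : edge p q = |size p - size q| := by
  cases p with
  | nil => exact absurd rfl hp
  | node l m r => rfl

/-- What a linear branch of `s` hexagons contributes to the Mostar index (divided by 12) of a
phenylene with `N` hexagons, at least half of which are outside the branch, when the straight cut
along the branch is disregarded. -/
def base (N s : ℤ) : ℤ := 3 * N * s - 3 * s ^ 2 + s - N

/-! ### The contribution of one branch -/

/-- The amount by which the contribution `innerSum p q` exceeds what is there for a linear branch
of the same size, the straight cut that enters `p` being counted separately: it contributes
`tilt p q` for each of the `run p` hexagons of `p` that it divides. -/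
def excess (p q : Branch) : ℤ :=
  innerSum p q - run p * tilt p q - base (size p + size q) (size p)

theorem tilt_comm (p q : Branch) : tilt p q = tilt q p := by
  unfold tilt; rw [← abs_neg]; congr 1; ring

theorem tilt_straight (m q : Branch) :
    tilt m (node nil q nil) = tilt (node nil m nil) q := by
  simp only [tilt, left, right, size]; congr 1; ring

/-- A hexagon that is passed straight may be moved from the smaller branch to the larger one
without changing the excess. -/
theorem excess_straight {m q : Branch} (hm : m ≠ nil) (h : size m ≤ size q) :
    excess (node nil m nil) q = excess m (node nil q nil) := by
  have h1 : |size m - size q| = size q - size m := by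
    rw [abs_sub_comm]; exact abs_of_nonneg (by omega)
  have h2 : |size m - size (node nil q nil)| = size q + 1 - size m := by
    rw [abs_sub_comm]; simp only [size]; rw [abs_of_nonneg] <;> omega
  have h3 := tilt_straight m q
  simp only [excess, innerSum, cell, edge_of_ne hm, edge_nil] at *
  rw [h2, h3]
  simp only [tilt, left, right, size, run, base] at *
  simp only [zero_add, add_zero, sub_zero] at *
  rw [h1]
  ring_nf

theorem excess_leaf (q : Branch) (h : 1 ≤ size q) : excess (node nil nil nil) q = 0 := by
  have h1 : |-size q| = size q := by rw [abs_neg]; exact abs_of_nonneg (by omega)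
  simp only [excess, innerSum, cell, edge_nil, tilt, left, right, size, run, base]
  simp only [zero_add, add_zero, sub_zero, zero_sub, h1]
  ring

/-- A lower bound for the excess of a branch that turns left at its first hexagon, in terms of that
of the branch that follows. The cut that enters `l` straight becomes very unbalanced: `q` lies on
one side of it. -/
theorem excess_left {l q : Branch} (hl : l ≠ nil) (h : size l + 1 ≤ size q) :
    excess l (node nil nil q) + run l * (size q - size l + run l) - (size q - size l) +
      (size q - size l + run l) ≤ excess (node l nil nil) q := by
  have h1 : |size l - size q| = size q - size l := by
    rw [abs_sub_comm]; exact abs_of_nonneg (by omega)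
  have h2 : |size l - size (node nil nil q)| = size q + 1 - size l := by
    rw [abs_sub_comm]; simp only [size]; rw [abs_of_nonneg] <;> omega
  have h3 : tilt l (node nil nil q) = |right l - size q - left l| := by
    simp only [tilt, left, right, size]; rw [← abs_neg]; congr 1; ring
  have h4 : size q - size l + run l ≤ |right l - size q - left l| := by
    rw [abs_sub_comm, abs_sub_comm]
    have := size_eq l; have := left_nonneg l; have := right_nonneg l
    refine le_trans ?_ (neg_le_abs _); omega
  have h5 := run_pos hl
  simp only [excess, innerSum, cell, edge_of_ne hl, edge_nil, h2, h3]
  simp only [tilt, left, right, size, run, base]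
  simp only [zero_add, add_zero, sub_zero, h1]
  generalize hX : |right l - size q - left l| = X at *
  generalize |size l + right q - left q| = Y at *
  have h6 : |size l + left .nil + right q - left q| = |size l + right q - left q| := by simp [left]
  nlinarith [mul_le_mul_of_nonneg_left h4 h5.le]

/-- A lower bound for the excess of a branch that forks at its first hexagon: both cuts that enter
`l` and `r` are unbalanced, since most of the phenylene lies on one side. -/
theorem excess_both {l r q : Branch} (hl : l ≠ nil) (hr : r ≠ nil)
    (h : size l + size r + 1 ≤ size q) :
    excess l (node r nil q) + excess r (node q nil l) + 2 * (size l + size r + 1 + size q) ≤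
      excess (node l nil r) q := by
  have hl0 := size_pos hl
  have hr0 := size_pos hr
  have h2 : |size l - size (node r nil q)| = size q + size r + 1 - size l := by
    rw [abs_sub_comm]; simp only [size]; rw [abs_of_nonneg] <;> omega
  have h2' : |size r - size (node q nil l)| = size q + size l + 1 - size r := by
    rw [abs_sub_comm]; simp only [size]; rw [abs_of_nonneg] <;> omega
  have h3 : tilt l (node r nil q) = |size r + right l - size q - left l| := by
    simp only [tilt, left, right]; rw [← abs_neg]; congr 1; ring
  have h3' : tilt r (node q nil l) = |size l + left r - size q - right r| := by
    simp only [tilt, left, right]; congr 1; ring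
  have h4 : size q - size r - size l + run l ≤ |size r + right l - size q - left l| := by
    have := size_eq l; have := left_nonneg l; have := right_nonneg l
    refine le_trans ?_ (neg_le_abs _); omega
  have h4' : size q - size r - size l + run r ≤ |size l + left r - size q - right r| := by
    have := size_eq r; have := left_nonneg r; have := right_nonneg r
    refine le_trans ?_ (neg_le_abs _); omega
  have h5 := run_pos hl
  have h5' := run_pos hr
  simp only [excess, innerSum, cell, edge_of_ne hl, edge_of_ne hr, edge_nil, h2, h2', h3, h3']
  simp only [tilt, left, right, size, run, base]
  simp only [zero_add, add_zero, sub_zero]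
  have h6 : |size l + right q - size r - left q| = |size l - size r + right q - left q| := by
    congr 1; ring
  rw [h6]
  generalize |size r + right l - size q - left l| = X at *
  generalize |size l + left r - size q - right r| = X' at *
  generalize |size l - size r + right q - left q| = Y at *
  have hu : (2 : ℤ) * (size q - size r - size l + 1) ≤ (run l + 1) * X := by
    have : size q - size r - size l + 1 ≤ X := by omega
    nlinarith
  have hu' : (2 : ℤ) * (size q - size r - size l + 1) ≤ (run r + 1) * X' := by
    have : size q - size r - size l + 1 ≤ X' := by omega
    nlinarith
  nlinarith [mul_nonneg (sub_nonneg.2 (Int.add_one_le_iff.2 hl0))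
    (sub_nonneg.2 (Int.add_one_le_iff.2 hr0))]

/-! ### Reflections -/

@[simp] theorem mirror_mirror (p : Branch) : mirror (mirror p) = p := by
  induction p with
  | nil => rfl
  | node l m r hl hm hr => simp only [mirror, hl, hm, hr]

@[simp] theorem size_mirror (p : Branch) : size (mirror p) = size p := by
  induction p with
  | nil => rfl
  | node l m r hl hm hr => simp only [mirror, size, hl, hm, hr]; ring

@[simp] theorem run_mirror (p : Branch) : run (mirror p) = run p := by
  induction p with
  | nil => rfl
  | node l m r hl hm hr => simp only [mirror, run, hm]

@[simp] theorem left_mirror (p : Branch) : left (mirror p) = right p := by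
  induction p with
  | nil => rfl
  | node l m r hl hm hr => simp only [mirror, left, right, hm, size_mirror]

@[simp] theorem right_mirror (p : Branch) : right (mirror p) = left p := by
  induction p with
  | nil => rfl
  | node l m r hl hm hr => simp only [mirror, left, right, hm, size_mirror]

@[simp] theorem mirror_eq_nil {p : Branch} : mirror p = nil ↔ p = nil := by
  cases p <;> simp [mirror]

@[simp] theorem edge_mirror (p q : Branch) : edge (mirror p) (mirror q) = edge p q := by
  by_cases hp : p = nil
  · subst hp; rfl
  · rw [edge_of_ne hp, edge_of_ne (by simpa using hp), size_mirror, size_mirror]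

theorem Wf.mirror {p : Branch} (h : Wf p) : Wf (mirror p) := by
  induction p with
  | nil => trivial
  | node l m r hl hm hr =>
    obtain ⟨h1, h2, h3, h4⟩ := h
    exact ⟨fun hm' => by simpa using (h1 (by simpa using hm')).symm, hr h4, hm h3, hl h2⟩

theorem innerSum_mirror (p q : Branch) : innerSum (mirror p) (mirror q) = innerSum p q := by
  induction p generalizing q with
  | nil => rfl
  | node l m r hl hm hr =>
    have el := hl (node r nil q)
    have em := hm (node nil q nil)
    have er := hr (node q nil l)
    have el' := edge_mirror l (node r nil q)
    have em' := edge_mirror m (node nil q nil)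
    have er' := edge_mirror r (node q nil l)
    simp only [mirror] at el em er el' em' er' ⊢
    simp only [innerSum, cell, el, em, er, el', em', er', size_mirror, left_mirror, right_mirror]
    have a1 : |size r + right m + left q - size l - left m - right q| =
        |size l + left m + right q - size r - right m - left q| := by
      rw [← abs_neg]; congr 1; ring
    have a2 : |size r + size m + right l - size q - left l| =
        |size m + size r + right l - size q - left l| := by congr 1; ring
    have a3 : |size m + size l + left r - size q - right r| =
        |size l + size m + left r - size q - right r| := by congr 1; ring
    rw [a1, a2, a3]; ring

theorem tilt_mirror (p q : Branch) : tilt (mirror p) (mirror q) = tilt p q := by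
  simp only [tilt, left_mirror, right_mirror]; rw [← abs_neg]; congr 1; ring

theorem excess_mirror (p q : Branch) : excess (mirror p) (mirror q) = excess p q := by
  simp only [excess, innerSum_mirror, tilt_mirror, size_mirror, run_mirror]

theorem mostar_mirror (p q : Branch) : mostar (mirror p) (mirror q) = mostar p q := by
  simp only [mostar, innerSum_mirror, size_mirror]

theorem mirror_straight (n : ℕ) (p : Branch) :
    mirror (straight n p) = straight n (mirror p) := by
  induction n with
  | zero => rfl
  | succ n ih => simp only [straight, mirror, ih]

@[simp] theorem mirror_line (n : ℕ) : mirror (line n) = line n := mirror_straight n nil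

@[simp] theorem mirror_bentLeft (j : ℕ) : mirror (bentLeft j) = bentRight j := by
  simp only [bentLeft, bentRight, mirror_straight, mirror]

@[simp] theorem mirror_bentRight (j : ℕ) : mirror (bentRight j) = bentLeft j := by
  simp only [bentLeft, bentRight, mirror_straight, mirror]

/-- The smallest turn: two hexagons, the first of which turns. -/
theorem excess_turn_leaf {q : Branch} (h : 2 ≤ size q) :
    excess (node (line 1) nil nil) q = size q + 1 := by
  simp only [line, straight, excess, innerSum, cell, edge, tilt, left, right, size, run, base]
  simp only [zero_add, add_zero, sub_zero, zero_sub]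
  have h1 : |1 - size q| = size q - 1 := by rw [abs_sub_comm]; exact abs_of_nonneg (by omega)
  have h2 : |-size q| = size q := by rw [abs_neg]; exact abs_of_nonneg (by omega)
  have h3 : |-(1 + size q)| = size q + 1 := by rw [abs_neg, abs_of_nonneg] <;> omega
  have h4 : |1 - (1 + size q)| = size q := by rw [abs_sub_comm, abs_of_nonneg] <;> omega
  have h5 : |size q| = size q := abs_of_nonneg (by omega)
  simp only [h1, h2, h3, h4, h5]; ring_nf

theorem straight_succ_comm (n : ℕ) (p : Branch) :
    straight n (node nil p nil) = node nil (straight n p) nil := by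
  induction n with
  | zero => rfl
  | succ n ih => simp only [straight, ih]

/-! ### Classification by the excess -/

/-- The possibilities for the excess `e` of a branch `p` that contains at most half of the `N`
hexagons: `p` is linear, or it is linear up to a turn before the last hexagon, or it first turns
somewhere and has a larger excess, or its excess is at least `2 * N`, as is the case if it has a
hexagon with three quadrilaterals. In the third case all hexagons of `p` that are off the straight
cut through `p` lie on one side. -/
inductive ExcessType (N : ℤ) (p : Branch) (e : ℤ) : Prop
  | line (n : ℕ) (hp : p = line (n + 1)) (he : e = 0)
  | bent (j : ℕ) (hp : p = bentLeft j ∨ p = bentRight j) (he : e = N - 1)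
  | turning (ht : |left p - right p| = size p - run p) (h1 : 1 ≤ size p - run p) (he : N ≤ e)
  | branching (he : 2 * N ≤ e)

theorem ExcessType.nonneg {N e : ℤ} {p : Branch} (h : ExcessType N p e) (hN : 1 ≤ N) : 0 ≤ e := by
  cases h <;> omega

theorem ExcessType.mirror {N e : ℤ} {p : Branch} (h : ExcessType N p.mirror e) :
    ExcessType N p e := by
  cases h with
  | line n hp he =>
    refine .line n ?_ he
    rw [← mirror_mirror p, hp, mirror_line]
  | bent j hp he =>
    refine .bent j ?_ he
    rw [← mirror_mirror p]
    rcases hp with hp | hp <;> rw [hp] <;> simp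
  | turning ht h1 he =>
    refine .turning ?_ (by simpa using h1) he
    rw [abs_sub_comm]; simpa using ht
  | branching he => exact .branching he

theorem ExcessType.straight {N e : ℤ} {m : Branch} (h : ExcessType N m e) :
    ExcessType N (node nil m nil) e := by
  cases h with
  | line n hp he => exact .line (n + 1) (by rw [hp]; rfl) he
  | bent j hp he =>
    refine .bent (j + 1) ?_ he
    rcases hp with hp | hp
    · exact .inl (by rw [hp]; rfl)
    · exact .inr (by rw [hp]; rfl)
  | turning ht h1 he =>
    refine .turning ?_ ?_ he
    · simp only [left, right, size, run]
      rw [zero_add, zero_add, ht]; ring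
    · simp only [size, run]; omega
  | branching he => exact .branching he

/-- The induction step of `excessType` for a branch whose first hexagon turns left. -/
theorem excessType_turn {l q : Branch} (hl : l ≠ nil) (h : size l + 1 ≤ size q)
    (ih : ExcessType (size l + 1 + size q) l (excess l (node nil nil q))) :
    ExcessType (size l + 1 + size q) (node l nil nil) (excess (node l nil nil) q) := by
  have hl0 := size_pos hl
  have hr0 := run_pos hl
  have key := excess_left hl h
  have h0 := ih.nonneg (by omega)
  have hge : 0 ≤ (run l - 1) * (size q - size l + run l) :=
    mul_nonneg (by omega) (by omega)
  have ht : |left (node l nil nil) - right (node l nil nil)| =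
      size (node l nil nil) - run (node l nil nil) := by
    simp only [left, right, size, run, add_zero, sub_zero]
    rw [abs_of_nonneg] <;> omega
  have h1 : 1 ≤ size (node l nil nil) - run (node l nil nil) := by
    simp only [size, run]; omega
  cases ih with
  | line n hp he =>
    subst hp
    rcases n with _ | n
    · refine .bent 0 (.inl rfl) ?_
      rw [excess_turn_leaf]
      · simp [size, line, straight]; ring
      · simp [size, line, straight] at h; omega
    · refine .turning ht h1 ?_
      have e1 : ∀ n, run (line n) = size (line n) := by
        intro n; induction n with
        | zero => rfl
        | succ n ih => simp only [line, straight, run, size] at ih ⊢; omega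
      rw [e1] at key
      have : 2 ≤ size (line (n + 1 + 1)) := by rw [size_line]; push_cast; omega
      nlinarith
  | bent j hp he => exact .turning ht h1 (by nlinarith)
  | turning _ _ he => exact .turning ht h1 (by nlinarith)
  | branching he => exact .branching (by nlinarith)

/-- The excess increases with every turn. The induction goes from a branch to the branches at its
first hexagon, and the condition that at least half of the phenylene is outside is inherited. -/
theorem excessType {p : Branch} (q : Branch) (hp : Wf p) (h0 : p ≠ nil) (h : size p ≤ size q) :
    ExcessType (size p + size q) p (excess p q) := by
  induction p generalizing q with
  | nil => exact absurd rfl h0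
  | node l m r ihl ihm ihr =>
    obtain ⟨h1, hl, hm, hr⟩ := hp
    by_cases hm0 : m = nil
    · subst hm0
      by_cases hl0 : l = nil
      · subst hl0
        by_cases hr0 : r = nil
        · subst hr0
          refine .line 0 rfl (excess_leaf q ?_)
          simpa [size] using h
        · simp only [size, add_zero] at h
          apply ExcessType.mirror
          rw [← excess_mirror]
          have := excessType_turn (l := mirror r) (q := mirror q) (by simpa using hr0)
            (by simp only [size_mirror]; omega) (by
              have := ihr (node q nil nil) hr hr0 (by simp only [size]; omega)
              rw [← excess_mirror] at this
              have h' : mirror (node q nil nil) = node nil nil (mirror q) := rfl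
              rw [h', ← mirror_mirror r] at this
              have := this.mirror
              convert this using 1
              · simp only [size, size_mirror]; ring
              · rw [mirror_mirror])
          have hN : size (node nil nil r) + size q = size (mirror r) + 1 + size (mirror q) := by
            simp only [size, size_mirror]; ring
          rw [hN]
          exact this
      · by_cases hr0 : r = nil
        · subst hr0
          simp only [size, add_zero] at h
          have := excessType_turn (l := l) (q := q) hl0
            (by omega) (by
              have := ihl (node nil nil q) hl hl0 (by simp only [size]; omega)
              convert this using 1
              simp only [size]; ring)
          convert this using 1
          simp only [size]; ring
        · have hl1 := size_pos hl0
          have hr1 := size_pos hr0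
          simp only [size, add_zero] at h
          have il := ihl (node r nil q) hl hl0 (by simp only [size]; omega)
          have ir := ihr (node q nil l) hr hr0 (by simp only [size]; omega)
          have := excess_both hl0 hr0 (q := q) (by omega)
          have n1 := il.nonneg (by simp only [size]; omega)
          have n2 := ir.nonneg (by simp only [size]; omega)
          refine .branching ?_
          simp only [size]; omega
    · obtain ⟨rfl, rfl⟩ := h1 hm0
      simp only [size, add_zero] at h
      rw [excess_straight hm0 (by omega)]
      have := ihm (node nil q nil) hm hm0 (by simp only [size]; omega)
      have hN : size (node nil m nil) + size q = size m + size (node nil q nil) := by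
        simp only [size]; ring
      rw [hN]
      exact this.straight

/-! ### Balanced pairs of branches -/

/-- A twelfth of the Mostar index of the linear chain with `N ≥ 4` hexagons. -/
def linearValue (N : ℤ) : ℤ := 6 * (N / 2) * ((N + 1) / 2) - 2 * (N / 2)

/-- The pairs of branches that form `C_L(1, N - 2)` or `C_L(1, N - 4, 1)` with `N` hexagons. In
`zigzag` both branches bend to the same side as seen from the cut, so the two turns have opposite
directions when the chain is walked through from one end to the other. -/
inductive MinimalShape (p q : Branch) : Prop
  | bent_line (i j : ℕ) (hp : p = bentLeft i ∨ p = bentRight i) (hq : q = line j)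
  | line_bent (i j : ℕ) (hp : p = line i) (hq : q = bentLeft j ∨ q = bentRight j)
  | zigzag (i j : ℕ)
      (h : (p = bentLeft i ∧ q = bentLeft j) ∨ (p = bentRight i ∧ q = bentRight j))

theorem linearValue_even (k : ℤ) : linearValue (2 * k) = 6 * k ^ 2 - 2 * k := by
  have h1 : 2 * k / 2 = k := by omega
  have h2 : (2 * k + 1) / 2 = k := by omega
  rw [linearValue, h1, h2]; ring

theorem linearValue_odd (k : ℤ) : linearValue (2 * k + 1) = 6 * k ^ 2 + 4 * k := by
  have h1 : (2 * k + 1) / 2 = k := by omega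
  have h2 : (2 * k + 1 + 1) / 2 = k + 1 := by omega
  rw [linearValue, h1, h2]; ring

theorem mostar_eq (p q : Branch) : mostar p q =
    |size p - size q| + base (size p + size q) (size p) + base (size p + size q) (size q) +
      (excess p q + excess q p + (run p + run q) * tilt p q) := by
  rw [mostar, excess, excess, tilt_comm q p, add_comm (size q) (size p)]; ring

/-- If the two branches differ in size by at most one, then the part of `mostar p q` that does not
depend on their shapes is the value of the linear chain. -/
theorem mostar_eq_of_balanced {p q : Branch} (h : size p = size q ∨ size q = size p + 1) :
    mostar p q = linearValue (size p + size q) +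
      (excess p q + excess q p + (run p + run q) * tilt p q) := by
  rw [mostar_eq]
  congr 1
  rcases h with h | h
  · have h1 : size p + size q = 2 * size q := by omega
    rw [h1, h, linearValue_even, sub_self, abs_zero, base]; ring
  · have h1 : size p + size q = 2 * size p + 1 := by omega
    have h2 : |size p - size q| = 1 := by rw [abs_sub_comm, abs_of_nonneg] <;> omega
    rw [h1, linearValue_odd, h2, h, base, base]; ring

theorem run_line (n : ℕ) : run (line n) = n := by
  induction n with
  | zero => rfl
  | succ n ih => simp only [line, straight, run] at ih ⊢; push_cast; omega

theorem left_sub_right_line (n : ℕ) : left (line n) - right (line n) = 0 := by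
  have := size_eq (line n); have := left_nonneg (line n); have := right_nonneg (line n)
  have := run_line n; have := size_line n
  omega

theorem left_straight (n : ℕ) (p : Branch) : left (straight n p) = left p := by
  induction n with
  | zero => rfl
  | succ n ih => simp only [straight, left, size, ih, zero_add]

theorem right_straight (n : ℕ) (p : Branch) : right (straight n p) = right p := by
  induction n with
  | zero => rfl
  | succ n ih => simp only [straight, right, size, ih, zero_add]

theorem run_straight (n : ℕ) (p : Branch) : run (straight n p) = n + run p := by
  induction n with
  | zero => simp [straight]
  | succ n ih => simp only [straight, run, ih]; push_cast; ring

theorem size_straight (n : ℕ) (p : Branch) : size (straight n p) = n + size p := by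
  induction n with
  | zero => simp [straight]
  | succ n ih => simp only [straight, size, ih]; push_cast; ring

theorem left_sub_right_bentLeft (j : ℕ) : left (bentLeft j) - right (bentLeft j) = 1 := by
  simp [bentLeft, left_straight, right_straight, left, right, size_line, size]

theorem left_sub_right_bentRight (j : ℕ) : left (bentRight j) - right (bentRight j) = -1 := by
  simp [bentRight, left_straight, right_straight, left, right, size_line, size]

theorem run_bentLeft (j : ℕ) : run (bentLeft j) = size (bentLeft j) - 1 := by
  simp [bentLeft, run_straight, size_straight, size, run]; ring

theorem run_bentRight (j : ℕ) : run (bentRight j) = size (bentRight j) - 1 := by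
  simp [bentRight, run_straight, size_straight, size, run]; ring

/-- A linear branch does nothing to balance the cut along it, so if `p` has all hexagons that are
off the cut on one side of it, then the cut is unbalanced in all hexagons it divides. -/
theorem le_run_mul_tilt_line {N : ℤ} {p : Branch} (n : ℕ) (hN : size p + size (line n) = N)
    (ht : |left p - right p| = size p - run p) (h1 : 1 ≤ size p - run p)
    (hr : 1 ≤ run p + run (line n)) :
    N - 1 ≤ (run p + run (line n)) * tilt p (line n) := by
  have h2 : tilt p (line n) = |left p - right p| := by
    have := left_sub_right_line n
    rw [tilt]; congr 1; omega
  rw [h2, ht]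
  have h3 := run_line n
  have h4 := size_line n
  nlinarith [mul_nonneg (sub_nonneg.2 h1) (sub_nonneg.2 hr)]

theorem abs_left_sub_right_bent {j : ℕ} {p : Branch} (hp : p = bentLeft j ∨ p = bentRight j) :
    |left p - right p| = size p - run p ∧ size p - run p = 1 := by
  rcases hp with rfl | rfl
  · rw [left_sub_right_bentLeft, run_bentLeft]; norm_num
  · rw [left_sub_right_bentRight, run_bentRight]; norm_num

/-- The minimum of the part of `mostar p q` that depends on the shapes, if neither branch contains
more than half of the hexagons, in the sense that both are subject to `excessType`. -/
theorem excess_add_bound {N e e' : ℤ} {p q : Branch} (hN : size p + size q = N)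
    (hN4 : 4 ≤ N) (hp0 : p ≠ nil) (hq0 : q ≠ nil)
    (hp : ExcessType N p e) (hq : ExcessType N q e') :
    (∃ i j, p = line i ∧ q = line j) ∨
      (2 * (N - 1) ≤ e + e' + (run p + run q) * tilt p q ∧
        (e + e' + (run p + run q) * tilt p q = 2 * (N - 1) → MinimalShape p q)) := by
  have rp := run_pos hp0
  have rq := run_pos hq0
  have e0 := hp.nonneg (by omega)
  have e0' := hq.nonneg (by omega)
  have tp : 0 ≤ tilt p q := abs_nonneg _
  have hprod : 0 ≤ (run p + run q) * tilt p q := mul_nonneg (by omega) tp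
  have strict : 2 * (N - 1) < e + e' + (run p + run q) * tilt p q →
      (2 * (N - 1) ≤ e + e' + (run p + run q) * tilt p q ∧
        (e + e' + (run p + run q) * tilt p q = 2 * (N - 1) → MinimalShape p q)) :=
    fun h => ⟨h.le, fun h' => absurd h' h.ne'⟩
  cases hp with
  | branching he => exact .inr (strict (by omega))
  | line i hpi he =>
    cases hq with
    | branching he' => exact .inr (strict (by omega))
    | line j hqj he' => exact .inl ⟨_, _, hpi, hqj⟩
    | bent j hqj he' =>
      right
      obtain ⟨h1, h2⟩ := abs_left_sub_right_bent hqj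
      subst hpi
      have := le_run_mul_tilt_line (i + 1) ((add_comm _ _).trans hN) h1 (by omega) (by omega)
      rw [tilt_comm, add_comm (run q)] at this
      exact ⟨by omega, fun _ => .line_bent _ j rfl hqj⟩
    | turning h1 h2 he' =>
      right
      subst hpi
      have := le_run_mul_tilt_line (i + 1) ((add_comm _ _).trans hN) h1 (by omega) (by omega)
      rw [tilt_comm, add_comm (run q)] at this
      exact strict (by omega)
  | bent i hpi he =>
    right
    obtain ⟨h1, h2⟩ := abs_left_sub_right_bent hpi
    cases hq with
    | branching he' => exact strict (by omega)
    | line j hqj he' =>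
      subst hqj
      have := le_run_mul_tilt_line (j + 1) hN h1 (by omega) (by omega)
      exact ⟨by omega, fun _ => .bent_line i _ hpi rfl⟩
    | bent j hqj he' =>
      refine ⟨by omega, fun h => ?_⟩
      have h0 : (run p + run q) * tilt p q = 0 := by omega
      have h3 : tilt p q = 0 := by
        rcases mul_eq_zero.1 h0 with h | h
        · omega
        · exact h
      have h4 : left p - right p + right q - left q = 0 := abs_eq_zero.1 h3
      have := left_sub_right_bentLeft i
      have := left_sub_right_bentRight i
      have := left_sub_right_bentLeft j
      have := left_sub_right_bentRight j
      rcases hpi with rfl | rfl <;> rcases hqj with rfl | rfl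
      · exact .zigzag i j (.inl ⟨rfl, rfl⟩)
      · omega
      · omega
      · exact .zigzag i j (.inr ⟨rfl, rfl⟩)
    | turning h3 h4 he' => exact strict (by omega)
  | turning h1 h2 he =>
    right
    cases hq with
    | branching he' => exact strict (by omega)
    | line j hqj he' =>
      subst hqj
      have := le_run_mul_tilt_line (j + 1) hN h1 (by omega) (by omega)
      exact strict (by omega)
    | bent j hqj he' => exact strict (by omega)
    | turning h3 h4 he' => exact strict (by omega)

theorem ExcessType.eq_zero_or_le {N e : ℤ} {p : Branch} (h : ExcessType N p e) (hN : 1 ≤ N) :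
    (e = 0 ∧ run p = size p) ∨ N - 1 ≤ e := by
  cases h with
  | line n hp he => left; subst hp; exact ⟨he, by rw [run_line, size_line]⟩
  | bent j hp he => right; omega
  | turning ht h1 he => right; omega
  | branching he => right; omega

theorem innerSum_eq (p q : Branch) :
    innerSum p q = run p * tilt p q + base (size p + size q) (size p) + excess p q := by
  rw [excess]; ring

/-! ### A central hexagon that is not passed straight -/

/-- A phenylene with a turn-hexagon exactly in the middle exceeds the bound: of the two cuts along
its branches, each has a full branch on one side. -/
theorem lt_mostar_of_center_turn {p l : Branch} (hp : Wf p) (hl : Wf l)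
    (hpl : size p = size l) (h2 : 2 ≤ size p) :
    linearValue (size p + size (node l nil nil)) + 2 * (size p + size (node l nil nil) - 1) <
      mostar p (node l nil nil) := by
  have hp0 : p ≠ nil := by rintro rfl; simp [size] at h2
  have hl0 : l ≠ nil := by rintro rfl; rw [hpl] at h2; simp [size] at h2
  have tp := (excessType (node l nil nil) hp hp0 (by simp only [size]; omega)).eq_zero_or_le
    (by simp only [size]; omega)
  have tl := (excessType (node nil nil p) hl hl0 (by simp only [size]; omega)).eq_zero_or_le
    (by simp only [size]; omega)
  have rp := run_pos hp0
  have rl := run_pos hl0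
  have hN : size p + size (node l nil nil) = 2 * size p + 1 := by simp only [size]; omega
  have hN' : size l + size (node nil nil p) = 2 * size p + 1 := by simp only [size]; omega
  rw [hN] at tp ⊢
  rw [hN'] at tl
  rw [linearValue_odd, mostar, innerSum_eq p, hN]
  simp only [innerSum, edge_nil, edge_of_ne hl0]
  rw [innerSum_eq l, hN']
  have e1 : |size p - size (node l nil nil)| = 1 := by
    rw [abs_sub_comm, abs_of_nonneg] <;> simp only [size] <;> omega
  have e2 : |size l - size (node nil nil p)| = 1 := by
    rw [abs_sub_comm, abs_of_nonneg] <;> simp only [size] <;> omega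
  have e3 : cell p l nil nil = tilt p (node l nil nil) + tilt l (node nil nil p) := by
    have : size l + size nil + left nil - size p - right nil = 0 := by
      simp only [size, left, right]; omega
    rw [cell, this, abs_zero, add_zero, tilt, tilt, abs_sub_comm]
    simp only [left, right, size]
    congr 1
    · congr 1; ring
    · rw [← abs_neg]; congr 1; ring
  rw [e1, e2, e3]
  -- The cut along `p` has all of `l` on one side, and at most the hexagons of `p` outside its
  -- run on the other one.
  have X1 : run p ≤ tilt p (node l nil nil) := by
    have := size_eq p; have := left_nonneg p; have := right_nonneg p
    refine le_trans ?_ (neg_le_abs _); simp only [left, right, size]; omega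
  have X2 : run l ≤ tilt l (node nil nil p) := by
    have := size_eq l; have := left_nonneg l; have := right_nonneg l
    refine le_trans ?_ (le_abs_self _); simp only [left, right, size]; omega
  have Y1 : (run p + 1) * run p ≤ (run p + 1) * tilt p (node l nil nil) :=
    mul_le_mul_of_nonneg_left X1 (by omega)
  have Y2 : (run l + 1) * run l ≤ (run l + 1) * tilt l (node nil nil p) :=
    mul_le_mul_of_nonneg_left X2 (by omega)
  rw [← hpl] at tl ⊢
  simp only [base]
  -- If `p` is linear, then `run p = size p` makes the cut along `p` expensive. Otherwise `p` has
  -- a positive excess, which is at least `N - 1 = 2 * size p`.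
  have Z1 : 3 * size p ≤ excess p (node l nil nil) + (run p + 1) * tilt p (node l nil nil) ∨
      2 * size p + 1 ≤ excess p (node l nil nil) + (run p + 1) * tilt p (node l nil nil) := by
    rcases tp with ⟨h3, h4⟩ | h3
    · left; rw [h4] at Y1 ⊢; nlinarith
    · right; nlinarith
  have Z2 : 3 * size p ≤ excess l (node nil nil p) + (run l + 1) * tilt l (node nil nil p) ∨
      2 * size p + 1 ≤ excess l (node nil nil p) + (run l + 1) * tilt l (node nil nil p) := by
    rcases tl with ⟨h3, h4⟩ | h3
    · left; rw [h4] at Y2 ⊢; nlinarith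
    · right; nlinarith
  have Z1' : 2 * size p + 1 ≤ excess p (node l nil nil) + (run p + 1) * tilt p (node l nil nil) := by
    omega
  have Z2' : 2 * size p + 1 ≤ excess l (node nil nil p) + (run l + 1) * tilt l (node nil nil p) := by
    omega
  linarith

/-- The contribution of one of the branches at a central hexagon with three branches. Here `|x|` is
the imbalance of the cut along the branch, and the hypothesis `hx` expresses that the hexagons that
are not divided by this cut lie on one side or the other: if they are odd in number, then `x` is
not `0`. -/
theorem two_le_of_odd {N e : ℤ} {p : Branch} (h : ExcessType N p e) (hN : 3 ≤ N) (hp : p ≠ nil)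
    {x : ℤ} (hx : (x - (size p - run p)) % 2 = (N - 1 - size p) % 2)
    (hodd : (N - 1 - size p) % 2 = 1) : 2 ≤ e + (run p + 1) * |x| := by
  have rp := run_pos hp
  have h0 := h.nonneg (by omega)
  rcases h.eq_zero_or_le (by omega) with ⟨_, h2⟩ | h1
  · have : x ≠ 0 := by rintro rfl; omega
    have : 1 ≤ |x| := Int.one_le_abs this
    nlinarith
  · have : 0 ≤ (run p + 1) * |x| := mul_nonneg (by omega) (abs_nonneg x)
    omega

theorem le_sum_mul_of_sum_eq {k a b c : ℤ} (ha : a ≤ k) (hb : b ≤ k) (hc : c ≤ k) (ha1 : 1 ≤ a)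
    (hb1 : 1 ≤ b) (hc1 : 1 ≤ c) (h : a + b + c = 2 * k) :
    k - 1 ≤ (k - a) * (k - b) + (k - b) * (k - c) + (k - c) * (k - a) := by
  obtain rfl : c = 2 * k - a - b := by omega
  rcases eq_or_lt_of_le ha with rfl | ha'
  · nlinarith [mul_nonneg (sub_nonneg.2 hb1) (sub_nonneg.2 hc1)]
  · nlinarith [mul_nonneg (sub_nonneg.2 hb) (sub_nonneg.2 hc),
      mul_nonneg (sub_nonneg.2 (Int.add_one_le_iff.2 ha')) (sub_nonneg.2 ha1)]

theorem eq_line_one {p : Branch} (h : size p = 1) : p = line 1 := by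
  cases p with
  | nil => simp [size] at h
  | node l m r =>
    have h1 := size_nonneg l; have h2 := size_nonneg m; have h3 := size_nonneg r
    simp only [size] at h
    have hl : l = nil := by by_contra hc; have := size_pos hc; omega
    have hm : m = nil := by by_contra hc; have := size_pos hc; omega
    have hr : r = nil := by by_contra hc; have := size_pos hc; omega
    subst hl hm hr; rfl

/-- `mostar` for a central hexagon with three branches, in a form that is symmetric in the
branches. -/
theorem mostar_center_branching {p l r : Branch} (hl0 : l ≠ nil) (hr0 : r ≠ nil)
    {N : ℤ} (hN : size p + size l + size r + 1 = N)
    (hpN : 2 * size p ≤ N) (hlN : 2 * size l ≤ N) (hrN : 2 * size r ≤ N) :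
    mostar p (node l nil r) =
      (base N (size p) + (N - 2 * size p)) + (base N (size l) + (N - 2 * size l)) +
      (base N (size r) + (N - 2 * size r)) +
      (excess p (node l nil r) + (run p + 1) * |size l + right p - size r - left p|) +
      (excess l (node r nil p) + (run l + 1) * |size r + right l - size p - left l|) +
      (excess r (node p nil l) + (run r + 1) * |size l + left r - size p - right r|) := by
  rw [mostar, innerSum_eq p]
  simp only [innerSum, edge_nil, edge_of_ne hl0, edge_of_ne hr0]
  rw [innerSum_eq l, innerSum_eq r]
  have n1 : size p + size (node l nil r) = N := by simp only [size]; omega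
  have n2 : size l + size (node r nil p) = N := by simp only [size]; omega
  have n3 : size r + size (node p nil l) = N := by simp only [size]; omega
  have e1 : |size p - size (node l nil r)| = N - 2 * size p := by
    rw [abs_sub_comm, abs_of_nonneg] <;> omega
  have e2 : |size l - size (node r nil p)| = N - 2 * size l := by
    rw [abs_sub_comm, abs_of_nonneg] <;> omega
  have e3 : |size r - size (node p nil l)| = N - 2 * size r := by
    rw [abs_sub_comm, abs_of_nonneg] <;> omega
  have t1 : tilt p (node l nil r) = |size l + right p - size r - left p| := by
    simp only [tilt, left, right]; rw [← abs_neg]; congr 1; ring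
  have t2 : tilt l (node r nil p) = |size r + right l - size p - left l| := by
    simp only [tilt, left, right]; rw [← abs_neg]; congr 1; ring
  have t3 : tilt r (node p nil l) = |size l + left r - size p - right r| := by
    simp only [tilt, left, right]; congr 1; ring
  have c1 : cell p l nil r = |size l + right p - size r - left p| +
      |size l + left r - size p - right r| + |size r + right l - size p - left l| := by
    simp only [cell, size, left, right]
    congr 1
    · congr 1
      · congr 1; ring
      · congr 1; ring
    · congr 1; ring
  rw [n1, n2, n3, e1, e2, e3, t1, t2, t3, c1]; ring

/-- Apart from `P_L(1, 1, 1)`, phenylenes that have a central hexagon with three branches exceed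
the bound. The main term depends on the sizes only, and suffices except for `N ≤ 7`, where the
parity argument of `two_le_of_odd` is added. -/
theorem mostar_bound_of_center_branching {p l r : Branch} (hp : Wf p) (hl : Wf l) (hr : Wf r)
    (hp0 : p ≠ nil) (hl0 : l ≠ nil) (hr0 : r ≠ nil)
    {N : ℤ} (hN : size p + size l + size r + 1 = N) (hN4 : 4 ≤ N)
    (hpN : 2 * size p < N) (hlN : 2 * size l < N) (hrN : 2 * size r < N) :
    linearValue N + 2 * (N - 1) < mostar p (node l nil r) ∨
      N = 4 ∧ p = line 1 ∧ l = line 1 ∧ r = line 1 := by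
  have sp := size_pos hp0
  have sl := size_pos hl0
  have sr := size_pos hr0
  rw [mostar_center_branching hl0 hr0 hN hpN.le hlN.le hrN.le]
  have tp := excessType (node l nil r) hp hp0 (by simp only [size]; omega)
  have tl := excessType (node r nil p) hl hl0 (by simp only [size]; omega)
  have tr := excessType (node p nil l) hr hr0 (by simp only [size]; omega)
  have n1 : size p + size (node l nil r) = N := by simp only [size]; omega
  have n2 : size l + size (node r nil p) = N := by simp only [size]; omega
  have n3 : size r + size (node p nil l) = N := by simp only [size]; omega
  rw [n1] at tp
  rw [n2] at tl
  rw [n3] at tr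
  have op := two_le_of_odd tp (by omega) hp0 (x := size l + right p - size r - left p)
    (by have := size_eq p; omega)
  have ol := two_le_of_odd tl (by omega) hl0 (x := size r + right l - size p - left l)
    (by have := size_eq l; omega)
  have odr := two_le_of_odd tr (by omega) hr0 (x := size l + left r - size p - right r)
    (by have := size_eq r; omega)
  have rp := run_pos hp0
  have rl := run_pos hl0
  have rr := run_pos hr0
  have zp : 0 ≤ excess p (node l nil r) + (run p + 1) * |size l + right p - size r - left p| :=
    add_nonneg (tp.nonneg (by omega)) (mul_nonneg (by omega) (abs_nonneg _))
  have zl : 0 ≤ excess l (node r nil p) + (run l + 1) * |size r + right l - size p - left l| :=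
    add_nonneg (tl.nonneg (by omega)) (mul_nonneg (by omega) (abs_nonneg _))
  have zr : 0 ≤ excess r (node p nil l) + (run r + 1) * |size l + left r - size p - right r| :=
    add_nonneg (tr.nonneg (by omega)) (mul_nonneg (by omega) (abs_nonneg _))
  generalize excess p (node l nil r) + (run p + 1) * |size l + right p - size r - left p| = A at *
  generalize excess l (node r nil p) + (run l + 1) * |size r + right l - size p - left l| = B at *
  generalize excess r (node p nil l) + (run r + 1) * |size l + left r - size p - right r| = C at *
  -- From here on only the sizes `a`, `b`, `c` of the branches and the nonnegative numbers `A`,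
  -- `B`, `C` matter.
  have leaf : size p = 1 → size l = 1 → size r = 1 → p = line 1 ∧ l = line 1 ∧ r = line 1 :=
    fun h1 h2 h3 => ⟨eq_line_one h1, eq_line_one h2, eq_line_one h3⟩
  clear tp tl tr n1 n2 n3 hp hl hr hp0 hl0 hr0 rp rl rr
  generalize size p = a at *
  generalize size l = b at *
  generalize size r = c at *
  obtain ⟨k, rfl | rfl⟩ : ∃ k, N = 2 * k ∨ N = 2 * k + 1 := ⟨N / 2, by omega⟩
  · -- The sizes are at most `k - 1` and their sum is `2 * k - 1`.
    rw [linearValue_even]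
    have hid : (base (2 * k) a + (2 * k - 2 * a)) + (base (2 * k) b + (2 * k - 2 * b)) +
        (base (2 * k) c + (2 * k - 2 * c)) = 6 * k ^ 2 - 2 * k + (6 * k - 8) +
        6 * ((k - 1 - a) * (k - 1 - b) + (k - 1 - b) * (k - 1 - c) +
          (k - 1 - c) * (k - 1 - a)) := by
      obtain rfl : c = 2 * k - 1 - a - b := by omega
      simp only [base]; ring
    rw [hid]
    have y1 := mul_nonneg (show 0 ≤ k - 1 - a by omega) (show 0 ≤ k - 1 - b by omega)
    have y2 := mul_nonneg (show 0 ≤ k - 1 - b by omega) (show 0 ≤ k - 1 - c by omega)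
    have y3 := mul_nonneg (show 0 ≤ k - 1 - c by omega) (show 0 ≤ k - 1 - a by omega)
    rcases eq_or_lt_of_le (show 2 ≤ k by omega) with rfl | hk
    · right
      exact ⟨rfl, leaf (by omega) (by omega) (by omega)⟩
    · left
      rcases eq_or_lt_of_le (show 3 ≤ k by omega) with rfl | hk
      · -- `N = 6`: the main term meets the bound for the sizes 1, 2, 2; the branches of size 2
        -- contribute more.
        have : 2 ≤ A + B + C := by omega
        omega
      · nlinarith
  · -- The sizes are at most `k` and their sum is `2 * k`.
    left
    rw [linearValue_odd]
    have hid : (base (2 * k + 1) a + (2 * k + 1 - 2 * a)) +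
        (base (2 * k + 1) b + (2 * k + 1 - 2 * b)) +
        (base (2 * k + 1) c + (2 * k + 1 - 2 * c)) = 6 * k ^ 2 + 4 * k +
        6 * ((k - a) * (k - b) + (k - b) * (k - c) + (k - c) * (k - a)) := by
      obtain rfl : c = 2 * k - a - b := by omega
      simp only [base]; ring
    rw [hid]
    have key := le_sum_mul_of_sum_eq (show a ≤ k by omega) (show b ≤ k by omega)
      (show c ≤ k by omega) sp sl sr (by omega)
    rcases eq_or_lt_of_le (show 2 ≤ k by omega) with rfl | hk
    · -- `N = 5`: the sizes are 1, 1, 2, and the branches of size 1 contribute more.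
      have : 4 ≤ A + B + C := by omega
      omega
    rcases eq_or_lt_of_le (show 3 ≤ k by omega) with rfl | hk
    · -- `N = 7`: the main term meets the bound for the sizes 1, 2, 3; the branches of odd size
      -- contribute more.
      have ha : a = 1 ∨ a = 2 ∨ a = 3 := by omega
      have hb : b = 1 ∨ b = 2 ∨ b = 3 := by omega
      obtain rfl : c = 6 - a - b := by omega
      rcases ha with rfl | rfl | rfl <;> rcases hb with rfl | rfl | rfl <;> omega
    · nlinarith

/-! ### The bound for pairs of branches -/

/-- The theorem in terms of branches: for a balanced cut into `p` and `q`, the phenylene is a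
linear chain, or it satisfies the bound with equality only in the minimal shapes, or it is
`P_L(1, 1, 1)`. -/
theorem mostar_bound {p q : Branch} (hp : Wf p) (hq : Wf q) (hp0 : p ≠ nil) (hq0 : q ≠ nil)
    {N : ℤ} (hN : size p + size q = N) (hN4 : 4 ≤ N)
    (hb : size p = size q ∨ ∃ l m r, q = node l m r ∧ 2 * size p < N ∧ 2 * size l < N ∧
      2 * size m < N ∧ 2 * size r < N) :
    (∃ i j, p = line i ∧ q = line j) ∨
      (linearValue N + 2 * (N - 1) ≤ mostar p q ∧
        (mostar p q = linearValue N + 2 * (N - 1) → MinimalShape p q)) ∨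
      (N = 4 ∧ p = line 1 ∧ q = node (line 1) nil (line 1)) := by
  have conclude : (size p = size q ∨ size q = size p + 1) → ExcessType N p (excess p q) →
      ExcessType N q (excess q p) → (∃ i j, p = line i ∧ q = line j) ∨
      (linearValue N + 2 * (N - 1) ≤ mostar p q ∧
        (mostar p q = linearValue N + 2 * (N - 1) → MinimalShape p q)) := by
    intro h1 tp tq
    rw [mostar_eq_of_balanced h1, hN]
    rcases excess_add_bound hN hN4 hp0 hq0 tp tq with h | ⟨h2, h3⟩
    · exact .inl h
    · exact .inr ⟨by omega, fun h => h3 (by omega)⟩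
  rcases hb with h | ⟨l, m, r, rfl, h1, h2, h3, h4⟩
  · have tp := excessType q hp hp0 h.le
    have tq := excessType p hq hq0 h.ge
    rw [hN] at tp
    rw [add_comm, hN] at tq
    rcases conclude (.inl h) tp tq with h | h
    · exact .inl h
    · exact .inr (.inl h)
  · obtain ⟨hm', hl, hm, hr⟩ := hq
    have sp := size_pos hp0
    by_cases hm0 : m = nil
    · subst hm0
      by_cases hl0 : l = nil
      · subst hl0
        by_cases hr0 : r = nil
        · subst hr0
          simp only [size] at hN; omega
        · have hs : size p = size r := by simp only [size] at hN; omega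
          have := lt_mostar_of_center_turn hp.mirror hr.mirror (by simpa using hs)
            (by simp only [size] at hN; simp only [size_mirror]; omega)
          have hmir : node (mirror r) nil nil = mirror (node nil nil r) := rfl
          rw [hmir, mostar_mirror, size_mirror, size_mirror, hN] at this
          exact .inr (.inl ⟨this.le, fun h => absurd h this.ne'⟩)
      · by_cases hr0 : r = nil
        · subst hr0
          have hs : size p = size l := by simp only [size] at hN; omega
          have := lt_mostar_of_center_turn hp hl hs (by simp only [size] at hN; omega)
          rw [hN] at this
          exact .inr (.inl ⟨this.le, fun h => absurd h this.ne'⟩)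
        · rcases mostar_bound_of_center_branching hp hl hr hp0 hl0 hr0 (N := N)
            (by simp only [size] at hN; omega) hN4 h1 h2 h4 with h | ⟨h5, rfl, rfl, rfl⟩
          · exact .inr (.inl ⟨h.le, fun h' => absurd h' h.ne'⟩)
          · exact .inr (.inr ⟨h5, rfl, rfl⟩)
    · -- The central hexagon is passed straight, so it may be counted on either side of the cut.
      obtain ⟨rfl, rfl⟩ := hm' hm0
      have hs : size p = size m := by simp only [size] at hN; omega
      have hN' : size (node nil m nil) = size m + 1 := by simp only [size]; omega
      have tp := excessType (node nil m nil) hp hp0 (by omega)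
      have tq := (excessType (node nil p nil) hm hm0 (by simp only [size]; omega)).straight
      rw [hN] at tp
      have hN'' : size m + size (node nil p nil) = N := by simp only [size] at hN ⊢; omega
      rw [← excess_straight hm0 (by omega), hN''] at tq
      rcases conclude (.inr (by omega)) tp tq with h | h
      · exact .inl h
      · exact .inr (.inl h)

/-! ### Values of the extremal phenylenes -/

theorem excess_straight_iter {m q : Branch} (n : ℕ) (hm : m ≠ nil)
    (h : n + size m ≤ size q + 1) : excess (straight n m) q = excess m (straight n q) := by
  induction n generalizing q with
  | zero => rfl
  | succ n ih =>
    push_cast at h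
    have h0 : straight n m ≠ nil := by
      cases n with
      | zero => exact hm
      | succ n => exact Branch.noConfusion
    rw [straight, excess_straight h0 (by rw [size_straight]; omega),
      ih (by simp only [size]; omega), straight_succ_comm, straight]

theorem excess_line {q : Branch} (n : ℕ) (h : n ≤ size q) : excess (line (n + 1)) q = 0 := by
  have h1 : line (n + 1) = straight n (node nil nil nil) := (straight_succ_comm n nil).symm
  have hq : 1 ≤ size (straight n q) ∨ n = 0 ∧ size q = 0 := by
    have := size_nonneg q
    rw [size_straight]; omega
  rw [h1, excess_straight_iter n Branch.noConfusion (by simp only [size]; omega)]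
  rcases hq with hq | ⟨rfl, hq⟩
  · exact excess_leaf _ hq
  · have hq' : q = nil := by
      by_contra hc; have := size_pos hc; omega
    subst hq'; rfl

theorem excess_bentLeft {q : Branch} (n : ℕ) (h : n + 1 ≤ size q) (h2 : 2 ≤ size q) :
    excess (bentLeft n) q = n + size q + 1 := by
  rw [bentLeft, excess_straight_iter n Branch.noConfusion, excess_turn_leaf, size_straight]
  · rw [size_straight]; omega
  · simp only [size, size_line]; push_cast; omega

theorem size_bentLeft (j : ℕ) : size (bentLeft j) = j + 2 := by
  simp only [bentLeft, size_straight, size]; push_cast; ring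

theorem mostar_line_line {i j : ℕ} (h : j = i ∨ j = i + 1) (hi : 1 ≤ i) :
    mostar (line i) (line j) = linearValue (i + j) := by
  have h1 := size_line i
  have h2 := size_line j
  have h3 := left_sub_right_line i
  have h4 := left_sub_right_line j
  have ht : tilt (line i) (line j) = 0 := by rw [tilt, abs_eq_zero]; omega
  rw [mostar_eq_of_balanced (by omega), ht, h1, h2]
  obtain ⟨i, rfl⟩ := Nat.exists_eq_add_of_le' hi
  obtain ⟨j, rfl⟩ := Nat.exists_eq_add_of_le' (show 1 ≤ j by omega)
  rw [excess_line i (by omega), excess_line j (by omega)]; ring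

theorem mostar_bentLeft_line {i j : ℕ} (h : j = i + 2 ∨ j = i + 3) :
    mostar (bentLeft i) (line j) = linearValue (i + 2 + j) + 2 * (i + 1 + j) := by
  have h1 := size_bentLeft i
  have h2 := size_line j
  have h3 := left_sub_right_bentLeft i
  have h4 := left_sub_right_line j
  have ht : tilt (bentLeft i) (line j) = 1 := by
    have : left (bentLeft i) - right (bentLeft i) + right (line j) - left (line j) = 1 := by omega
    rw [tilt, this, abs_one]
  rw [mostar_eq_of_balanced (by omega), ht, run_bentLeft, run_line, h1, h2,
    excess_bentLeft _ (by omega) (by omega)]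
  obtain ⟨j, rfl⟩ := Nat.exists_eq_add_of_le' (show 1 ≤ j by omega)
  rw [excess_line j (by omega), h2]; push_cast; ring

theorem mostar_zigzag {i j : ℕ} (h : j = i ∨ j = i + 1) :
    mostar (bentLeft i) (bentLeft j) = linearValue (i + 2 + (j + 2)) + 2 * (i + j + 3) := by
  have h1 := size_bentLeft i
  have h2 := size_bentLeft j
  have h3 := left_sub_right_bentLeft i
  have h4 := left_sub_right_bentLeft j
  have ht : tilt (bentLeft i) (bentLeft j) = 0 := by rw [tilt, abs_eq_zero]; omega
  rw [mostar_eq_of_balanced (by omega), ht, h1, h2,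
    excess_bentLeft _ (by omega) (by omega), excess_bentLeft _ (by omega) (by omega), h1, h2]
  ring

theorem mostar_star : mostar (line 1) (node (line 1) nil (line 1)) = 24 := by
  decide

end Branch

open Branch

section

variable {ι : Type*} {T : SimpleGraph ι} {side : ι → ι → ZMod 6}

/-! ### Rooted trees -/

theorem exists_adj_dist_add_one (hT : T.IsTree) {a x : ι} (h : x ≠ a) :
    ∃ c, T.Adj x c ∧ T.dist a c + 1 = T.dist a x := by
  obtain ⟨w, hw⟩ := hT.connected.exists_walk_length_eq_dist x a
  cases w with
  | nil => exact absurd rfl h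
  | cons hadj w =>
    rename_i c
    refine ⟨c, hadj, ?_⟩
    have h1 := SimpleGraph.dist_le w
    have h2 := hT.dist_eq_dist_add_one_of_adj a hadj
    rw [SimpleGraph.Walk.length_cons] at hw
    rw [SimpleGraph.dist_comm] at h1 hw
    omega

theorem eq_of_adj_of_dist_add_one (hT : T.IsTree) {a x c c' : ι} (h : T.Adj x c) (h' : T.Adj x c')
    (hd : T.dist a c + 1 = T.dist a x) (hd' : T.dist a c' + 1 = T.dist a x) : c = c' := by
  obtain ⟨w, hw⟩ := hT.connected.exists_walk_length_eq_dist a c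
  obtain ⟨w', hw'⟩ := hT.connected.exists_walk_length_eq_dist a c'
  have p : (w.concat h.symm).IsPath :=
    SimpleGraph.Walk.isPath_of_length_eq_dist _ (by simp [hw, hd])
  have p' : (w'.concat h'.symm).IsPath :=
    SimpleGraph.Walk.isPath_of_length_eq_dist _ (by simp [hw', hd'])
  have := (hT.isAcyclic.subsingleton_path a x).elim ⟨_, p⟩ ⟨_, p'⟩
  have h2 := congrArg (fun q : T.Path a x => q.1.penultimate) this
  simpa using h2

open Classical in
/-- The neighbour of `x` that is next on the path from `x` to `a` in a tree; it is `a` itself if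
`x = a`. -/
noncomputable def parent (T : SimpleGraph ι) (a x : ι) : ι :=
  if h : ∃ c, T.Adj x c ∧ T.dist a c + 1 = T.dist a x then h.choose else x

theorem adj_parent (hT : T.IsTree) {a x : ι} (h : x ≠ a) : T.Adj x (parent T a x) := by
  have := exists_adj_dist_add_one hT h
  rw [parent, dif_pos this]; exact this.choose_spec.1

theorem dist_parent (hT : T.IsTree) {a x : ι} (h : x ≠ a) :
    T.dist a (parent T a x) + 1 = T.dist a x := by
  have := exists_adj_dist_add_one hT h
  rw [parent, dif_pos this]; exact this.choose_spec.2

theorem ne_of_dist_add_one {a x c : ι} (hd : T.dist a c + 1 = T.dist a x) : x ≠ a := by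
  rintro rfl; simp at hd

theorem parent_eq (hT : T.IsTree) {a x c : ι} (h : T.Adj x c)
    (hd : T.dist a c + 1 = T.dist a x) : parent T a x = c :=
  have hx := ne_of_dist_add_one hd
  eq_of_adj_of_dist_add_one hT (adj_parent hT hx) h (dist_parent hT hx) hd

/-- Of two adjacent vertices, one is the parent of the other. -/
theorem parent_or_parent (hT : T.IsTree) (a : ι) {x y : ι} (h : T.Adj x y) :
    (x ≠ a ∧ parent T a x = y) ∨ (y ≠ a ∧ parent T a y = x) := by
  rcases hT.dist_eq_dist_add_one_of_adj a h with h1 | h1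
  · exact .inl ⟨ne_of_dist_add_one h1.symm, parent_eq hT h h1.symm⟩
  · exact .inr ⟨ne_of_dist_add_one h1.symm, parent_eq hT h.symm h1.symm⟩

theorem parent_induction (hT : T.IsTree) (a : ι) {P : ι → Prop} (h0 : P a)
    (h1 : ∀ x, x ≠ a → P (parent T a x) → P x) (x : ι) : P x := by
  induction hn : T.dist a x generalizing x with
  | zero =>
    have : a = x := (hT.connected.dist_eq_zero_iff).1 hn
    exact this ▸ h0
  | succ n ih =>
    have hx : x ≠ a := by rintro rfl; simp at hn
    exact h1 x hx (ih _ (by have := dist_parent hT hx; omega))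

/-- A connected graph is a tree if each of its edges joins a vertex, other than a fixed one, to the
vertex assigned to it: there are not enough such edges to close a cycle. -/
theorem isTree_of_parent [Finite ι] (hc : T.Connected) (r : ι) (par : ι → ι)
    (h : ∀ x y, T.Adj x y → (x ≠ r ∧ y = par x) ∨ (y ≠ r ∧ x = par y)) : T.IsTree := by
  classical
  rw [SimpleGraph.isTree_iff_connected_and_card]
  refine ⟨hc, le_antisymm ?_ hc.card_vert_le_card_edgeSet_add_one⟩
  have hsub : T.edgeSet ⊆ (fun x => s(x, par x)) '' {x | x ≠ r} := by
    intro e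
    induction e with
    | h x y =>
      intro he
      rcases h x y he with ⟨h1, rfl⟩ | ⟨h1, rfl⟩
      · exact ⟨x, h1, rfl⟩
      · exact ⟨y, h1, Sym2.eq_swap⟩
  have h1 : T.edgeSet.ncard ≤ {x : ι | x ≠ r}.ncard :=
    (Set.ncard_le_ncard hsub (Set.toFinite _)).trans (Set.ncard_image_le (Set.toFinite _))
  have h2 : {x : ι | x ≠ r}.ncard + 1 = Nat.card ι := by
    have := Set.ncard_add_ncard_compl ({x : ι | x ≠ r})
    have h3 : {x : ι | x ≠ r}ᶜ = {r} := by ext; simp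
    rwa [h3, Set.ncard_singleton] at this
  rw [Nat.card_coe_set_eq]
  omega

/-! ### The branches of a phenylene -/

/-- The condition of `IsTreelikePhenylene` on the sides: quadrilaterals at the same hexagon have no
common vertex. -/
def Separated (T : SimpleGraph ι) (side : ι → ι → ZMod 6) : Prop :=
  ∀ a b c, T.Adj a b → T.Adj a c → b ≠ c →
    side a b ≠ side a c ∧ side a b ≠ side a c + 1 ∧ side a c ≠ side a b + 1

theorem Separated.eq_of_side_eq (hs : Separated T side) {a b c : ι} (hb : T.Adj a b)
    (hc : T.Adj a c) (h : side a b = side a c) : b = c := by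
  by_contra hne
  exact (hs a b c hb hc hne).1 h

theorem Separated.side_eq (hs : Separated T side) {a b c : ι} (hb : T.Adj a b)
    (hc : T.Adj a c) (h : b ≠ c) : side a c = side a b + 2 ∨ side a c = side a b + 3 ∨
      side a c = side a b + 4 := by
  obtain ⟨h1, h2, h3⟩ := hs a b c hb hc h
  generalize side a b = i at *
  generalize side a c = j at *
  revert i j; decide

theorem Separated.forall_adj_side_ne (hs : Separated T side) {b c : ι} (h : T.Adj b c) :
    (∀ d, T.Adj b d → side b d ≠ side b c + 1) ∧ (∀ d, T.Adj b d → side b d ≠ side b c + 5) := by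
  constructor <;> intro d hd <;> by_cases hcd : c = d
  · subst hcd; intro h; exact absurd h (by generalize side b c = i; revert i; decide)
  · rcases hs.side_eq h hd hcd with h | h | h <;> rw [h] <;> generalize side b c = i <;>
      revert i <;> decide
  · subst hcd; intro h; exact absurd h (by generalize side b c = i; revert i; decide)
  · rcases hs.side_eq h hd hcd with h | h | h <;> rw [h] <;> generalize side b c = i <;>
      revert i <;> decide

/-- The branch `p` is what hangs at side `i` of the hexagon `b`. -/
def Realizes (T : SimpleGraph ι) (side : ι → ι → ZMod 6) : Branch → ι → ZMod 6 → Prop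
  | nil, b, i => ∀ c, T.Adj b c → side b c ≠ i
  | node l m r, b, i => ∃ c, T.Adj b c ∧ side b c = i ∧ Realizes T side l c (side c b + 2) ∧
      Realizes T side m c (side c b + 3) ∧ Realizes T side r c (side c b + 4)

open Classical in
/-- The set of hexagons in the branch at side `i` of the hexagon `b`. -/
noncomputable def branchAt [Fintype ι] (T : SimpleGraph ι) (side : ι → ι → ZMod 6) (b : ι)
    (i : ZMod 6) : Finset ι :=
  Finset.univ.filter fun x => x ≠ b ∧ side b (parent T x b) = i

section
variable [Fintype ι]

theorem mem_branchAt (hT : T.IsTree) (hs : Separated T side) {b c x : ι} (h : T.Adj b c) :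
    x ∈ branchAt T side b (side b c) ↔ T.dist x c + 1 = T.dist x b := by
  simp only [branchAt, Finset.mem_filter, Finset.mem_univ, true_and]
  constructor
  · rintro ⟨h1, h2⟩
    rw [← hs.eq_of_side_eq (adj_parent hT h1.symm) h h2]
    exact dist_parent hT h1.symm
  · intro h1
    exact ⟨(ne_of_dist_add_one h1).symm, by rw [parent_eq hT h h1]⟩

theorem branchAt_eq_empty (hT : T.IsTree) {b : ι} {i : ZMod 6}
    (h : ∀ c, T.Adj b c → side b c ≠ i) : branchAt T side b i = ∅ := by
  ext x
  simp only [branchAt, Finset.mem_filter, Finset.mem_univ, true_and, Finset.notMem_empty,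
    iff_false, not_and]
  exact fun h1 => h _ (adj_parent hT h1.symm)

/-- The sides of a hexagon, listed from the side `e` on. -/
theorem sum_zmod_six {M : Type*} [AddCommMonoid M] (e : ZMod 6) (g : ZMod 6 → M) :
    ∑ i, g i = g e + g (e + 1) + g (e + 2) + g (e + 3) + g (e + 4) + g (e + 5) := by
  rw [← Equiv.sum_comp (Equiv.addLeft e) g]
  have := Fin.sum_univ_six (fun i : Fin 6 => g (e + (show ZMod 6 from i)))
  simp only [Equiv.coe_addLeft]
  refine this.trans ?_
  congr 1; congr 1; congr 1; congr 1; congr 1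
  exact congrArg g (add_zero e)

theorem sum_eq_add_sum_branchAt {M : Type*} [AddCommMonoid M] (b : ι) (f : ι → M) :
    ∑ x, f x = f b + ∑ i, ∑ x ∈ branchAt T side b i, f x := by
  classical
  rw [← Finset.add_sum_erase _ _ (Finset.mem_univ b)]
  congr 1
  rw [← Finset.sum_fiberwise (Finset.univ.erase b) (fun x => side b (parent T x b)) f]
  refine Finset.sum_congr rfl fun i _ => Finset.sum_congr ?_ fun _ _ => rfl
  ext x
  simp [branchAt, and_comm]

theorem sum_branchAt_add {M : Type*} [AddCommMonoid M] (hT : T.IsTree) (hs : Separated T side)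
    {b c : ι} (h : T.Adj b c) (f : ι → M) :
    ∑ x ∈ branchAt T side b (side b c), f x + ∑ x ∈ branchAt T side c (side c b), f x =
      ∑ x, f x := by
  classical
  have : branchAt T side c (side c b) = (branchAt T side b (side b c))ᶜ := by
    ext x
    rw [Finset.mem_compl, mem_branchAt hT hs h, mem_branchAt hT hs h.symm]
    have := hT.dist_eq_dist_add_one_of_adj x h
    omega
  rw [this, Finset.sum_add_sum_compl]

/-- A sum over a branch, split into the first hexagon of the branch and the three branches that
follow. -/
theorem sum_branchAt {M : Type*} [AddCommGroup M] (hT : T.IsTree) (hs : Separated T side)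
    {b c : ι} (h : T.Adj b c) (f : ι → M) :
    ∑ x ∈ branchAt T side b (side b c), f x = f c +
      ∑ x ∈ branchAt T side c (side c b + 2), f x + ∑ x ∈ branchAt T side c (side c b + 3), f x +
      ∑ x ∈ branchAt T side c (side c b + 4), f x := by
  have h1 := sum_branchAt_add hT hs h f
  rw [sum_eq_add_sum_branchAt (T := T) (side := side) c f, sum_zmod_six (side c b),
    branchAt_eq_empty hT (hs.forall_adj_side_ne h.symm).1,
    branchAt_eq_empty hT (hs.forall_adj_side_ne h.symm).2, Finset.sum_empty, add_zero,
    add_zero] at h1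
  rw [← sub_eq_zero] at h1 ⊢
  rw [← h1]; abel

theorem Realizes.sum_nil {M : Type*} [AddCommMonoid M] (hT : T.IsTree) {b : ι} {i : ZMod 6}
    (h : Realizes T side nil b i) (f : ι → M) : ∑ x ∈ branchAt T side b i, f x = 0 := by
  rw [branchAt_eq_empty hT h, Finset.sum_empty]

theorem Realizes.card (hT : T.IsTree) (hs : Separated T side) {p : Branch} {b : ι} {i : ZMod 6}
    (h : Realizes T side p b i) : ((branchAt T side b i).card : ℤ) = size p := by
  have key : ∑ x ∈ branchAt T side b i, (1 : ℤ) = size p := by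
    induction p generalizing b i with
    | nil => exact h.sum_nil hT _
    | node l m r hl hm hr =>
      obtain ⟨c, hbc, rfl, h1, h2, h3⟩ := h
      rw [sum_branchAt hT hs hbc, hl h1, hm h2, hr h3, size]
  simpa using key

theorem exists_realizes (hT : T.IsTree) (hs : Separated T side) (b : ι) (i : ZMod 6) :
    ∃ p, Wf p ∧ Realizes T side p b i := by
  induction hn : (branchAt T side b i).card using Nat.strong_induction_on generalizing b i with
  | _ n ih =>
    subst hn
    by_cases h : ∃ c, T.Adj b c ∧ side b c = i
    · obtain ⟨c, hbc, rfl⟩ := h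
      have hcard := sum_branchAt hT hs hbc (fun _ => (1 : ℤ))
      simp only [Finset.sum_const, nsmul_eq_mul, mul_one] at hcard
      obtain ⟨l, wl, hl⟩ := ih (branchAt T side c (side c b + 2)).card (by omega) c _ rfl
      obtain ⟨m, wm, hm⟩ := ih (branchAt T side c (side c b + 3)).card (by omega) c _ rfl
      obtain ⟨r, wr, hr⟩ := ih (branchAt T side c (side c b + 4)).card (by omega) c _ rfl
      refine ⟨node l m r, ⟨fun hm0 => ?_, wl, wm, wr⟩, c, hbc, rfl, hl, hm, hr⟩
      cases m with
      | nil => exact absurd rfl hm0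
      | node l' m' r' =>
        obtain ⟨d, hcd, hd, -⟩ := hm
        have key := hs.forall_adj_side_ne hcd
        rw [hd] at key
        constructor
        · cases l with
          | nil => rfl
          | node _ _ _ =>
            obtain ⟨f, hcf, hf, -⟩ := hl
            refine absurd hf ?_
            have := key.2 f hcf
            rwa [add_assoc, show (3 + 5 : ZMod 6) = 2 from by decide] at this
        · cases r with
          | nil => rfl
          | node _ _ _ =>
            obtain ⟨f, hcf, hf, -⟩ := hr
            refine absurd hf ?_
            have := key.1 f hcf
            rwa [add_assoc, show (3 + 1 : ZMod 6) = 4 from by decide] at this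
    · exact ⟨nil, trivial, fun c hc hi => h ⟨c, hc, hi⟩⟩

end

/-! ### Cutting a phenylene into two branches -/

/-- Cutting the phenylene at a suitable quadrilateral leaves the branches `p` and `q`. -/
def SplitsAs (T : SimpleGraph ι) (side : ι → ι → ZMod 6) (p q : Branch) : Prop :=
  ∃ b c, T.Adj b c ∧ Realizes T side p b (side b c) ∧ Realizes T side q c (side c b)

theorem SplitsAs.symm {p q : Branch} (h : SplitsAs T side p q) : SplitsAs T side q p := by
  obtain ⟨b, c, h1, h2, h3⟩ := h
  exact ⟨c, b, h1.symm, h3, h2⟩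

theorem Realizes.of_adj (hs : Separated T side) {l m r : Branch} {b c : ι} (h : T.Adj b c)
    (hr : Realizes T side (node l m r) b (side b c)) :
    Realizes T side l c (side c b + 2) ∧ Realizes T side m c (side c b + 3) ∧
      Realizes T side r c (side c b + 4) := by
  obtain ⟨d, hbd, hd, h'⟩ := hr
  rwa [hs.eq_of_side_eq hbd h hd] at h'

/-- What the branch at the left side of a hexagon sees behind it, when that hexagon is entered from
`q`. -/
theorem Realizes.left_context (hs : Separated T side) {r q : Branch} {b c d : ι}
    (hbc : T.Adj b c) (hcd : T.Adj c d) (hd : side c d = side c b + 2)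
    (hr : Realizes T side r c (side c b + 4)) (hq : Realizes T side q c (side c b)) :
    Realizes T side (node r nil q) d (side d c) := by
  refine ⟨c, hcd.symm, rfl, ?_, ?_, ?_⟩
  · rw [hd, add_assoc, show (2 + 2 : ZMod 6) = 4 from by decide]; exact hr
  · rw [hd, add_assoc, show (2 + 3 : ZMod 6) = 5 from by decide]
    exact (hs.forall_adj_side_ne hbc.symm).2
  · rw [hd, add_assoc, show (2 + 4 : ZMod 6) = 0 from by decide, add_zero]; exact hq

/-- What the branch at the opposite side of a hexagon sees behind it, when that hexagon is entered
from `q`. -/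
theorem Realizes.middle_context (hs : Separated T side) {q : Branch} {b c d : ι}
    (hbc : T.Adj b c) (hcd : T.Adj c d) (hd : side c d = side c b + 3)
    (hq : Realizes T side q c (side c b)) :
    Realizes T side (node nil q nil) d (side d c) := by
  refine ⟨c, hcd.symm, rfl, ?_, ?_, ?_⟩
  · rw [hd, add_assoc, show (3 + 2 : ZMod 6) = 5 from by decide]
    exact (hs.forall_adj_side_ne hbc.symm).2
  · rw [hd, add_assoc, show (3 + 3 : ZMod 6) = 0 from by decide, add_zero]; exact hq
  · rw [hd, add_assoc, show (3 + 4 : ZMod 6) = 1 from by decide]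
    exact (hs.forall_adj_side_ne hbc.symm).1

/-- What the branch at the right side of a hexagon sees behind it, when that hexagon is entered
from `q`. -/
theorem Realizes.right_context (hs : Separated T side) {l q : Branch} {b c d : ι}
    (hbc : T.Adj b c) (hcd : T.Adj c d) (hd : side c d = side c b + 4)
    (hl : Realizes T side l c (side c b + 2)) (hq : Realizes T side q c (side c b)) :
    Realizes T side (node q nil l) d (side d c) := by
  refine ⟨c, hcd.symm, rfl, ?_, ?_, ?_⟩
  · rw [hd, add_assoc, show (4 + 2 : ZMod 6) = 0 from by decide, add_zero]; exact hq
  · rw [hd, add_assoc, show (4 + 3 : ZMod 6) = 1 from by decide]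
    exact (hs.forall_adj_side_ne hbc.symm).1
  · rw [hd, add_assoc, show (4 + 4 : ZMod 6) = 2 from by decide]; exact hl

theorem Realizes.ne_nil {p : Branch} {b c : ι} (h : T.Adj b c)
    (hp : Realizes T side p b (side b c)) : p ≠ nil := by
  rintro rfl
  exact hp c h rfl

theorem SplitsAs.ne_nil {p q : Branch} (h : SplitsAs T side p q) : p ≠ nil ∧ q ≠ nil := by
  obtain ⟨b, c, h1, h2, h3⟩ := h
  exact ⟨h2.ne_nil h1, h3.ne_nil h1.symm⟩

theorem SplitsAs.size_add_size [Fintype ι] (hT : T.IsTree) (hs : Separated T side) {p q : Branch}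
    (h : SplitsAs T side p q) : size p + size q = Fintype.card ι := by
  obtain ⟨b, c, h1, h2, h3⟩ := h
  have h4 := sum_branchAt_add hT hs h1 (fun _ => (1 : ℤ))
  rw [← h2.card hT hs, ← h3.card hT hs]
  simpa using h4

/-- Every phenylene can be cut in half, or it has a central hexagon: the first hexagon of a
smallest branch `q` that contains at least half of the hexagons, so that its further branches, as
well as the rest `p`, contain less than half. -/
theorem exists_balanced_split [Fintype ι] (hT : T.IsTree) (hs : Separated T side)
    (hcard : 2 ≤ Fintype.card ι) :
    ∃ p q, Wf p ∧ Wf q ∧ SplitsAs T side p q ∧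
      (size p = size q ∨ ∃ l m r, q = node l m r ∧ 2 * size p < Fintype.card ι ∧
        2 * size l < Fintype.card ι ∧ 2 * size m < Fintype.card ι ∧
        2 * size r < Fintype.card ι) := by
  classical
  have hex : ∃ n b c, T.Adj b c ∧ (branchAt T side b (side b c)).card = n ∧
      Fintype.card ι ≤ 2 * n := by
    obtain ⟨x, y, hxy⟩ := Fintype.one_lt_card_iff.1 hcard
    obtain ⟨c, hc, -⟩ := exists_adj_dist_add_one hT hxy
    have h4 := sum_branchAt_add hT hs hc (fun _ => (1 : ℕ))
    simp only [Finset.sum_const, smul_eq_mul, mul_one, Finset.card_univ] at h4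
    rcases Nat.le_total (branchAt T side x (side x c)).card
      (branchAt T side c (side c x)).card with h | h
    · exact ⟨_, c, x, hc.symm, rfl, by omega⟩
    · exact ⟨_, x, c, hc, rfl, by omega⟩
  -- A branch with the least number of hexagons among those with at least half of them.
  obtain ⟨b, c, hbc, hn, hle⟩ := Nat.find_spec hex
  have hmin := fun m (hm : m < Nat.find hex) => Nat.find_min hex hm
  rw [← hn] at hle hmin
  obtain ⟨q, wq, hq⟩ := exists_realizes hT hs b (side b c)
  obtain ⟨p, wp, hp⟩ := exists_realizes hT hs c (side c b)
  have hsplit : SplitsAs T side p q := ⟨c, b, hbc.symm, hp, hq⟩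
  refine ⟨p, q, wp, wq, hsplit, ?_⟩
  have hsum := hsplit.size_add_size hT hs
  have cq := hq.card hT hs
  by_cases heq : size p = size q
  · exact .inl heq
  · right
    cases q with
    | nil => exact absurd rfl hsplit.ne_nil.2
    | node l m r =>
      obtain ⟨hl, hm, hr⟩ := hq.of_adj hs hbc
      have hchild : ∀ (s : Branch) (i : ZMod 6), Realizes T side s c i →
          size s < size (node l m r) → 2 * size s < Fintype.card ι := by
        intro s i h hlt
        by_cases hd : ∃ d, T.Adj c d ∧ side c d = i
        · obtain ⟨d, hcd, rfl⟩ := hd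
          have cs := h.card hT hs
          by_contra hcon
          exact hmin (branchAt T side c (side c d)).card (by omega) ⟨c, d, hcd, rfl, by omega⟩
        · have hs0 : s = nil := by
            cases s with
            | nil => rfl
            | node _ _ _ =>
              obtain ⟨d, h1, h2, -⟩ := h
              exact absurd ⟨d, h1, h2⟩ hd
          subst hs0
          simp only [size]; omega
      have l0 := size_nonneg l
      have m0 := size_nonneg m
      have r0 := size_nonneg r
      refine ⟨l, m, r, rfl, by omega, hchild l _ hl ?_, hchild m _ hm ?_, hchild r _ hr ?_⟩ <;>
        simp only [size] <;> omega

end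

section

/-! ### Folding a graph along a cut -/

theorem exists_walk_of_fold {V : Type*} {G : SimpleGraph V} {φ : V → V}
    (hadj : ∀ x y, G.Adj x y → φ x = φ y ∨ G.Adj (φ x) (φ y)) {x y : V} (w : G.Walk x y) :
    ∃ w' : G.Walk (φ x) (φ y), w'.length ≤ w.length := by
  induction w with
  | nil => exact ⟨.nil, le_rfl⟩
  | cons h w ih =>
    obtain ⟨w', hw'⟩ := ih
    rcases hadj _ _ h with h1 | h1
    · exact ⟨w'.copy h1.symm rfl, by simp; omega⟩
    · exact ⟨.cons h1 w', by simpa using hw'⟩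

/-- Let `φ` fold the graph onto `W`, so that an edge is mapped to an edge or to a vertex, and any
edge that leaves `W` is mapped to its end in `W`. Then a walk that leaves `W` becomes shorter. -/
theorem exists_shorter_walk_of_fold {V : Type*} {G : SimpleGraph V} {φ : V → V} {W : Set V}
    (hadj : ∀ x y, G.Adj x y → φ x = φ y ∨ G.Adj (φ x) (φ y)) (hid : ∀ x ∈ W, φ x = x)
    (hcut : ∀ x y, x ∈ W → y ∉ W → G.Adj x y → φ y = x)
    {x y : V} (w : G.Walk x y) (hx : x ∈ W) (hy : y ∉ W) :
    ∃ w' : G.Walk (φ x) (φ y), w'.length < w.length := by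
  induction w with
  | nil => exact absurd hx hy
  | @cons x z y h w ih =>
    by_cases hz : z ∈ W
    · obtain ⟨w', hw'⟩ := ih hz hy
      rcases hadj _ _ h with h1 | h1
      · exact ⟨w'.copy h1.symm rfl, by simp; omega⟩
      · exact ⟨.cons h1 w', by simpa using hw'⟩
    · obtain ⟨w', hw'⟩ := exists_walk_of_fold hadj w
      have h1 : φ z = φ x := by rw [hcut x z hx hz h, hid x hx]
      exact ⟨w'.copy h1 rfl, by simp; omega⟩

/-- If the graph can be folded onto `W` as in `exists_shorter_walk_of_fold`, then, for every edge
that leaves `W`, all vertices of `W` are closer to its end in `W`. -/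
theorem dist_lt_of_fold {V : Type*} {G : SimpleGraph V} (hG : G.Connected) {φ : V → V} {W : Set V}
    (hadj : ∀ x y, G.Adj x y → φ x = φ y ∨ G.Adj (φ x) (φ y)) (hid : ∀ x ∈ W, φ x = x)
    (hcut : ∀ x y, x ∈ W → y ∉ W → G.Adj x y → φ y = x)
    {u v x : V} (hu : u ∈ W) (hv : v ∉ W) (huv : G.Adj u v) (hx : x ∈ W) :
    G.dist x u < G.dist x v := by
  obtain ⟨w, hw⟩ := hG.exists_walk_length_eq_dist x v
  obtain ⟨w', hw'⟩ := exists_shorter_walk_of_fold hadj hid hcut w hx hv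
  have := SimpleGraph.dist_le (w'.copy (hid x hx) (hcut u v hu hv huv))
  simp only [SimpleGraph.Walk.length_copy] at this
  omega

variable {ι : Type*} {T : SimpleGraph ι} {side : ι → ι → ZMod 6}

/-! ### Connectedness of assemblies -/

theorem hexagonAssembly_adj_hexagon (a : ι) (i : ZMod 6) :
    (hexagonAssembly T side).Adj (a, i) (a, i + 1) := .inl ⟨rfl, .inl rfl⟩

theorem hexagonAssembly_adj_link {a b : ι} (h : T.Adj a b) :
    (hexagonAssembly T side).Adj (a, side a b) (b, side b a + 1) := .inr ⟨h, .inl ⟨rfl, rfl⟩⟩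

theorem hexagonAssembly_connected (hT : T.Connected) : (hexagonAssembly T side).Connected := by
  have hex : ∀ (a : ι) (i : ZMod 6) (n : ℕ),
      (hexagonAssembly T side).Reachable (a, i) (a, i + n) := by
    intro a i n
    induction n with
    | zero => rw [Nat.cast_zero, add_zero]
    | succ n ih =>
      refine ih.trans (SimpleGraph.Adj.reachable ?_)
      rw [Nat.cast_succ, ← add_assoc]
      exact hexagonAssembly_adj_hexagon a _
  have hex' : ∀ (a : ι) (i j : ZMod 6), (hexagonAssembly T side).Reachable (a, i) (a, j) := by
    intro a i j
    have := hex a i (j - i).val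
    rwa [ZMod.natCast_zmod_val, add_sub_cancel] at this
  have walk : ∀ (a b : ι) (w : T.Walk a b), (hexagonAssembly T side).Reachable (a, 0) (b, 0) := by
    intro a b w
    induction w with
    | nil => rfl
    | cons h w ih =>
      exact ((hex' _ _ _).trans (hexagonAssembly_adj_link h).reachable).trans
        ((hex' _ _ _).trans ih)
  have := hT.nonempty
  rw [SimpleGraph.connected_iff]
  refine ⟨fun x y => ?_, inferInstance⟩
  obtain ⟨w⟩ := hT.preconnected x.1 y.1
  exact ((hex' _ _ _).trans (walk _ _ w)).trans (hex' _ _ _)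

/-! ### Cuts between two hexagons -/

/-- An edge of a tree is the only one between the two components that are left when it is removed. -/
theorem eq_of_adj_of_crossing (hT : T.IsTree) {b c x y : ι} (hbc : T.Adj b c) (hxy : T.Adj x y)
    (hx : T.dist x b + 1 = T.dist x c) (hy : ¬ T.dist y b + 1 = T.dist y c) :
    x = b ∧ y = c := by
  have hbcy := hT.dist_eq_dist_add_one_of_adj y hbc
  have h1 := hT.dist_eq_dist_add_one_of_adj b hxy
  have h2 := hT.dist_eq_dist_add_one_of_adj c hxy
  simp only [SimpleGraph.dist_comm (u := x), SimpleGraph.dist_comm (u := y)] at hx hy hbcy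
  have hxb : x = b := by
    by_contra hne
    have h3 := dist_parent hT hne
    have h4 := adj_parent hT hne
    have h5 := hT.dist_eq_dist_add_one_of_adj c h4
    have h6 := hT.dist_eq_dist_add_one_of_adj (parent T b x) hbc
    simp only [SimpleGraph.dist_comm (u := parent T b x)] at h6
    have h7 : y = parent T b x := eq_of_adj_of_dist_add_one hT (a := c) hxy h4 (by omega) (by omega)
    rw [← h7] at h3
    omega
  subst hxb
  refine ⟨rfl, ?_⟩
  rw [SimpleGraph.dist_self] at hx h1
  have : T.dist c y = 0 := by omega
  exact ((hT.connected.dist_eq_zero_iff).1 this).symm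

/-- The two edges of a quadrilateral that join its hexagons form a cut. The graph is folded onto
one part by collapsing the other part onto the side of the quadrilateral. -/
theorem dist_lt_of_link (hT : T.IsTree) {b c : ι} (hbc : T.Adj b c) {x : ι × ZMod 6}
    (hx : T.dist x.1 b + 1 = T.dist x.1 c) :
    (hexagonAssembly T side).dist x (b, side b c) <
        (hexagonAssembly T side).dist x (c, side c b + 1) ∧
      (hexagonAssembly T side).dist x (b, side b c + 1) <
        (hexagonAssembly T side).dist x (c, side c b) := by
  classical
  set W : Set (ι × ZMod 6) := {v | T.dist v.1 b + 1 = T.dist v.1 c} with hW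
  have hb : ∀ i, (b, i) ∈ W := by
    intro i; simp [hW, SimpleGraph.dist_eq_one_iff_adj.2 hbc]
  have hc : ∀ i, (c, i) ∉ W := by
    intro i; simp [hW]
  -- One vertex outside `W` goes to the vertex `side b c + 1` of `b`, all others go to the vertex
  -- `side b c`.
  set φ : ι × ZMod 6 → ι × ZMod 6 := fun v => if v ∈ W then v else
    if v = (c, side c b) then (b, side b c + 1) else (b, side b c) with hφ
  have hid : ∀ v ∈ W, φ v = v := fun v hv => by rw [hφ]; exact if_pos hv
  have hout : ∀ v, v ∉ W → φ v = (b, side b c + 1) ∨ φ v = (b, side b c) := by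
    intro v hv
    simp only [hφ, if_neg hv]
    split_ifs <;> simp
  have hcut : ∀ x y, x ∈ W → y ∉ W → (hexagonAssembly T side).Adj x y → φ y = x := by
    rintro ⟨x, i⟩ ⟨y, j⟩ hx hy h
    rcases h with ⟨h1, h2⟩ | ⟨h1, h2⟩
    · dsimp only at h1; subst h1; exact absurd hx hy
    · dsimp only at h1 h2
      obtain ⟨rfl, rfl⟩ := eq_of_adj_of_crossing hT hbc h1 hx hy
      simp only [hφ, if_neg hy]
      rcases h2 with ⟨rfl, rfl⟩ | ⟨rfl, rfl⟩
      · rw [if_neg]; simp only [Prod.mk.injEq, true_and, add_eq_left]; decide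
      · rw [if_pos rfl]
  have hadj : ∀ x y, (hexagonAssembly T side).Adj x y →
      φ x = φ y ∨ (hexagonAssembly T side).Adj (φ x) (φ y) := by
    intro x y h
    by_cases hx : x ∈ W <;> by_cases hy : y ∈ W
    · rw [hid x hx, hid y hy]; exact .inr h
    · left; rw [hid x hx, hcut x y hx hy h]
    · left; rw [hid y hy, hcut y x hy hx h.symm]
    · have := hexagonAssembly_adj_hexagon (T := T) (side := side) b (side b c)
      rcases hout x hx with h1 | h1 <;> rcases hout y hy with h2 | h2 <;> rw [h1, h2]
      · exact .inl rfl
      · exact .inr this.symm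
      · exact .inr this
      · exact .inl rfl
  have key := fun i j h => dist_lt_of_fold (hexagonAssembly_connected hT.connected) (W := W) hadj hid
    hcut (hb i) (hc j) h hx
  exact ⟨key _ _ (hexagonAssembly_adj_link hbc),
    key _ _ (hexagonAssembly_adj_link hbc.symm).symm⟩

/-! ### Straight cuts through hexagons -/

/-- The position of a hexagon relative to a straight cut. In the state `cross d` the cut passes
through the sides `d` and `d + 3`, and the vertices `d + 1`, `d + 2`, `d + 3` belong to the near
part. In the state `near` the whole hexagon belongs to the near part. In the state `far v` it
belongs to the other part, and `v` is the vertex of the near part onto which all of its vertices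
are folded. -/
inductive CutState (ι : Type*) : Type _
  | cross (d : ZMod 6) : CutState ι
  | near : CutState ι
  | far (v : ι × ZMod 6) : CutState ι

namespace CutState

/-- The state of a hexagon that is joined by its side `e` to the side `s` of the hexagon `y`, given
the state of `y`. If `y` is crossed and the new hexagon lies on the far side, then it is folded
onto the middle one of the three near vertices of `y`, which is equal or adjacent to both images of
the ends of the side `s`. -/
def next (y : ι) (s e : ZMod 6) : CutState ι → CutState ι
  | cross d => if s = d then cross (e + 3) else if s = d + 3 then cross e else
      if s = d + 1 ∨ s = d + 2 then near else far (y, d + 2)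
  | near => near
  | far v => far v

/-- Whether the vertex `j` of a hexagon in the given state belongs to the near part of the cut. -/
def Near : CutState ι → ZMod 6 → Prop
  | cross d, j => j = d + 1 ∨ j = d + 2 ∨ j = d + 3
  | near, _ => True
  | far _, _ => False

/-- The reflection of a hexagon that is crossed at its sides `d` and `d + 3` onto its near half. -/
def foldIndex (d j : ZMod 6) : ZMod 6 :=
  if j = d + 1 ∨ j = d + 2 ∨ j = d + 3 then j else 2 * d + 1 - j

/-- The folding map onto the near part of the cut. -/
def fold : CutState ι → ι × ZMod 6 → ι × ZMod 6
  | cross d, v => (v.1, foldIndex d v.2)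
  | near, v => v
  | far w, _ => w

end CutState

open CutState

/-- The recursion for `cutState`, over the distance `n` from the initial hexagon `a`. -/
noncomputable def cutAux (T : SimpleGraph ι) (side : ι → ι → ZMod 6) (a : ι) (i : ZMod 6) :
    ℕ → ι → CutState ι
  | 0, _ => cross i
  | n + 1, x => (cutAux T side a i n (parent T a x)).next (parent T a x)
      (side (parent T a x) x) (side x (parent T a x))

/-- The state of the hexagon `x` relative to the straight cut that passes through the sides `i` and
`i + 3` of the hexagon `a`. The near part contains the vertices `i + 1`, `i + 2`, `i + 3` of `a`. -/
noncomputable def cutState (T : SimpleGraph ι) (side : ι → ι → ZMod 6) (a : ι) (i : ZMod 6)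
    (x : ι) : CutState ι := cutAux T side a i (T.dist a x) x

theorem cutState_self (a : ι) (i : ZMod 6) : cutState T side a i a = cross i := by
  rw [cutState, SimpleGraph.dist_self, cutAux]

theorem cutState_of_parent (hT : T.IsTree) {a x y : ι} (hx : x ≠ a) (hy : parent T a x = y)
    (i : ZMod 6) : cutState T side a i x =
      (cutState T side a i y).next y (side y x) (side x y) := by
  subst hy
  rw [cutState, ← dist_parent hT hx, cutAux, cutState]

theorem foldIndex_step : ∀ d i : ZMod 6, foldIndex d i = foldIndex d (i + 1) ∨
    foldIndex d (i + 1) = foldIndex d i + 1 ∨ foldIndex d i = foldIndex d (i + 1) + 1 := by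
  decide

/-- The folding map respects the edges of a hexagon that is crossed by the cut. -/
theorem fold_cross_adj (x : ι) (d i j : ZMod 6) (h : j = i + 1 ∨ i = j + 1) :
    CutState.fold (cross d) (x, i) = CutState.fold (cross d) (x, j) ∨
      (hexagonAssembly T side).Adj (CutState.fold (cross d) (x, i))
        (CutState.fold (cross d) (x, j)) := by
  simp only [CutState.fold, hexagonAssembly, Prod.mk.injEq, true_and]
  have h1 := foldIndex_step d i
  have h2 := foldIndex_step d j
  rcases h with rfl | rfl
  · exact h1.imp id .inl
  · exact h2.imp Eq.symm fun h => .inl h.symm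

/-- The folding map respects the edges that join two hexagons. -/
theorem fold_link_adj {x y : ι} (h : T.Adj y x) (st : CutState ι) {k j : ZMod 6}
    (hkj : (k = side y x ∧ j = side x y + 1) ∨ (k = side y x + 1 ∧ j = side x y)) :
    st.fold (y, k) = (st.next y (side y x) (side x y)).fold (x, j) ∨
      (hexagonAssembly T side).Adj (st.fold (y, k))
        ((st.next y (side y x) (side x y)).fold (x, j)) := by
  have hlink : (hexagonAssembly T side).Adj (y, k) (x, j) := .inr ⟨h, hkj⟩
  cases st with
  | near => exact .inr hlink
  | far v => exact .inl rfl
  | cross d =>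
    have f1 : ∀ d : ZMod 6, foldIndex d d = d + 1 ∧ foldIndex d (d + 1) = d + 1 ∧
        foldIndex (d + 3) (d + 1) = d ∧ foldIndex (d + 3) d = d ∧ foldIndex d (d + 3) = d + 3 ∧
        foldIndex d (d + 3 + 1) = d + 3 := by decide
    have k1 : side y x = d → (foldIndex d k = side y x ∧
        foldIndex (side x y + 3) j = side x y + 1) ∨
        (foldIndex d k = side y x + 1 ∧ foldIndex (side x y + 3) j = side x y) := by
      rintro rfl
      have h1 := f1 (side y x)
      have h2 := f1 (side x y)
      rcases hkj with ⟨hk, hj⟩ | ⟨hk, hj⟩ <;> rw [hk, hj]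
      · exact .inr ⟨h1.1, h2.2.2.1⟩
      · exact .inr ⟨h1.2.1, h2.2.2.2.1⟩
    have k2 : side y x = d + 3 → (foldIndex d k = side y x ∧
        foldIndex (side x y) j = side x y + 1) ∨
        (foldIndex d k = side y x + 1 ∧ foldIndex (side x y) j = side x y) := by
      intro hd
      have h1 := f1 d
      have h2 := f1 (side x y)
      rw [hd] at hkj ⊢
      rcases hkj with ⟨hk, hj⟩ | ⟨hk, hj⟩ <;> rw [hk, hj]
      · exact .inl ⟨h1.2.2.2.2.1, h2.2.1⟩
      · exact .inl ⟨h1.2.2.2.2.2, h2.1⟩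
    have hk : k = side y x ∨ k = side y x + 1 := hkj.imp And.left And.left
    have k3 : side y x = d + 1 ∨ side y x = d + 2 → foldIndex d k = k := by
      have : ∀ d s : ZMod 6, (s = d + 1 ∨ s = d + 2) → foldIndex d s = s ∧
        foldIndex d (s + 1) = s + 1 := by decide
      intro h
      have := this d _ h
      rcases hk with rfl | rfl
      exacts [this.1, this.2]
    have k4 : side y x ≠ d → side y x ≠ d + 3 → side y x ≠ d + 1 → side y x ≠ d + 2 →
        foldIndex d k = d + 2 ∨ d + 2 = foldIndex d k + 1 ∨ foldIndex d k = d + 2 + 1 := by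
      have : ∀ d s : ZMod 6, s ≠ d → s ≠ d + 3 → s ≠ d + 1 → s ≠ d + 2 →
          (foldIndex d s = d + 2 ∨ d + 2 = foldIndex d s + 1 ∨ foldIndex d s = d + 2 + 1) ∧
          (foldIndex d (s + 1) = d + 2 ∨ d + 2 = foldIndex d (s + 1) + 1 ∨
            foldIndex d (s + 1) = d + 2 + 1) := by decide
      intro h1 h2 h3 h4
      have := this d _ h1 h2 h3 h4
      rcases hk with rfl | rfl
      exacts [this.1, this.2]
    simp only [CutState.next]
    split_ifs with c1 c2 c3
    · exact .inr (.inr ⟨h, k1 c1⟩)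
    · exact .inr (.inr ⟨h, k2 c2⟩)
    · right
      simp only [CutState.fold, k3 c3]
      exact hlink
    · push Not at c3
      rcases k4 c1 c2 c3.1 c3.2 with h1 | h1 | h1
      · left; simp only [CutState.fold, h1]
      · right; exact .inl ⟨rfl, .inl h1⟩
      · right; exact .inl ⟨rfl, .inr h1⟩

theorem fold_of_near (st : CutState ι) (v : ι × ZMod 6) (h : st.Near v.2) : st.fold v = v := by
  cases st with
  | near => rfl
  | far w => exact h.elim
  | cross d => simp only [CutState.fold, foldIndex]; rw [if_pos (show v.2 = d + 1 ∨ _ from h)]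

/-- The folding map sends the far end of an edge of the cut to its near end. -/
theorem fold_cross_of_not_near (x : ι) (d i j : ZMod 6) (h : j = i + 1 ∨ i = j + 1)
    (hi : CutState.Near (ι := ι) (cross d) i) (hj : ¬ CutState.Near (ι := ι) (cross d) j) :
    CutState.fold (cross d) (x, j) = (x, i) := by
  have key : ∀ d i j : ZMod 6, (j = i + 1 ∨ i = j + 1) → (i = d + 1 ∨ i = d + 2 ∨ i = d + 3) →
      ¬ (j = d + 1 ∨ j = d + 2 ∨ j = d + 3) → foldIndex d j = i := by decide
  simp only [CutState.fold, key d i j h hi hj]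

/-- The edges of a straight cut are sides of hexagons; no edge between two hexagons belongs to it. -/
theorem near_iff_near_next {x y : ι} (st : CutState ι) {k j : ZMod 6}
    (hkj : (k = side y x ∧ j = side x y + 1) ∨ (k = side y x + 1 ∧ j = side x y)) :
    st.Near k ↔ (st.next y (side y x) (side x y)).Near j := by
  cases st with
  | near => exact Iff.rfl
  | far v => exact Iff.rfl
  | cross d =>
    have f1 : ∀ d : ZMod 6, ¬ (d = d + 1 ∨ d = d + 2 ∨ d = d + 3) ∧
        (d = d + 3 + 1 ∨ d = d + 3 + 2 ∨ d = d + 3 + 3) ∧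
        ¬ (d + 1 = d + 3 + 1 ∨ d + 1 = d + 3 + 2 ∨ d + 1 = d + 3 + 3) ∧
        ¬ (d + 3 + 1 = d + 1 ∨ d + 3 + 1 = d + 2 ∨ d + 3 + 1 = d + 3) := by decide
    have k1 : side y x = d → ((k = d + 1 ∨ k = d + 2 ∨ k = d + 3) ↔
        (j = side x y + 3 + 1 ∨ j = side x y + 3 + 2 ∨ j = side x y + 3 + 3)) := by
      rintro rfl
      have h1 := f1 (side y x)
      have h2 := f1 (side x y)
      rcases hkj with ⟨hk, hj⟩ | ⟨hk, hj⟩ <;> rw [hk, hj]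
      · exact iff_of_false h1.1 h2.2.2.1
      · exact iff_of_true (.inl rfl) h2.2.1
    have k2 : side y x = d + 3 → ((k = d + 1 ∨ k = d + 2 ∨ k = d + 3) ↔
        (j = side x y + 1 ∨ j = side x y + 2 ∨ j = side x y + 3)) := by
      intro hd
      have h1 := f1 d
      have h2 := f1 (side x y)
      rw [hd] at hkj
      rcases hkj with ⟨hk, hj⟩ | ⟨hk, hj⟩ <;> rw [hk, hj]
      · exact iff_of_true (.inr (.inr rfl)) (.inl rfl)
      · exact iff_of_false h1.2.2.2 h2.1
    have hk : k = side y x ∨ k = side y x + 1 := hkj.imp And.left And.left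
    have k3 : side y x = d + 1 ∨ side y x = d + 2 → (k = d + 1 ∨ k = d + 2 ∨ k = d + 3) := by
      have : ∀ d s : ZMod 6, (s = d + 1 ∨ s = d + 2) → (s = d + 1 ∨ s = d + 2 ∨ s = d + 3) ∧
        (s + 1 = d + 1 ∨ s + 1 = d + 2 ∨ s + 1 = d + 3) := by decide
      intro h
      have := this d _ h
      rcases hk with rfl | rfl
      exacts [this.1, this.2]
    have k4 : side y x ≠ d → side y x ≠ d + 3 → side y x ≠ d + 1 → side y x ≠ d + 2 →
        ¬ (k = d + 1 ∨ k = d + 2 ∨ k = d + 3) := by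
      have h5 : ∀ d s : ZMod 6, s ≠ d → s ≠ d + 3 → s ≠ d + 1 → s ≠ d + 2 →
          s = d + 4 ∨ s = d + 5 := by decide
      have h6 : ∀ d : ZMod 6, ¬ (d + 4 = d + 1 ∨ d + 4 = d + 2 ∨ d + 4 = d + 3) ∧
          ¬ (d + 4 + 1 = d + 1 ∨ d + 4 + 1 = d + 2 ∨ d + 4 + 1 = d + 3) ∧
          ¬ (d + 5 = d + 1 ∨ d + 5 = d + 2 ∨ d + 5 = d + 3) ∧
          ¬ (d + 5 + 1 = d + 1 ∨ d + 5 + 1 = d + 2 ∨ d + 5 + 1 = d + 3) := by decide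
      intro h1 h2 h3 h4
      obtain ⟨m1, m2, m3, m4⟩ := h6 d
      rcases h5 d _ h1 h2 h3 h4 with h | h <;> rcases hk with hk | hk <;> rw [hk, h] <;> assumption
    simp only [CutState.next]
    split_ifs with c1 c2 c3
    · exact k1 c1
    · exact k2 c2
    · exact iff_of_true (k3 c3) trivial
    · push Not at c3
      exact iff_of_false (k4 c1 c2 c3.1 c3.2) id

/-- The vertices of the near part of a straight cut are closer to the near ends of the two sides of
the hexagon `a` that belong to the cut. -/
theorem dist_lt_of_near (hT : T.IsTree) {a : ι} {i : ZMod 6} {v : ι × ZMod 6}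
    (hv : (cutState T side a i v.1).Near v.2) :
    (hexagonAssembly T side).dist v (a, i + 1) < (hexagonAssembly T side).dist v (a, i) ∧
      (hexagonAssembly T side).dist v (a, i + 3) <
        (hexagonAssembly T side).dist v (a, i + 3 + 1) := by
  set W : Set (ι × ZMod 6) := {v | (cutState T side a i v.1).Near v.2} with hW
  set φ : ι × ZMod 6 → ι × ZMod 6 := fun v => (cutState T side a i v.1).fold v with hφ
  have hlink : ∀ x y k j, parent T a x = y → x ≠ a →
      ((k = side y x ∧ j = side x y + 1) ∨ (k = side y x + 1 ∧ j = side x y)) →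
      ((y, k) ∈ W ↔ (x, j) ∈ W) ∧
        (φ (y, k) = φ (x, j) ∨ (hexagonAssembly T side).Adj (φ (y, k)) (φ (x, j))) := by
    intro x y k j hy hx h
    simp only [hW, hφ, Set.mem_ofPred_eq]
    rw [cutState_of_parent hT hx hy]
    refine ⟨near_iff_near_next _ h, fold_link_adj ?_ _ h⟩
    rw [← hy]; exact (adj_parent hT hx).symm
  have hid : ∀ v ∈ W, φ v = v := fun v hv => fold_of_near _ _ hv
  have hcross : ∀ x y, x ∈ W → y ∉ W → x.1 = y.1 → ∃ d, cutState T side a i x.1 = cross d := by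
    rintro ⟨x, i⟩ ⟨y, j⟩ hx hy h
    dsimp only at h; subst h
    simp only [hW, Set.mem_ofPred_eq] at hx hy
    dsimp only
    cases hst : cutState T side a _ x with
    | cross d => exact ⟨d, rfl⟩
    | near => rw [hst] at hy; exact absurd trivial hy
    | far v => rw [hst] at hx; exact hx.elim
  have hcut : ∀ x y, x ∈ W → y ∉ W → (hexagonAssembly T side).Adj x y → φ y = x := by
    intro u v hu hv h
    rcases h with ⟨h1, h2⟩ | ⟨h1, h2⟩
    · obtain ⟨d, hd⟩ := hcross u v hu hv h1
      obtain ⟨x, i⟩ := u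
      obtain ⟨y, j⟩ := v
      dsimp only at h1 h2 hd; subst h1
      simp only [hW, Set.mem_ofPred_eq, hd] at hu hv
      simp only [hφ, hd]
      exact fold_cross_of_not_near x d i j h2 hu hv
    · exfalso
      obtain ⟨x, k⟩ := u
      obtain ⟨y, j⟩ := v
      dsimp only at h1 h2
      rcases parent_or_parent hT a h1 with ⟨h3, h4⟩ | ⟨h3, h4⟩
      · exact hv ((hlink x y j k h4 h3 (h2.symm.imp And.symm And.symm)).1.2 hu)
      · exact hv ((hlink y x k j h4 h3 h2).1.1 hu)
  have hadj : ∀ x y, (hexagonAssembly T side).Adj x y →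
      φ x = φ y ∨ (hexagonAssembly T side).Adj (φ x) (φ y) := by
    rintro ⟨x, k⟩ ⟨y, j⟩ h
    rcases h with ⟨h1, h2⟩ | ⟨h1, h2⟩
    · dsimp only at h1 h2; subst h1
      simp only [hφ]
      cases hst : cutState T side a i x with
      | cross d => exact fold_cross_adj x d k j h2
      | near => exact .inr (.inl ⟨rfl, h2⟩)
      | far v => exact .inl rfl
    · dsimp only at h1 h2
      rcases parent_or_parent hT a h1 with ⟨h3, h4⟩ | ⟨h3, h4⟩
      · have := (hlink x y j k h4 h3 (h2.symm.imp And.symm And.symm)).2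
        exact this.imp Eq.symm SimpleGraph.Adj.symm
      · exact (hlink y x k j h4 h3 h2).2
  have hmem : ∀ j, (a, j) ∈ W ↔ (j = i + 1 ∨ j = i + 2 ∨ j = i + 3) := by
    intro j
    simp only [hW, Set.mem_ofPred_eq, cutState_self, CutState.Near]
  have key : ∀ j k, (j = i + 1 ∨ j = i + 2 ∨ j = i + 3) → ¬ (k = i + 1 ∨ k = i + 2 ∨ k = i + 3) →
      (hexagonAssembly T side).Adj (a, j) (a, k) →
      (hexagonAssembly T side).dist v (a, j) < (hexagonAssembly T side).dist v (a, k) :=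
    fun j k hj hk h => dist_lt_of_fold (hexagonAssembly_connected hT.connected) (W := W)
      hadj hid hcut ((hmem j).2 hj) (fun h => hk ((hmem k).1 h)) h hv
  exact ⟨key _ _ (.inl rfl)
      ((by decide : ∀ i : ZMod 6, ¬ (i = i + 1 ∨ i = i + 2 ∨ i = i + 3)) i)
      (hexagonAssembly_adj_hexagon a i).symm,
    key _ _ (.inr (.inr rfl))
      ((by decide : ∀ i : ZMod 6, ¬ (i + 3 + 1 = i + 1 ∨ i + 3 + 1 = i + 2 ∨
        i + 3 + 1 = i + 3)) i)
      (hexagonAssembly_adj_hexagon a (i + 3))⟩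

end

section

open CutState

/-! ### The Mostar index and isomorphisms -/

/-- The set of vertices that are closer to `u` than to `v`. -/
noncomputable def closer {V : Type*} [Fintype V] (G : SimpleGraph V) (u v : V) : Finset V :=
  Finset.univ.filter fun x => G.dist x u < G.dist x v

/-- The contribution `|n_u - n_v|` of an edge `uv` to the Mostar index. -/
noncomputable def imbalance {V : Type*} [Fintype V] (G : SimpleGraph V) (u v : V) : ℤ :=
  |((closer G u v).card : ℤ) - (closer G v u).card|

theorem imbalance_comm {V : Type*} [Fintype V] (G : SimpleGraph V) (u v : V) :
    imbalance G u v = imbalance G v u := abs_sub_comm _ _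

/-- To determine `n_u` and `n_v` it suffices to find enough vertices that are closer to `u`, and
enough that are closer to `v`. -/
theorem imbalance_eq {V : Type*} [Fintype V] {G : SimpleGraph V} {u v : V} {A B : Finset V}
    (hA : ∀ x ∈ A, G.dist x u < G.dist x v) (hB : ∀ x ∈ B, G.dist x v < G.dist x u)
    (hAB : Fintype.card V ≤ A.card + B.card) :
    imbalance G u v = |(A.card : ℤ) - B.card| := by
  classical
  have h1 : A ⊆ closer G u v := fun x hx => by simpa [closer] using hA x hx
  have h2 : B ⊆ closer G v u := fun x hx => by simpa [closer] using hB x hx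
  have h3 : Disjoint (closer G u v) (closer G v u) := by
    rw [Finset.disjoint_left]
    intro x hx hx'
    simp only [closer, Finset.mem_filter, Finset.mem_univ, true_and] at hx hx'
    omega
  have h4 : (closer G u v).card + (closer G v u).card ≤ Fintype.card V := by
    rw [← Finset.card_union_of_disjoint h3]
    exact Finset.card_le_univ _
  have h5 := Finset.card_le_card h1
  have h6 := Finset.card_le_card h2
  rw [imbalance, show (closer G u v).card = A.card by omega,
    show (closer G v u).card = B.card by omega]

theorem dist_iso {V W : Type*} {G : SimpleGraph V} {H : SimpleGraph W} (e : G ≃g H) (x y : V) :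
    H.dist (e x) (e y) = G.dist x y := by
  rw [SimpleGraph.dist_eq_sInf, SimpleGraph.dist_eq_sInf]
  congr 1
  ext n
  constructor
  · rintro ⟨w, rfl⟩
    exact ⟨(w.map e.symm.toHom).copy (e.symm_apply_apply x) (e.symm_apply_apply y), by simp⟩
  · rintro ⟨w, rfl⟩
    exact ⟨w.map e.toHom, by simp⟩

theorem imbalance_iso {V W : Type*} [Fintype V] [Fintype W] {G : SimpleGraph V}
    {H : SimpleGraph W} (e : G ≃g H) (u v : V) : imbalance H (e u) (e v) = imbalance G u v := by
  have key : ∀ u v, (closer H (e u) (e v)).card = (closer G u v).card := by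
    intro u v
    rw [← Finset.card_map e.toEquiv.toEmbedding]
    congr 1
    ext x
    obtain ⟨y, rfl⟩ := e.surjective x
    rw [Finset.mem_map]
    simp only [closer, Finset.mem_filter, Finset.mem_univ, true_and, dist_iso]
    constructor
    · intro h; exact ⟨y, h, rfl⟩
    · rintro ⟨z, h, hz⟩
      have : z = y := e.injective hz
      rwa [← this]
  rw [imbalance, imbalance, key, key]

/-- A form of the Mostar index without a choice of decidability instances. -/
theorem mostarIndex_eq_finsum {V : Type*} [Fintype V] (G : SimpleGraph V) :
    mostarIndex G = ∑ᶠ e ∈ G.edgeSet, Sym2.lift ⟨imbalance G, imbalance_comm G⟩ e := by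
  classical
  rw [← SimpleGraph.coe_edgeFinset, finsum_mem_coe_finset, mostarIndex]
  rfl

theorem mostarIndex_congr {V W : Type*} [Fintype V] [Fintype W] {G : SimpleGraph V}
    {H : SimpleGraph W} (e : G ≃g H) : mostarIndex G = mostarIndex H := by
  rw [mostarIndex_eq_finsum, mostarIndex_eq_finsum]
  refine finsum_mem_eq_of_bijOn (Sym2.map e) ⟨?_, ?_, ?_⟩ ?_
  · intro x
    induction x with
    | h u v => intro h; exact e.map_adj_iff.2 h
  · exact (Sym2.map.injective e.injective).injOn
  · intro x
    induction x with
    | h u v =>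
      intro h
      refine ⟨s(e.symm u, e.symm v), e.symm.map_adj_iff.2 h, ?_⟩
      simp
  · intro x
    induction x with
    | h u v => intro h; exact (imbalance_iso e u v).symm

variable {ι : Type*}

/-! ### The sizes of the two parts of a cut -/

namespace CutState

/-- The number of near vertices of a hexagon in the given state. -/
def weight : CutState ι → ℤ
  | cross _ => 3
  | near => 6
  | far _ => 0

open Classical in
theorem sum_near (st : CutState ι) :
    (∑ j : ZMod 6, if st.Near j then (1 : ℤ) else 0) = st.weight := by
  cases st with
  | near => simp [Near, weight, ZMod.card]
  | far v => simp [Near, weight]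
  | cross d =>
    have : ∀ d : ZMod 6,
        (∑ j : ZMod 6, if (j = d + 1 ∨ j = d + 2 ∨ j = d + 3) then (1 : ℤ) else 0) = 3 := by
      decide
    rw [weight, ← this d]
    refine Finset.sum_congr rfl fun j _ => ?_
    simp only [Near]
    congr

/-- The number of near vertices in a branch that hangs at side `i` of a hexagon in the given state;
see `sum_weight_branchAt`. -/
def nearSum : CutState ι → ZMod 6 → Branch → ℤ
  | cross d, i, p => if i = d then 3 * run p + 6 * right p else
      if i = d + 3 then 3 * run p + 6 * left p else
      if i = d + 1 ∨ i = d + 2 then 6 * size p else 0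
  | near, _, p => 6 * size p
  | far _, _, _ => 0

theorem nearSum_nil (st : CutState ι) (i : ZMod 6) : st.nearSum i nil = 0 := by
  cases st <;> simp [nearSum, run, left, right, size]

theorem nearSum_cross (d : ZMod 6) (p : Branch) :
    (cross d : CutState ι).nearSum d p = 3 * run p + 6 * right p ∧
    (cross d : CutState ι).nearSum (d + 1) p = 6 * size p ∧
    (cross d : CutState ι).nearSum (d + 2) p = 6 * size p ∧
    (cross d : CutState ι).nearSum (d + 3) p = 3 * run p + 6 * left p ∧
    (cross d : CutState ι).nearSum (d + 4) p = 0 ∧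
    (cross d : CutState ι).nearSum (d + 5) p = 0 := by
  have h1 : (1 : ZMod 6) ≠ 0 := by decide
  have h2 : (2 : ZMod 6) ≠ 0 := by decide
  have h3 : (3 : ZMod 6) ≠ 0 := by decide
  have h4 : (4 : ZMod 6) ≠ 0 := by decide
  have h5 : (5 : ZMod 6) ≠ 0 := by decide
  have h13 : (1 : ZMod 6) ≠ 3 := by decide
  have h23 : (2 : ZMod 6) ≠ 3 := by decide
  have h43 : (4 : ZMod 6) ≠ 3 := by decide
  have h53 : (5 : ZMod 6) ≠ 3 := by decide
  have h41 : (4 : ZMod 6) ≠ 1 := by decide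
  have h51 : (5 : ZMod 6) ≠ 1 := by decide
  have h42 : (4 : ZMod 6) ≠ 2 := by decide
  have h52 : (5 : ZMod 6) ≠ 2 := by decide
  simp [nearSum, h1, h2, h3, h4, h5, h13, h23, h43, h53, h41, h51, h42, h52]

theorem nearSum_next (st : CutState ι) (y : ι) (s e : ZMod 6) (l m r : Branch) :
    (st.next y s e).weight + (st.next y s e).nearSum (e + 2) l +
      (st.next y s e).nearSum (e + 3) m + (st.next y s e).nearSum (e + 4) r =
    st.nearSum s (node l m r) := by
  cases st with
  | near => simp only [next, weight, nearSum, size]; ring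
  | far v => simp only [next, weight, nearSum]; ring
  | cross d =>
    have e1 : e + 2 = e + 3 + 5 := by rw [add_assoc]; congr 1
    have e2 : e + 4 = e + 3 + 1 := by rw [add_assoc]; congr 1
    simp only [next]
    split_ifs with c1 c2 c3
    · rw [e1, e2, (nearSum_cross _ l).2.2.2.2.2, (nearSum_cross _ m).1, (nearSum_cross _ r).2.1, c1,
        (nearSum_cross _ _).1]
      simp only [weight, run, right]; ring
    · rw [(nearSum_cross _ l).2.2.1, (nearSum_cross _ m).2.2.2.1, (nearSum_cross _ r).2.2.2.2.1, c2,
        (nearSum_cross _ _).2.2.2.1]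
      simp only [weight, run, left]; ring
    · simp only [nearSum, if_neg c1, if_neg c2, if_pos c3, weight, size]; ring
    · simp only [nearSum, if_neg c1, if_neg c2, if_neg c3, weight]; ring

end CutState

variable [Fintype ι] {T : SimpleGraph ι} {side : ι → ι → ZMod 6}

theorem sum_weight_branchAt (hT : T.IsTree) (hs : Separated T side) (a : ι) (i : ZMod 6)
    {p : Branch} {y : ι} {j : ZMod 6} (h : Realizes T side p y j)
    (hj : y ≠ a → j ≠ side y (parent T a y)) :
    ∑ x ∈ branchAt T side y j, (cutState T side a i x).weight =
      (cutState T side a i y).nearSum j p := by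
  induction p generalizing y j with
  | nil => rw [h.sum_nil hT, nearSum_nil]
  | node l m r hl hm hr =>
    obtain ⟨c, hyc, rfl, h1, h2, h3⟩ := h
    obtain ⟨hc, hpc⟩ : c ≠ a ∧ parent T a c = y := by
      rcases parent_or_parent hT a hyc.symm with h | ⟨h4, h5⟩
      · exact h
      · exact absurd (by rw [h5]) (hj h4)
    have hne : ∀ k : ZMod 6, k ≠ 0 → (c ≠ a → side c y + k ≠ side c (parent T a c)) := by
      intro k hk _
      rw [hpc]
      simpa using hk
    rw [sum_branchAt hT hs hyc, hl h1 (hne _ (by decide)), hm h2 (hne _ (by decide)),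
      hr h3 (hne _ (by decide)), cutState_of_parent hT hc hpc, nearSum_next]

open Classical in
/-- The near part of the straight cut through the sides `i` and `i + 3` of the hexagon `a`. -/
noncomputable def nearSet (T : SimpleGraph ι) (side : ι → ι → ZMod 6) (a : ι) (i : ZMod 6) :
    Finset (ι × ZMod 6) :=
  Finset.univ.filter fun v => (cutState T side a i v.1).Near v.2

/-- The number of hexagons that are contained in the near part of the straight cut through the
sides `i` and `i + 3` of a hexagon, where `Q j` is the branch at side `j`. -/
def nearCount (Q : ZMod 6 → Branch) (i : ZMod 6) : ℤ :=
  size (Q (i + 1)) + size (Q (i + 2)) + right (Q i) + left (Q (i + 3))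

theorem card_nearSet (hT : T.IsTree) (hs : Separated T side) {a : ι} {Q : ZMod 6 → Branch}
    (hQ : ∀ j, Realizes T side (Q j) a j) (i : ZMod 6) :
    ((nearSet T side a i).card : ℤ) =
      6 * nearCount Q i + 3 * (run (Q i) + run (Q (i + 3)) + 1) := by
  classical
  have h1 : ((nearSet T side a i).card : ℤ) = ∑ x, (cutState T side a i x).weight := by
    rw [nearSet, Finset.card_filter, Fintype.sum_prod_type]
    push_cast
    exact Finset.sum_congr rfl fun x _ => by
      rw [← sum_near]
  rw [h1, sum_eq_add_sum_branchAt (T := T) (side := side) a]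
  have h2 : ∀ j, ∑ x ∈ branchAt T side a j, (cutState T side a i x).weight =
      (cross i : CutState ι).nearSum j (Q j) := by
    intro j
    rw [sum_weight_branchAt hT hs a i (hQ j) (fun h => absurd rfl h), cutState_self]
  simp only [h2]
  rw [sum_zmod_six i, cutState_self, (nearSum_cross i _).1, (nearSum_cross i _).2.1,
    (nearSum_cross i _).2.2.1, (nearSum_cross i _).2.2.2.1, (nearSum_cross i _).2.2.2.2.1,
    (nearSum_cross i _).2.2.2.2.2, nearCount, weight]
  ring

theorem card_eq_sum_size (hT : T.IsTree) (hs : Separated T side) {a : ι} {Q : ZMod 6 → Branch}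
    (hQ : ∀ j, Realizes T side (Q j) a j) : (Fintype.card ι : ℤ) = 1 + ∑ j, size (Q j) := by
  have := sum_eq_add_sum_branchAt (T := T) (side := side) a (fun _ => (1 : ℤ))
  simp only [Finset.sum_const, nsmul_eq_mul, mul_one, Finset.card_univ, (hQ _).card hT hs] at this
  exact this

/-- The hexagons divided by a straight cut contribute equally to its two parts, so only the
undivided ones count, with 6 vertices each. -/
theorem imbalance_hexagon (hT : T.IsTree) (hs : Separated T side) {a : ι} {Q : ZMod 6 → Branch}
    (hQ : ∀ j, Realizes T side (Q j) a j) (i : ZMod 6) :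
    imbalance (hexagonAssembly T side) (a, i) (a, i + 1) =
      6 * |nearCount Q i - nearCount Q (i + 3)| := by
  have hcard : Fintype.card (ι × ZMod 6) = 6 * Fintype.card ι := by
    rw [Fintype.card_prod, ZMod.card, mul_comm]
  have h6 : i + 3 + 3 = i := by rw [add_assoc]; exact add_zero i
  have hA := card_nearSet hT hs hQ i
  have hB := card_nearSet hT hs hQ (i + 3)
  rw [h6] at hB
  have hN := card_eq_sum_size hT hs hQ
  rw [sum_zmod_six i] at hN
  have hsum : Fintype.card (ι × ZMod 6) ≤ (nearSet T side a i).card +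
      (nearSet T side a (i + 3)).card := by
    zify
    rw [hcard, hA, hB, nearCount, nearCount, h6]
    have e1 : i + 3 + 1 = i + 4 := by rw [add_assoc]; congr 1
    have e2 : i + 3 + 2 = i + 5 := by rw [add_assoc]; congr 1
    rw [e1, e2]
    push_cast
    rw [hN]
    have k1 := size_eq (Q i)
    have k2 := size_eq (Q (i + 3))
    linarith
  rw [imbalance_comm, imbalance_eq (A := nearSet T side a i)
      (B := nearSet T side a (i + 3)) ?_ ?_ hsum,
    hA, hB]
  · have : (6 : ℤ) * nearCount Q i + 3 * (run (Q i) + run (Q (i + 3)) + 1) -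
        (6 * nearCount Q (i + 3) + 3 * (run (Q (i + 3)) + run (Q i) + 1)) =
        6 * (nearCount Q i - nearCount Q (i + 3)) := by ring
    rw [this, abs_mul]; rfl
  · intro x hx
    simp only [nearSet, Finset.mem_filter, Finset.mem_univ, true_and] at hx
    exact (dist_lt_of_near hT hx).1
  · intro x hx
    simp only [nearSet, Finset.mem_filter, Finset.mem_univ, true_and] at hx
    have := (dist_lt_of_near hT hx).2
    rwa [h6] at this

theorem imbalance_link (hT : T.IsTree) (hs : Separated T side) {b c : ι} (hbc : T.Adj b c)
    {p q : Branch} (hp : Realizes T side p b (side b c)) (hq : Realizes T side q c (side c b)) :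
    imbalance (hexagonAssembly T side) (b, side b c) (c, side c b + 1) =
      6 * |size p - size q| := by
  have hcard : Fintype.card (ι × ZMod 6) = 6 * Fintype.card ι := by
    rw [Fintype.card_prod, ZMod.card, mul_comm]
  have hN := SplitsAs.size_add_size hT hs ⟨b, c, hbc, hp, hq⟩
  have cp := hp.card hT hs
  have cq := hq.card hT hs
  rw [imbalance_eq (A := branchAt T side c (side c b) ×ˢ Finset.univ)
    (B := branchAt T side b (side b c) ×ˢ Finset.univ)]
  · rw [Finset.card_product, Finset.card_product, Finset.card_univ, ZMod.card]
    push_cast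
    rw [cp, cq, ← sub_mul, abs_mul, abs_sub_comm, mul_comm]; rfl
  · intro x hx
    rw [Finset.mem_product, mem_branchAt hT hs hbc.symm] at hx
    exact (dist_lt_of_link hT hbc hx.1).1
  · intro x hx
    rw [Finset.mem_product, mem_branchAt hT hs hbc] at hx
    exact (dist_lt_of_link hT hbc.symm hx.1).2
  · rw [Finset.card_product, Finset.card_product, Finset.card_univ, ZMod.card, hcard]
    omega

end

section

variable {ι : Type*} {T : SimpleGraph ι} {side : ι → ι → ZMod 6}

/-! ### The Mostar index in terms of branches -/

/-- The branches at the six sides of a hexagon, listed from its side `e` on, where `q` is the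
branch at the side `e`. -/
def around (q l m r : Branch) : ZMod 6 → Branch := ![q, nil, l, m, r, nil]

theorem Realizes.around (hs : Separated T side) {b c : ι} (hbc : T.Adj b c) {l m r q : Branch}
    (hq : Realizes T side q c (side c b)) (hl : Realizes T side l c (side c b + 2))
    (hm : Realizes T side m c (side c b + 3)) (hr : Realizes T side r c (side c b + 4))
    (k : ZMod 6) : Realizes T side (around q l m r k) c (side c b + k) := by
  have h := hs.forall_adj_side_ne hbc.symm
  have : ∀ k : ZMod 6, k = 0 ∨ k = 1 ∨ k = 2 ∨ k = 3 ∨ k = 4 ∨ k = 5 := by decide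
  rcases this k with rfl | rfl | rfl | rfl | rfl | rfl
  · rw [add_zero]; exact hq
  · exact h.1
  · exact hl
  · exact hm
  · exact hr
  · exact h.2

variable [Fintype ι]

open Classical in
/-- The contribution of one edge of the quadrilateral at side `i` of the hexagon `b`, if there is
one: the edge that starts at the vertex `i` of `b`. -/
noncomputable def linkSum (T : SimpleGraph ι) (side : ι → ι → ZMod 6) (b : ι) (i : ZMod 6) : ℤ :=
  ∑ c, if T.Adj b c ∧ side b c = i then
    imbalance (hexagonAssembly T side) (b, side b c) (c, side c b + 1) else 0

/-- The part of the Mostar index that is assigned to the hexagon `b`: its six sides, and one edge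
of each quadrilateral at `b`. The other edge of the quadrilateral is assigned to the other hexagon. -/
noncomputable def hexagonSum (T : SimpleGraph ι) (side : ι → ι → ZMod 6) (b : ι) : ℤ :=
  ∑ i, (imbalance (hexagonAssembly T side) (b, i) (b, i + 1) + linkSum T side b i)

theorem linkSum_eq (hT : T.IsTree) (hs : Separated T side) {b : ι} {i : ZMod 6} {p q : Branch}
    (hp : Realizes T side p b i)
    (hq : ∀ c, T.Adj b c → side b c = i → Realizes T side q c (side c b)) :
    linkSum T side b i = 6 * edge p q := by
  classical
  by_cases h : ∃ c, T.Adj b c ∧ side b c = i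
  · obtain ⟨c, hbc, rfl⟩ := h
    rw [linkSum, Finset.sum_eq_single c]
    · rw [if_pos ⟨hbc, rfl⟩, imbalance_link hT hs hbc hp (hq c hbc rfl), edge_of_ne (hp.ne_nil hbc)]
    · intro d _ hd
      rw [if_neg]
      rintro ⟨h1, h2⟩
      exact hd (hs.eq_of_side_eq h1 hbc h2)
    · intro h; exact absurd (Finset.mem_univ _) h
  · have hp0 : p = nil := by
      cases p with
      | nil => rfl
      | node _ _ _ =>
        obtain ⟨c, h1, h2, -⟩ := hp
        exact absurd ⟨c, h1, h2⟩ h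
    subst hp0
    rw [linkSum, edge_nil, mul_zero]
    exact Finset.sum_eq_zero fun c _ => if_neg fun h' => h ⟨c, h'⟩

theorem sum_imbalance_hexagon (hT : T.IsTree) (hs : Separated T side) {b : ι} {e : ZMod 6}
    {q l m r : Branch} (hQ : ∀ k, Realizes T side (around q l m r k) b (e + k)) :
    ∑ i, imbalance (hexagonAssembly T side) (b, i) (b, i + 1) = 12 * cell q l m r := by
  have hQ' : ∀ j, Realizes T side (around q l m r (j - e)) b j := by
    intro j
    have := hQ (j - e)
    rwa [add_sub_cancel] at this
  have h1 : ∀ k, imbalance (hexagonAssembly T side) (b, e + k) (b, e + k + 1) =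
      6 * |nearCount (around q l m r) k - nearCount (around q l m r) (k + 3)| := by
    intro k
    rw [imbalance_hexagon hT hs hQ' (e + k)]
    simp only [nearCount]
    have h2 : ∀ j, e + k + j - e = k + j := fun j => by ring
    have h3 : ∀ j, e + k + 3 + j - e = k + 3 + j := fun j => by ring
    simp only [h2, h3, add_sub_cancel_left]
  rw [← Equiv.sum_comp (Equiv.addLeft e)]
  simp only [Equiv.coe_addLeft, h1]
  rw [← Finset.mul_sum, sum_zmod_six 0]
  have n0 : nearCount (around q l m r) 0 = size nil + size l + right q + left m := rfl
  have n1 : nearCount (around q l m r) 1 = size l + size m + right nil + left r := rfl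
  have n2 : nearCount (around q l m r) 2 = size m + size r + right l + left nil := rfl
  have n3 : nearCount (around q l m r) 3 = size r + size nil + right m + left q := rfl
  have n4 : nearCount (around q l m r) 4 = size nil + size q + right r + left nil := rfl
  have n5 : nearCount (around q l m r) 5 = size q + size nil + right nil + left l := rfl
  have a0 : (0 : ZMod 6) + 3 = 3 := rfl
  have a1 : (0 : ZMod 6) + 1 + 3 = 4 := rfl
  have a2 : (0 : ZMod 6) + 2 + 3 = 5 := rfl
  have a3 : (3 : ZMod 6) + 3 = 0 := rfl
  have a4 : (0 : ZMod 6) + 4 + 3 = 1 := rfl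
  have a5 : (0 : ZMod 6) + 5 + 3 = 2 := rfl
  rw [a0, a1, a2, a3, a4, a5]
  simp only [zero_add, n0, n1, n2, n3, n4, n5]
  simp only [cell, size, left, right, zero_add, add_zero]
  rw [abs_sub_comm (size r + right m + left q), abs_sub_comm (size q + right r),
    abs_sub_comm (size q + left l)]
  have c1 : size l + right q + left m - (size r + right m + left q) =
    size l + left m + right q - size r - right m - left q := by ring
  have c2 : size l + size m + left r - (size q + right r) =
    size l + size m + left r - size q - right r := by ring
  have c3 : size m + size r + right l - (size q + left l) =
    size m + size r + right l - size q - left l := by ring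
  rw [c1, c2, c3]; ring

/-- The quadrilateral at which the branch `p` hangs is shared with the rest of the phenylene,
whence only half of its contribution is counted here. -/
theorem sum_hexagonSum (hT : T.IsTree) (hs : Separated T side) {p q : Branch} {b : ι} {i : ZMod 6}
    (hp : Realizes T side p b i)
    (hq : ∀ c, T.Adj b c → side b c = i → Realizes T side q c (side c b)) :
    ∑ x ∈ branchAt T side b i, hexagonSum T side x = 6 * (2 * innerSum p q + edge p q) := by
  induction p generalizing q b i with
  | nil => rw [hp.sum_nil hT, innerSum, edge_nil]; rfl
  | node l m r ihl ihm ihr =>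
    have hp' := hp
    obtain ⟨c, hbc, rfl, hl, hm, hr⟩ := hp'
    replace hq := hq c hbc rfl
    have ql : ∀ d, T.Adj c d → side c d = side c b + 2 →
        Realizes T side (node r nil q) d (side d c) :=
      fun d hd hd' => Realizes.left_context hs hbc hd hd' hr hq
    have qm : ∀ d, T.Adj c d → side c d = side c b + 3 →
        Realizes T side (node nil q nil) d (side d c) :=
      fun d hd hd' => Realizes.middle_context hs hbc hd hd' hq
    have qr : ∀ d, T.Adj c d → side c d = side c b + 4 →
        Realizes T side (node q nil l) d (side d c) :=
      fun d hd hd' => Realizes.right_context hs hbc hd hd' hl hq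
    have hself : hexagonSum T side c = 12 * cell q l m r + 6 * (edge (node l m r) q +
        edge l (node r nil q) + edge m (node nil q nil) + edge r (node q nil l)) := by
      rw [hexagonSum, Finset.sum_add_distrib,
        sum_imbalance_hexagon hT hs (Realizes.around hs hbc hq hl hm hr), sum_zmod_six (side c b),
        linkSum_eq hT hs hl ql, linkSum_eq hT hs hm qm, linkSum_eq hT hs hr qr,
        linkSum_eq hT hs (p := nil) (q := nil) (hs.forall_adj_side_ne hbc.symm).1
          (fun d hd hd' => absurd hd' ((hs.forall_adj_side_ne hbc.symm).1 d hd)),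
        linkSum_eq hT hs (p := nil) (q := nil) (hs.forall_adj_side_ne hbc.symm).2
          (fun d hd hd' => absurd hd' ((hs.forall_adj_side_ne hbc.symm).2 d hd)),
        linkSum_eq hT hs hq (q := node l m r) (fun d hd hd' => by
          rw [hs.eq_of_side_eq hd hbc.symm hd']; exact hp)]
      have : edge q (node l m r) = edge (node l m r) q := by
        rw [edge_of_ne (hq.ne_nil hbc.symm), edge_of_ne Branch.noConfusion, abs_sub_comm]
      rw [this, edge_nil]; ring
    rw [sum_branchAt hT hs hbc, ihl hl ql, ihm hm qm, ihr hr qr, hself, innerSum]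
    ring

theorem mostarIndex_eq_sum_hexagonSum :
    mostarIndex (hexagonAssembly T side) = ∑ x, hexagonSum T side x := by
  classical
  set G := hexagonAssembly T side with hG
  set F : Sym2 (ι × ZMod 6) → ℤ := fun e => Sym2.lift ⟨imbalance G, imbalance_comm G⟩ e with hF
  -- `g₁` lists the sides of hexagons. `g₂` lists the edges between hexagons: each of the two
  -- orientations of an edge of `T` gives one of the two edges of the quadrilateral.
  set g₁ : ι × ZMod 6 → Sym2 (ι × ZMod 6) := fun v => s(v, (v.1, v.2 + 1)) with hg₁
  set g₂ : ι × ι → Sym2 (ι × ZMod 6) :=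
    fun d => s((d.1, side d.1 d.2), (d.2, side d.2 d.1 + 1)) with hg₂
  set A : Finset (Sym2 (ι × ZMod 6)) := Finset.univ.image g₁ with hA
  set D : Finset (ι × ι) := Finset.univ.filter fun d => T.Adj d.1 d.2 with hD
  have hedge : G.edgeSet = ((A ∪ D.image g₂ : Finset _) : Set (Sym2 (ι × ZMod 6))) := by
    ext e
    induction e with
    | h u v =>
      obtain ⟨x, i⟩ := u
      obtain ⟨y, j⟩ := v
      simp only [SimpleGraph.mem_edgeSet, Finset.coe_union, Set.mem_union, Finset.mem_coe, hA, hD,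
        Finset.mem_image, Finset.mem_univ, true_and, Finset.mem_filter, hg₁, hg₂]
      constructor
      · rintro (⟨h1, h2⟩ | ⟨h1, h2⟩)
        · dsimp only at h1 h2
          subst h1
          rcases h2 with rfl | rfl
          · exact .inl ⟨(x, i), rfl⟩
          · exact .inl ⟨(x, j), Sym2.eq_swap⟩
        · dsimp only at h1 h2
          rcases h2 with ⟨rfl, rfl⟩ | ⟨rfl, rfl⟩
          · exact .inr ⟨(x, y), h1, rfl⟩
          · exact .inr ⟨(y, x), h1.symm, Sym2.eq_swap⟩
      · rintro (⟨⟨z, k⟩, h⟩ | ⟨⟨z, w⟩, h, h'⟩)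
        · rw [← SimpleGraph.mem_edgeSet, ← h, SimpleGraph.mem_edgeSet]
          exact hexagonAssembly_adj_hexagon z k
        · rw [← SimpleGraph.mem_edgeSet, ← h', SimpleGraph.mem_edgeSet]
          exact hexagonAssembly_adj_link h
  have hdisj : Disjoint A (D.image g₂) := by
    rw [Finset.disjoint_left]
    intro e he he'
    rw [hA, Finset.mem_image] at he
    rw [Finset.mem_image] at he'
    obtain ⟨⟨x, i⟩, -, rfl⟩ := he
    obtain ⟨⟨z, w⟩, hd, h⟩ := he'
    rw [hD, Finset.mem_filter] at hd
    simp only [hg₁, hg₂, Sym2.eq_iff, Prod.mk.injEq] at h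
    have hzw : z ≠ w := hd.2.ne
    rcases h with ⟨⟨rfl, -⟩, rfl, -⟩ | ⟨⟨rfl, -⟩, rfl, -⟩ <;> exact hzw rfl
  have hinj₁ : Set.InjOn g₁ (Finset.univ : Finset (ι × ZMod 6)) := by
    rintro ⟨x, i⟩ - ⟨y, j⟩ - h
    simp only [hg₁, Sym2.eq_iff, Prod.mk.injEq] at h
    rcases h with ⟨⟨rfl, rfl⟩, -⟩ | ⟨⟨rfl, h1⟩, -, h2⟩
    · rfl
    · exact absurd ⟨h1, h2⟩ ((by decide : ∀ i j : ZMod 6, ¬ (i = j + 1 ∧ i + 1 = j)) i j)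
  have hinj₂ : Set.InjOn g₂ D := by
    rintro ⟨x, y⟩ - ⟨z, w⟩ - h
    simp only [hg₂, Sym2.eq_iff, Prod.mk.injEq] at h
    rcases h with ⟨⟨rfl, -⟩, rfl, -⟩ | ⟨⟨rfl, h1⟩, rfl, h2⟩
    · rfl
    · exact absurd h1 ((by decide : ∀ i : ZMod 6, i ≠ i + 1) _)
  rw [mostarIndex_eq_finsum, hedge, finsum_mem_coe_finset, Finset.sum_union hdisj, hA,
    Finset.sum_image hinj₁, Finset.sum_image hinj₂]
  simp only [hexagonSum, Finset.sum_add_distrib]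
  congr 1
  · rw [Fintype.sum_prod_type]; rfl
  · rw [hD, Finset.sum_filter, Fintype.sum_prod_type]
    refine Finset.sum_congr rfl fun x _ => ?_
    simp only [linkSum]
    rw [Finset.sum_comm]
    refine Finset.sum_congr rfl fun y _ => ?_
    by_cases h : T.Adj x y
    · simp [h, hg₂, hG]
    · simp [h]

theorem mostarIndex_eq (hT : T.IsTree) (hs : Separated T side) {p q : Branch}
    (h : SplitsAs T side p q) : mostarIndex (hexagonAssembly T side) = 12 * mostar p q := by
  have hne := h.ne_nil
  obtain ⟨b, c, hbc, hp, hq⟩ := h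
  rw [mostarIndex_eq_sum_hexagonSum, ← sum_branchAt_add hT hs hbc,
    sum_hexagonSum hT hs hp (fun d hd hd' => by rw [hs.eq_of_side_eq hd hbc hd']; exact hq),
    sum_hexagonSum hT hs hq
      (fun d hd hd' => by rw [hs.eq_of_side_eq hd hbc.symm hd']; exact hp),
    edge_of_ne hne.1, edge_of_ne hne.2, mostar, abs_sub_comm (size q)]
  ring

end

/-! ### A phenylene is determined by its branches -/

section Transfer

variable {ι ι' : Type*} {T : SimpleGraph ι} {side : ι → ι → ZMod 6}
  {T' : SimpleGraph ι'} {side' : ι' → ι' → ZMod 6}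

/-- An isomorphism of trees extends to the phenylenes if it preserves the sides up to a rotation
`o x` of each hexagon `x`. -/
theorem nonempty_iso_of_transfer {f : ι → ι'} {o : ι → ZMod 6} (hf : Function.Bijective f)
    (hadj : ∀ x y, T'.Adj (f x) (f y) ↔ T.Adj x y)
    (hside : ∀ x y, T.Adj x y → side' (f x) (f y) = side x y + o x) :
    Nonempty (hexagonAssembly T side ≃g hexagonAssembly T' side') := by
  have hbij : Function.Bijective fun v : ι × ZMod 6 => (f v.1, v.2 + o v.1) := by
    constructor
    · rintro ⟨x, i⟩ ⟨y, j⟩ h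
      simp only [Prod.mk.injEq] at h
      obtain rfl := hf.1 h.1
      simpa using h.2
    · rintro ⟨x, i⟩
      obtain ⟨y, rfl⟩ := hf.2 x
      exact ⟨(y, i - o y), by simp⟩
  refine ⟨⟨Equiv.ofBijective _ hbij, ?_⟩⟩
  rintro ⟨x, i⟩ ⟨y, j⟩
  simp only [Equiv.ofBijective_apply, hexagonAssembly, hf.1.eq_iff, hadj]
  refine or_congr ?_ ?_
  · refine and_congr_right ?_
    rintro rfl
    rw [add_right_comm, add_left_inj, add_right_comm, add_left_inj]
  · refine and_congr_right fun h => ?_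
    rw [hside x y h, hside y x h.symm, add_right_comm _ _ 1, add_right_comm _ _ 1]
    simp only [add_left_inj]

open Classical in
/-- The hexagon that is joined to side `i` of the hexagon `b`, and `b` itself if there is none. -/
noncomputable def neighborAt (T : SimpleGraph ι) (side : ι → ι → ZMod 6) (b : ι) (i : ZMod 6) : ι :=
  if h : ∃ c, T.Adj b c ∧ side b c = i then h.choose else b

theorem neighborAt_spec {b : ι} {i : ZMod 6} {p : Branch} (h : Realizes T side p b i)
    (hp : p ≠ nil) : T.Adj b (neighborAt T side b i) ∧ side b (neighborAt T side b i) = i := by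
  cases p with
  | nil => exact absurd rfl hp
  | node l m r =>
    obtain ⟨c, h1, h2, -⟩ := h
    have : ∃ c, T.Adj b c ∧ side b c = i := ⟨c, h1, h2⟩
    rw [neighborAt, dif_pos this]
    exact this.choose_spec

/-- The recursion that carries a phenylene over to another one with the same branches, starting
with the hexagon `b` that is put in place of `b'` with a rotation by `o`: the image of the hexagon
`x`, at distance `n` from `b`, and the rotation that is applied to `x`. -/
noncomputable def transferAux (T : SimpleGraph ι) (side : ι → ι → ZMod 6) (T' : SimpleGraph ι')
    (side' : ι' → ι' → ZMod 6) (b : ι) (b' : ι') (o : ZMod 6) : ℕ → ι → ι' × ZMod 6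
  | 0, _ => (b', o)
  | n + 1, x =>
    let y := parent T b x
    let z := transferAux T side T' side' b b' o n y
    let c := neighborAt T' side' z.1 (side y x + z.2)
    (c, side' c z.1 - side x y)

theorem exists_transfer_aux (hT : T.IsTree) (b : ι) (b' : ι') (o₀ : ZMod 6) :
    ∃ (f : ι → ι') (o : ι → ZMod 6), f b = b' ∧ o b = o₀ ∧ ∀ x, x ≠ b →
      f x = neighborAt T' side' (f (parent T b x)) (side (parent T b x) x + o (parent T b x)) ∧
      o x = side' (f x) (f (parent T b x)) - side x (parent T b x) := by
  set t := fun x => transferAux T side T' side' b b' o₀ (T.dist b x) x with ht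
  have h0 : t b = (b', o₀) := by simp only [ht, SimpleGraph.dist_self, transferAux]
  refine ⟨fun x => (t x).1, fun x => (t x).2, congrArg Prod.fst h0, congrArg Prod.snd h0,
    fun x hx => ?_⟩
  have : t x = (neighborAt T' side' (t (parent T b x)).1 (side (parent T b x) x +
      (t (parent T b x)).2), side' (neighborAt T' side' (t (parent T b x)).1
        (side (parent T b x) x + (t (parent T b x)).2)) (t (parent T b x)).1 -
        side x (parent T b x)) := by
    simp only [ht]
    rw [← dist_parent hT hx, transferAux]
  constructor
  · exact congrArg Prod.fst this
  · dsimp only; rw [this]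

/-- Two phenylenes of the same size that realize the same branches around a hexagon have isomorphic
trees, by an isomorphism that preserves the sides up to rotations of the hexagons. -/
theorem exists_transfer [Fintype ι] [Fintype ι'] (hcard : Fintype.card ι = Fintype.card ι')
    (hT : T.IsTree) (hs : Separated T side) (hT' : T'.IsTree) (hs' : Separated T' side')
    {b : ι} {b' : ι'} {o₀ : ZMod 6}
    (h : ∀ i, ∃ p, Realizes T side p b i ∧ Realizes T' side' p b' (i + o₀)) :
    ∃ (f : ι → ι') (o : ι → ZMod 6), Function.Bijective f ∧
      (∀ x y, T'.Adj (f x) (f y) ↔ T.Adj x y) ∧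
      ∀ x y, T.Adj x y → side' (f x) (f y) = side x y + o x := by
  obtain ⟨f, o, hfb, hob, hfo⟩ := exists_transfer_aux (side := side) (T' := T') (side' := side')
    hT b b' o₀
  -- As soon as the branches of `T` and `T'` that contain `x` and its image agree, the edge from
  -- `x` to its parent is carried over.
  have link : ∀ x, x ≠ b → (∃ p, Realizes T side p (parent T b x) (side (parent T b x) x) ∧
      Realizes T' side' p (f (parent T b x)) (side (parent T b x) x + o (parent T b x))) →
      T'.Adj (f (parent T b x)) (f x) ∧
      side' (f (parent T b x)) (f x) = side (parent T b x) x + o (parent T b x) ∧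
      side' (f x) (f (parent T b x)) = side x (parent T b x) + o x := by
    rintro x hx ⟨p, hp, hp'⟩
    obtain ⟨h1, h2⟩ := hfo x hx
    have h3 := neighborAt_spec hp' (hp.ne_nil (adj_parent hT hx).symm)
    rw [← h1] at h3
    exact ⟨h3.1, h3.2, by rw [h2]; ring⟩
  have inv : ∀ x, x ≠ b → ∃ p, Realizes T side p (parent T b x) (side (parent T b x) x) ∧
      Realizes T' side' p (f (parent T b x)) (side (parent T b x) x + o (parent T b x)) := by
    refine parent_induction hT b (fun h => absurd rfl h) fun x hx ih _ => ?_
    by_cases hy : parent T b x = b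
    · rw [hy, hfb, hob]; exact h _
    · obtain ⟨h1, h2, h3⟩ := link _ hy (ih hy)
      obtain ⟨p, hp, hp'⟩ := ih hy
      have hzy := adj_parent hT hy
      have hyx := (adj_parent hT hx).symm
      cases p with
      | nil => exact absurd rfl (hp.ne_nil hzy.symm)
      | node l m r =>
        rw [← h2] at hp'
        obtain ⟨k1, k2, k3⟩ := hp.of_adj hs hzy.symm
        obtain ⟨k1', k2', k3'⟩ := hp'.of_adj hs' h1
        rw [h3] at k1' k2' k3'
        have hne : parent T b (parent T b x) ≠ x := by
          intro h
          have d1 := dist_parent hT hx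
          have d2 := dist_parent hT hy
          rw [h] at d2
          omega
        rcases hs.side_eq hzy hyx hne with hd | hd | hd
        · exact ⟨l, by rw [hd]; exact k1, by rw [hd, add_right_comm]; exact k1'⟩
        · exact ⟨m, by rw [hd]; exact k2, by rw [hd, add_right_comm]; exact k2'⟩
        · exact ⟨r, by rw [hd]; exact k3, by rw [hd, add_right_comm]; exact k3'⟩
  replace link := fun x hx => link x hx (inv x hx)
  -- Neighbours go to neighbours on different sides, so the image of a path never turns back.
  have dist_eq : ∀ x, T'.dist b' (f x) = T.dist b x ∧
      (x ≠ b → f x ≠ b' ∧ parent T' b' (f x) = f (parent T b x)) := by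
    refine parent_induction hT b ⟨by rw [hfb]; simp, fun h => absurd rfl h⟩ fun x hx ih => ?_
    obtain ⟨h1, h2, h3⟩ := link x hx
    rcases parent_or_parent hT' b' h1.symm with ⟨h4, h5⟩ | ⟨h4, h5⟩
    · refine ⟨?_, fun _ => ⟨h4, h5⟩⟩
      rw [← dist_parent hT' h4, h5, ih.1, dist_parent hT hx]
    · exfalso
      have hy : parent T b x ≠ b := by
        intro h; rw [h] at h4; exact h4 hfb
      obtain ⟨k1, k2, k3⟩ := link _ hy
      have h6 := (ih.2 hy).2
      rw [h5] at h6
      rw [← h6, h2] at k3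
      have h7 := hs.eq_of_side_eq (adj_parent hT hx).symm (adj_parent hT hy) (by simpa using k3)
      have d1 := dist_parent hT hx
      have d2 := dist_parent hT hy
      rw [← h7] at d2
      omega
  have hinj : ∀ x y, f x = f y → x = y := by
    refine parent_induction hT b ?_ ?_
    · intro y hy
      have := (dist_eq y).1
      rw [← hy, hfb, SimpleGraph.dist_self] at this
      exact (hT.connected.dist_eq_zero_iff).1 this.symm
    · intro x hx ih y hxy
      have hy : y ≠ b := by
        rintro rfl
        rw [hfb] at hxy
        exact ((dist_eq x).2 hx).1 hxy
      have h1 := ((dist_eq x).2 hx).2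
      have h2 := ((dist_eq y).2 hy).2
      rw [hxy, h2] at h1
      have h3 := ih _ h1.symm
      have h4 := (link x hx).2.1
      have h5 := (link y hy).2.1
      rw [hxy, h3, h5] at h4
      have h6 := (adj_parent hT hx).symm
      rw [h3] at h6
      exact hs.eq_of_side_eq h6 (adj_parent hT hy).symm (add_right_cancel h4).symm
  refine ⟨f, o, (Fintype.bijective_iff_injective_and_card f).2 ⟨fun x y => hinj x y, hcard⟩,
    fun x y => ⟨fun hxy => ?_, fun hxy => ?_⟩, fun x y hxy => ?_⟩
  · have key : ∀ x y, f x ≠ b' → parent T' b' (f x) = f y → T.Adj x y := by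
      intro x y h1 h2
      have hx : x ≠ b := by rintro rfl; exact h1 hfb
      rw [((dist_eq x).2 hx).2] at h2
      rw [← hinj _ _ h2]; exact adj_parent hT hx
    rcases parent_or_parent hT' b' hxy with ⟨h1, h2⟩ | ⟨h1, h2⟩
    · exact key x y h1 h2
    · exact (key y x h1 h2).symm
  · rcases parent_or_parent hT b hxy with ⟨h1, rfl⟩ | ⟨h1, rfl⟩
    · exact (link x h1).1.symm
    · exact (link y h1).1
  · rcases parent_or_parent hT b hxy with ⟨h1, rfl⟩ | ⟨h1, rfl⟩
    · exact (link x h1).2.2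
    · exact (link y h1).2.1

/-- A phenylene is determined up to isomorphism by the two branches left by a cut. -/
theorem nonempty_iso_of_splitsAs [Fintype ι] [Fintype ι'] (hT : T.IsTree) (hs : Separated T side)
    (hT' : T'.IsTree) (hs' : Separated T' side') {p q : Branch} (h : SplitsAs T side p q)
    (h' : SplitsAs T' side' p q) :
    Nonempty (hexagonAssembly T side ≃g hexagonAssembly T' side') := by
  have hcard : Fintype.card ι = Fintype.card ι' := by
    have h1 := h.size_add_size hT hs
    have h2 := h'.size_add_size hT' hs'
    omega
  obtain ⟨b, c, hbc, hp, hq⟩ := h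
  obtain ⟨b', c', hbc', hp', hq'⟩ := h'
  cases q with
  | nil => exact absurd rfl (hq.ne_nil hbc.symm)
  | node l m r =>
    obtain ⟨hl, hm, hr⟩ := hq.of_adj hs hbc.symm
    obtain ⟨hl', hm', hr'⟩ := hq'.of_adj hs' hbc'.symm
    obtain ⟨f, o, hf, hadj, hside⟩ := exists_transfer hcard hT hs hT' hs'
      (b := b) (b' := b') (o₀ := side' b' c' - side b c) (by
        intro i
        refine ⟨around p l m r (i - side b c), ?_, ?_⟩
        · have := Realizes.around hs hbc.symm hp hl hm hr (i - side b c)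
          rwa [add_sub_cancel] at this
        · have := Realizes.around hs' hbc'.symm hp' hl' hm' hr' (i - side b c)
          rwa [show side' b' c' + (i - side b c) = i + (side' b' c' - side b c) by ring] at this)
    exact nonempty_iso_of_transfer hf hadj hside

end Transfer

/-! ### Reflection of a phenylene -/

section Mirror

variable {ι : Type*} {T : SimpleGraph ι} {side : ι → ι → ZMod 6}

/-- The sides after a reflection of each hexagon by `i ↦ -i` on its vertices. Side `i`, from vertex
`i` to vertex `i + 1`, becomes side `-i - 1`. -/
def mirrorSide (side : ι → ι → ZMod 6) : ι → ι → ZMod 6 := fun a b => -side a b - 1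

/-- A phenylene is isomorphic to its reflection. -/
def mirrorIso (T : SimpleGraph ι) (side : ι → ι → ZMod 6) :
    hexagonAssembly T side ≃g hexagonAssembly T (mirrorSide side) where
  toEquiv := (Equiv.refl ι).prodCongr (Equiv.neg (ZMod 6))
  map_rel_iff' := by
    rintro ⟨x, i⟩ ⟨y, j⟩
    have h1 : ∀ i j : ZMod 6, -j = -i + 1 ↔ i = j + 1 := by decide
    have h2 : ∀ i s : ZMod 6, -i = -s - 1 ↔ i = s + 1 := by decide
    have h3 : ∀ i s : ZMod 6, -i = -s - 1 + 1 ↔ i = s := by decide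
    simp only [hexagonAssembly, mirrorSide, Equiv.prodCongr_apply, Equiv.coe_refl, Prod.map_apply,
      id_eq, Equiv.neg_apply, h1, h2, h3]
    exact or_congr (and_congr_right fun _ => or_comm) (and_congr_right fun _ => or_comm)

theorem Separated.mirror (hs : Separated T side) : Separated T (mirrorSide side) := by
  intro a b c hb hc hbc
  have := hs a b c hb hc hbc
  simp only [mirrorSide]
  generalize side a b = i at *
  generalize side a c = j at *
  revert i j; decide

theorem Realizes.mirror {p : Branch} {b : ι} {i : ZMod 6} (h : Realizes T side p b i) :
    Realizes T (mirrorSide side) p.mirror b (-i - 1) := by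
  induction p generalizing b i with
  | nil =>
    intro c hc h'
    exact h c hc (by simpa [mirrorSide] using h')
  | node l m r hl hm hr =>
    obtain ⟨c, hbc, rfl, h1, h2, h3⟩ := h
    have e2 : ∀ i : ZMod 6, -(i + 2) - 1 = -i - 1 + 4 := by decide
    have e3 : ∀ i : ZMod 6, -(i + 3) - 1 = -i - 1 + 3 := by decide
    have e4 : ∀ i : ZMod 6, -(i + 4) - 1 = -i - 1 + 2 := by decide
    refine ⟨c, hbc, rfl, ?_, ?_, ?_⟩
    · have := hr h3; rwa [e4] at this
    · have := hm h2; rwa [e3] at this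
    · have := hl h1; rwa [e2] at this

theorem SplitsAs.mirror {p q : Branch} (h : SplitsAs T side p q) :
    SplitsAs T (mirrorSide side) p.mirror q.mirror := by
  obtain ⟨b, c, h1, h2, h3⟩ := h
  exact ⟨b, c, h1, h2.mirror, h3.mirror⟩

/-! ### Moving the cut -/

/-- The place of the cut moves by one hexagon, which is passed straight. Together with the next
lemmas this allows the cut to be moved along the whole phenylene. -/
theorem SplitsAs.of_middle (hs : Separated T side) {m q : Branch} (hm : m ≠ nil)
    (h : SplitsAs T side (node nil m nil) q) : SplitsAs T side m (node nil q nil) := by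
  obtain ⟨b, c, hbc, hp, hq⟩ := h
  have h1 := (hp.of_adj hs hbc).2.1
  obtain ⟨h2, h3⟩ := neighborAt_spec h1 hm
  exact ⟨c, _, h2, by rw [h3]; exact h1, Realizes.middle_context hs hbc h2 h3 hq⟩

theorem SplitsAs.of_left (hs : Separated T side) {l r q : Branch} (hl : l ≠ nil)
    (h : SplitsAs T side (node l nil r) q) : SplitsAs T side l (node r nil q) := by
  obtain ⟨b, c, hbc, hp, hq⟩ := h
  have h1 := (hp.of_adj hs hbc).1
  have h1' := (hp.of_adj hs hbc).2.2
  obtain ⟨h2, h3⟩ := neighborAt_spec h1 hl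
  exact ⟨c, _, h2, by rw [h3]; exact h1, Realizes.left_context hs hbc h2 h3 h1' hq⟩

theorem SplitsAs.of_right (hs : Separated T side) {l r q : Branch} (hr : r ≠ nil)
    (h : SplitsAs T side (node l nil r) q) : SplitsAs T side r (node q nil l) := by
  obtain ⟨b, c, hbc, hp, hq⟩ := h
  have h1 := (hp.of_adj hs hbc).2.2
  have h1' := (hp.of_adj hs hbc).1
  obtain ⟨h2, h3⟩ := neighborAt_spec h1 hr
  exact ⟨c, _, h2, by rw [h3]; exact h1, Realizes.right_context hs hbc h2 h3 h1' hq⟩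

theorem SplitsAs.of_straight (hs : Separated T side) {m q : Branch} (hm : m ≠ nil) (n : ℕ)
    (h : SplitsAs T side (straight n m) q) : SplitsAs T side m (straight n q) := by
  induction n generalizing q with
  | zero => exact h
  | succ n ih =>
    have h0 : straight n m ≠ nil := by
      cases n with
      | zero => exact hm
      | succ n => exact Branch.noConfusion
    have := ih (SplitsAs.of_middle hs h0 h)
    rwa [straight_succ_comm] at this

theorem SplitsAs.to_straight (hs : Separated T side) {m q : Branch} (hq : q ≠ nil) (n : ℕ)
    (h : SplitsAs T side m (straight n q)) : SplitsAs T side (straight n m) q :=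
  (SplitsAs.of_straight hs hq n h.symm).symm

theorem SplitsAs.of_bentLeft (hs : Separated T side) {q : Branch} {i : ℕ}
    (h : SplitsAs T side (bentLeft i) q) : SplitsAs T side (line 1) (node nil nil (straight i q)) :=
  SplitsAs.of_left hs Branch.noConfusion (SplitsAs.of_straight hs Branch.noConfusion i h)

theorem SplitsAs.to_bentLeft (hs : Separated T side) {q : Branch} (hq : q ≠ nil) {i : ℕ}
    (h : SplitsAs T side (line 1) (node nil nil (straight i q))) :
    SplitsAs T side (bentLeft i) q := by
  have h0 : straight i q ≠ nil := by
    cases i with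
    | zero => exact hq
    | succ n => exact Branch.noConfusion
  exact SplitsAs.to_straight hs hq i (SplitsAs.of_right hs h0 h.symm).symm

end Mirror

/-! ### Phenylene chains -/

/-- The branch with the turn word `w`. The letter `1` of a turn word refers to the side
`3 + 1 = 4`, so it is a turn to the right in the sense of `Branch`. -/
def toBranch : List (ZMod 6) → Branch
  | [] => nil
  | x :: w => if x = 0 then node nil (toBranch w) nil else
      if x = 1 then node nil nil (toBranch w) else node (toBranch w) nil nil

/-- The sides by which the hexagons of `phenyleneChain w` are joined. -/
def chainSide (w : List (ZMod 6)) : Fin w.length → Fin w.length → ZMod 6 :=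
  fun a b => if b.val = a.val + 1 then 3 + w.get a else 0

/-- The words that describe a chain in which quadrilaterals at the same hexagon have no common
vertex. Other letters stand for the entry itself or for a side that meets it. -/
def IsTurnWord (w : List (ZMod 6)) : Prop := ∀ x ∈ w, x = 0 ∨ x = 1 ∨ x = -1

theorem isTree_pathGraph {n : ℕ} (hn : 0 < n) : (SimpleGraph.pathGraph n).IsTree := by
  obtain ⟨n, rfl⟩ := Nat.exists_eq_add_of_le' hn
  refine isTree_of_parent (SimpleGraph.pathGraph_connected n) 0
    (fun x => ⟨x.val - 1, by omega⟩) fun x y h => ?_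
  rw [SimpleGraph.pathGraph_adj] at h
  simp only [Fin.ext_iff, ne_eq, Fin.val_zero]
  omega

theorem separated_chainSide {w : List (ZMod 6)} (hw : IsTurnWord w) :
    Separated (SimpleGraph.pathGraph w.length) (chainSide w) := by
  intro a b c hb hc hbc
  rw [SimpleGraph.pathGraph_adj] at hb hc
  have hbc' : b.val ≠ c.val := fun h => hbc (Fin.ext h)
  have ha := hw (w.get a) (List.get_mem w a)
  generalize hx : w.get a = x at ha
  have key : ∀ x : ZMod 6, (x = 0 ∨ x = 1 ∨ x = -1) →
      (3 + x ≠ 0 ∧ 3 + x ≠ 0 + 1 ∧ 0 ≠ 3 + x + 1) := by decide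
  obtain ⟨k1, k2, k3⟩ := key x ha
  simp only [chainSide, hx]
  by_cases h : b.val = a.val + 1
  · rw [if_pos h, if_neg (by omega)]
    exact ⟨k1, k2, k3⟩
  · rw [if_neg h, if_pos (by omega)]
    exact ⟨k1.symm, k3, k2⟩

theorem chainSide_eq (w : List (ZMod 6)) (a b : Fin w.length) :
    chainSide w a b = 0 ∨ chainSide w a b = 3 + w.get a := by
  rw [chainSide]; split_ifs <;> simp

theorem realizes_toBranch {w : List (ZMod 6)} (hw : IsTurnWord w) {v : List (ZMod 6)}
    (i : Fin w.length) (hv : w.drop (i.val + 1) = v) :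
    Realizes (SimpleGraph.pathGraph w.length) (chainSide w) (toBranch v) i (3 + w.get i) := by
  induction v generalizing i with
  | nil =>
    intro c hc
    rw [List.drop_eq_nil_iff] at hv
    rw [SimpleGraph.pathGraph_adj] at hc
    have hi := hw (w.get i) (List.get_mem w i)
    rw [chainSide, if_neg (by omega)]
    generalize w.get i = x at hi
    revert x; decide
  | cons x v ih =>
    have hlt : i.val + 1 < w.length := by
      by_contra h
      rw [List.drop_of_length_le (by omega)] at hv
      exact List.noConfusion rfl (heq_of_eq hv)
    set c : Fin w.length := ⟨i.val + 1, hlt⟩ with hc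
    have hcons := List.drop_eq_getElem_cons hlt
    rw [hv, List.cons_eq_cons] at hcons
    obtain ⟨hx, hv'⟩ := hcons
    have hx' : w.get c = x := hx.symm
    have hic : (SimpleGraph.pathGraph w.length).Adj i c := by
      rw [SimpleGraph.pathGraph_adj]; exact .inl rfl
    have h1 : chainSide w i c = 3 + w.get i := if_pos rfl
    have h2 : chainSide w c i = 0 := if_neg (by rw [hc]; simp only; omega)
    have ih' := ih c hv'.symm
    rw [hx'] at ih'
    have hxw := hw x (hx' ▸ List.get_mem w c)
    have hnil : ∀ k : ZMod 6, k ≠ 0 → k ≠ 3 + x →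
        Realizes (SimpleGraph.pathGraph w.length) (chainSide w) nil c k := by
      intro k hk0 hk d _ hd
      rcases chainSide_eq w c d with h | h
      · exact hk0 (hd.symm.trans h)
      · exact hk (by rw [← hd, h, hx'])
    rcases hxw with rfl | rfl | rfl
    · rw [toBranch, if_pos rfl]
      refine ⟨c, hic, h1, ?_, ?_, ?_⟩ <;> rw [h2]
      · exact hnil _ (by decide) (by decide)
      · exact ih'
      · exact hnil _ (by decide) (by decide)
    · rw [toBranch, if_neg (by decide), if_pos rfl]
      refine ⟨c, hic, h1, ?_, ?_, ?_⟩ <;> rw [h2]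
      · exact hnil _ (by decide) (by decide)
      · exact hnil _ (by decide) (by decide)
      · exact ih'
    · rw [toBranch, if_neg (by decide), if_neg (by decide)]
      refine ⟨c, hic, h1, ?_, ?_, ?_⟩ <;> rw [h2]
      · exact ih'
      · exact hnil _ (by decide) (by decide)
      · exact hnil _ (by decide) (by decide)

/-- A chain, cut after its first hexagon. -/
theorem splitsAs_chain {x y : ZMod 6} {v : List (ZMod 6)} (hw : IsTurnWord (x :: y :: v)) :
    SplitsAs (SimpleGraph.pathGraph (x :: y :: v).length) (chainSide (x :: y :: v)) (line 1)
      (toBranch (y :: v)) := by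
  set w := x :: y :: v with hwdef
  have hlen : w.length = v.length + 2 := by rw [hwdef]; rfl
  set a : Fin w.length := ⟨0, by omega⟩ with ha
  set b : Fin w.length := ⟨1, by omega⟩ with hb
  have hab : (SimpleGraph.pathGraph w.length).Adj a b := by
    rw [SimpleGraph.pathGraph_adj]; exact .inl rfl
  have hside : chainSide w a b = 3 + w.get a := if_pos rfl
  refine ⟨b, a, hab.symm, ⟨a, hab.symm, rfl, ?_⟩, ?_⟩
  · have : ∀ k : ZMod 6, k ≠ 0 → Realizes (SimpleGraph.pathGraph w.length) (chainSide w) nil a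
        (chainSide w a b + k) := by
      intro k hk d hd
      rw [SimpleGraph.pathGraph_adj] at hd
      have : d = b := by
        apply Fin.ext
        simp only [ha, hb] at hd ⊢
        omega
      rw [this]
      simpa using hk
    exact ⟨this _ (by decide), this _ (by decide), this _ (by decide)⟩
  · rw [hside]
    exact realizes_toBranch hw a rfl

theorem toBranch_replicate_append (n : ℕ) (v : List (ZMod 6)) :
    toBranch (List.replicate n 0 ++ v) = straight n (toBranch v) := by
  induction n with
  | zero => rfl
  | succ n ih => rw [List.replicate_succ, List.cons_append, toBranch, if_pos rfl, ih]; rfl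

theorem toBranch_replicate (n : ℕ) : toBranch (List.replicate n 0) = line n := by
  have := toBranch_replicate_append n []
  rwa [List.append_nil] at this

theorem isTurnWord_linear (n : ℕ) : IsTurnWord (List.replicate n 0) :=
  fun _ hx => .inl (List.eq_of_mem_replicate hx)

theorem isTurnWord_cons {x : ZMod 6} {w : List (ZMod 6)} (hx : x = 0 ∨ x = 1 ∨ x = -1)
    (hw : IsTurnWord w) : IsTurnWord (x :: w) := by
  intro y hy
  rcases List.mem_cons.1 hy with rfl | h
  · exact hx
  · exact hw y h

theorem isTurnWord_append {v w : List (ZMod 6)} (hv : IsTurnWord v) (hw : IsTurnWord w) :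
    IsTurnWord (v ++ w) := fun y hy => (List.mem_append.1 hy).elim (hv y) (hw y)

/-- `IsTreelikePhenylene` does not depend on the index type of the hexagons. -/
theorem isTreelikePhenylene_hexagonAssembly {ι : Type*} [Fintype ι] {T : SimpleGraph ι}
    {side : ι → ι → ZMod 6} (hT : T.IsTree) (hs : Separated T side) {h : ℕ}
    (hcard : Fintype.card ι = h) : IsTreelikePhenylene h (hexagonAssembly T side) := by
  have e := Fintype.equivFinOfCardEq hcard
  refine ⟨T.comap e.symm, fun a b => side (e.symm a) (e.symm b), ?_, ?_, ?_⟩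
  · exact (SimpleGraph.Iso.isTree_iff (SimpleGraph.Iso.comap e.symm T)).2 hT
  · intro a b c hb hc hbc
    exact hs _ _ _ hb hc (fun h => hbc (e.symm.injective h))
  · refine nonempty_iso_of_transfer (f := e) (o := fun _ => 0) e.bijective ?_ ?_
    · intro x y; simp
    · intro x y _; simp

theorem isTreelikePhenylene_chain {w : List (ZMod 6)} (hw : IsTurnWord w) (h0 : w ≠ []) {h : ℕ}
    (hlen : w.length = h) : IsTreelikePhenylene h (phenyleneChain w) :=
  isTreelikePhenylene_hexagonAssembly (isTree_pathGraph (List.length_pos_iff.2 h0))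
    (separated_chainSide hw) (by simp [hlen])

/-! ### The phenylene with one hexagon in each of three branches -/

/-- The branches of `P_L(1, 1, 1)` have one hexagon each. -/
theorem branch_index_eq_zero (b : Fin 3) (i : Fin (![1, 1, 1] b)) : i.val = 0 := by
  have := i.isLt
  have h1 : ![1, 1, 1] b = 1 := by fin_cases b <;> rfl
  omega

theorem treePL_adj_iff (x y : PLIndex 1 1 1) :
    (treePL 1 1 1).Adj x y ↔ (x = none ∧ y ≠ none) ∨ (y = none ∧ x ≠ none) := by
  rcases x with _ | ⟨b, i⟩ <;> rcases y with _ | ⟨c, j⟩ <;>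
    simp [treePL, SimpleGraph.fromRel_adj, branch_index_eq_zero]

/-- The only hexagon of the branch `b` of `P_L(1, 1, 1)`. -/
def outer (b : Fin 3) : PLIndex 1 1 1 := some ⟨b, ⟨0, by fin_cases b <;> exact Nat.one_pos⟩⟩

theorem eq_outer (b : Fin 3) (i : Fin (![1, 1, 1] b)) :
    (some ⟨b, i⟩ : PLIndex 1 1 1) = outer b := by
  rw [outer]
  congr 2
  exact Fin.ext (branch_index_eq_zero b i)

theorem treePL_adj_none {x : PLIndex 1 1 1} (h : (treePL 1 1 1).Adj none x) :
    ∃ b, x = outer b := by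
  rcases x with _ | ⟨b, i⟩
  · exact absurd rfl h.ne
  · exact ⟨b, eq_outer b i⟩

theorem treePL_none_adj (b : Fin 3) : (treePL 1 1 1).Adj none (outer b) :=
  (treePL_adj_iff _ _).2 (.inl ⟨rfl, Option.some_ne_none _⟩)

theorem isTree_treePL : (treePL 1 1 1).IsTree := by
  refine isTree_of_parent ?_ none (fun _ => none) fun x y h => ?_
  · have key : ∀ x, (treePL 1 1 1).Reachable none x := by
      rintro (_ | ⟨b, i⟩)
      · rfl
      · rw [eq_outer]; exact (treePL_none_adj b).reachable
    rw [SimpleGraph.connected_iff]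
    exact ⟨fun x y => (key x).symm.trans (key y), ⟨none⟩⟩
  · rcases (treePL_adj_iff x y).1 h with ⟨h1, h2⟩ | ⟨h1, h2⟩
    · exact .inr ⟨h2, h1⟩
    · exact .inl ⟨h2, h1⟩

theorem treePL_adj_outer {b : Fin 3} {x : PLIndex 1 1 1} (h : (treePL 1 1 1).Adj (outer b) x) :
    x = none := by
  rcases (treePL_adj_iff _ x).1 h with ⟨h1, h2⟩ | ⟨h1, h2⟩
  · exact absurd h1 (Option.some_ne_none _)
  · exact h1

theorem separated_sidePL : Separated (treePL 1 1 1) (sidePL 1 1 1) := by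
  intro a b c hb hc hbc
  rcases a with _ | ⟨d, i⟩
  · obtain ⟨b, rfl⟩ := treePL_adj_none hb
    obtain ⟨c, rfl⟩ := treePL_adj_none hc
    have hne : b ≠ c := fun h => hbc (by rw [h])
    have key : ∀ b c : Fin 3, b ≠ c → (2 * (b.val : ZMod 6) ≠ 2 * (c.val : ZMod 6) ∧
      2 * (b.val : ZMod 6) ≠ 2 * (c.val : ZMod 6) + 1 ∧
      2 * (c.val : ZMod 6) ≠ 2 * (b.val : ZMod 6) + 1) := by decide
    exact key b c hne
  · rw [eq_outer] at hb hc
    exact absurd ((treePL_adj_outer hb).trans (treePL_adj_outer hc).symm) hbc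

theorem realizes_outer (b : Fin 3) :
    Realizes (treePL 1 1 1) (sidePL 1 1 1) (line 1) none (2 * (b.val : ZMod 6)) := by
  have hnil : ∀ k : ZMod 6, k ≠ 0 → Realizes (treePL 1 1 1) (sidePL 1 1 1) nil (outer b)
      (sidePL 1 1 1 (outer b) none + k) := by
    intro k hk d hd
    rw [treePL_adj_outer hd]
    simpa using hk
  exact ⟨outer b, treePL_none_adj b, rfl, hnil _ (by decide), hnil _ (by decide),
    hnil _ (by decide)⟩

theorem splitsAs_star : SplitsAs (treePL 1 1 1) (sidePL 1 1 1) (line 1)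
    (node (line 1) nil (line 1)) := by
  refine ⟨none, outer 0, treePL_none_adj 0, realizes_outer 0, none, (treePL_none_adj 0).symm, rfl,
    realizes_outer 1, ?_, realizes_outer 2⟩
  intro c hc h
  obtain ⟨b, rfl⟩ := treePL_adj_none hc
  have key : ∀ b : Fin 3, (2 * (b.val : ZMod 6)) ≠ 2 * ((0 : Fin 3).val : ZMod 6) + 3 := by decide
  exact key b h

/-! ### The extremal phenylenes -/

theorem straight_straight (i j : ℕ) (p : Branch) :
    straight i (straight j p) = straight (i + j) p := by
  induction i with
  | zero => rw [Nat.zero_add]; rfl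
  | succ i ih => rw [Nat.succ_add, straight, straight, ih]

theorem splitsAs_of_word {w v : List (ZMod 6)} {x y : ZMod 6} (h : w = x :: y :: v)
    (hw : IsTurnWord w) :
    SplitsAs (SimpleGraph.pathGraph w.length) (chainSide w) (line 1) (toBranch (y :: v)) := by
  subst h; exact splitsAs_chain hw

/-- The turn word of `C_L(1, n)`. -/
abbrev word₂ (n : ℕ) : List (ZMod 6) := List.replicate 1 0 ++ [1] ++ List.replicate n 0

/-- The turn word of `C_L(1, k, 1)`. -/
abbrev word₃ (k : ℕ) : List (ZMod 6) :=
  List.replicate 1 0 ++ [1] ++ List.replicate k 0 ++ [-1] ++ List.replicate 1 0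

theorem isTurnWord_word₂ (n : ℕ) : IsTurnWord (word₂ n) :=
  isTurnWord_append (isTurnWord_append (isTurnWord_linear 1)
    (isTurnWord_cons (.inr (.inl rfl)) (isTurnWord_linear 0))) (isTurnWord_linear n)

theorem isTurnWord_word₃ (k : ℕ) : IsTurnWord (word₃ k) :=
  isTurnWord_append (isTurnWord_append (isTurnWord_word₂ k)
    (isTurnWord_cons (.inr (.inr rfl)) (isTurnWord_linear 0))) (isTurnWord_linear 1)

theorem isTree_word₂ (n : ℕ) : (SimpleGraph.pathGraph (word₂ n).length).IsTree :=
  isTree_pathGraph (by simp [word₂])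

theorem isTree_word₃ (k : ℕ) : (SimpleGraph.pathGraph (word₃ k).length).IsTree :=
  isTree_pathGraph (by simp [word₃])

theorem isTree_linear (n : ℕ) :
    (SimpleGraph.pathGraph (List.replicate (n + 1) (0 : ZMod 6)).length).IsTree :=
  isTree_pathGraph (by simp)

theorem splitsAs_linear (n : ℕ) :
    SplitsAs (SimpleGraph.pathGraph (List.replicate (n + 2) (0 : ZMod 6)).length)
      (chainSide (List.replicate (n + 2) 0)) (line 1) (line (n + 1)) := by
  have := splitsAs_of_word (w := List.replicate (n + 2) (0 : ZMod 6)) (v := List.replicate n 0)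
    (x := 0) (y := 0) rfl (isTurnWord_linear _)
  rwa [show toBranch (0 :: List.replicate n 0) = line (n + 1) from
    toBranch_replicate (n + 1)] at this

theorem splitsAs_word₂ (n : ℕ) : SplitsAs (SimpleGraph.pathGraph (word₂ n).length)
    (chainSide (word₂ n)) (line 1) (node nil nil (line n)) := by
  have := splitsAs_of_word (w := word₂ n) (v := List.replicate n 0) (x := 0) (y := 1) rfl
    (isTurnWord_word₂ n)
  rwa [toBranch, if_neg (by decide), if_pos rfl, toBranch_replicate] at this

theorem splitsAs_word₃ (k : ℕ) : SplitsAs (SimpleGraph.pathGraph (word₃ k).length)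
    (chainSide (word₃ k)) (line 1) (node nil nil (bentLeft k)) := by
  have := splitsAs_of_word (w := word₃ k) (v := List.replicate k 0 ++ [-1, 0]) (x := 0) (y := 1)
    (by simp [word₃]) (isTurnWord_word₃ k)
  rw [toBranch, if_neg (by decide), if_pos rfl, toBranch_replicate_append] at this
  exact this

/-- The sizes `i + 2` and `j` of the two halves of a chain with `h` hexagons. -/
theorem exists_half {h : ℕ} (h4 : 4 ≤ h) : ∃ i j, h = i + 2 + j ∧ (j = i + 2 ∨ j = i + 3) :=
  ⟨h / 2 - 2, h - h / 2, by omega, by omega⟩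

theorem mostarIndex_linearChain {h : ℕ} (h4 : 4 ≤ h) :
    mostarIndex (linearChain h) = 12 * linearValue h := by
  obtain ⟨i, j, rfl, hj⟩ := exists_half h4
  obtain ⟨j, rfl⟩ := Nat.exists_eq_add_of_le' (show 2 ≤ j by omega)
  have h1 := splitsAs_linear (i + 2 + j)
  have hs := separated_chainSide (isTurnWord_linear (i + 2 + j + 2))
  have e : line (i + 2 + j + 1) = straight (i + 1) (line (j + 2)) := by
    rw [line, line, straight_straight]; congr 1; omega
  rw [e] at h1
  have h2 := SplitsAs.to_straight hs Branch.noConfusion _ h1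
  have e' : straight (i + 1) (line 1) = line (i + 2) := straight_straight _ _ _
  rw [e'] at h2
  refine (mostarIndex_eq (isTree_linear _) hs h2).trans ?_
  rw [mostar_line_line (by omega) (by omega)]
  push_cast; ring_nf

theorem mostarIndex_chainCL₂ {h : ℕ} (h4 : 4 ≤ h) :
    mostarIndex (chainCL₂ 1 (h - 2)) = 12 * (linearValue h + 2 * (h - 1)) := by
  obtain ⟨i, j, rfl, hj⟩ := exists_half h4
  have h1 := splitsAs_word₂ (i + j)
  have hs := separated_chainSide (isTurnWord_word₂ (i + j))
  rw [show line (i + j) = straight i (line j) from (straight_straight i j nil).symm] at h1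
  have h2 := SplitsAs.to_bentLeft hs (by
    obtain ⟨j, rfl⟩ := Nat.exists_eq_add_of_le' (show 1 ≤ j by omega)
    exact Branch.noConfusion) h1
  rw [show i + 2 + j - 2 = i + j by omega]
  refine (mostarIndex_eq (isTree_word₂ _) hs h2).trans ?_
  rw [mostar_bentLeft_line hj]
  push_cast; ring_nf

theorem mostarIndex_chainCL₃ {h : ℕ} (h4 : 4 ≤ h) :
    mostarIndex (chainCL₃ 1 (h - 4) 1) = 12 * (linearValue h + 2 * (h - 1)) := by
  obtain ⟨i, j, rfl, hj⟩ := exists_half h4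
  obtain ⟨j, rfl⟩ := Nat.exists_eq_add_of_le' (show 2 ≤ j by omega)
  have h1 := splitsAs_word₃ (i + j)
  have hs := separated_chainSide (isTurnWord_word₃ (i + j))
  rw [show bentLeft (i + j) = straight i (bentLeft j) from (straight_straight i j _).symm] at h1
  have h2 := SplitsAs.to_bentLeft hs (by cases j <;> exact Branch.noConfusion) h1
  rw [show i + 2 + (j + 2) - 4 = i + j by omega]
  refine (mostarIndex_eq (isTree_word₃ _) hs h2).trans ?_
  rw [mostar_zigzag (by omega)]
  push_cast; ring_nf

theorem mostarIndex_star : mostarIndex (branchedPL 1 1 1) = 288 := by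
  refine (mostarIndex_eq isTree_treePL separated_sidePL splitsAs_star).trans ?_
  rw [mostar_star]; norm_num

/-! ### Classification -/

section Classification

variable {ι : Type*} [Fintype ι] {T : SimpleGraph ι} {side : ι → ι → ZMod 6}

theorem iso_linearChain (hT : T.IsTree) (hs : Separated T side) {i j h : ℕ}
    (hcard : Fintype.card ι = h) (h2 : SplitsAs T side (line i) (line j)) :
    Nonempty (hexagonAssembly T side ≃g linearChain h) := by
  have hN := h2.size_add_size hT hs
  rw [size_line, size_line, hcard] at hN
  obtain ⟨i, rfl⟩ := Nat.exists_eq_succ_of_ne_zero (n := i) (fun h => h2.ne_nil.1 (by rw [h]; rfl))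
  obtain ⟨j, rfl⟩ := Nat.exists_eq_succ_of_ne_zero (n := j) (fun h => h2.ne_nil.2 (by rw [h]; rfl))
  obtain rfl : h = i + j + 2 := by push_cast at hN; omega
  have e : line (i + 1) = straight i (line 1) := (straight_straight i 1 nil).symm
  rw [Nat.succ_eq_add_one, e] at h2
  have h3 := SplitsAs.of_straight hs Branch.noConfusion i h2
  rw [line, line, straight_straight] at h3
  exact nonempty_iso_of_splitsAs hT hs (isTree_linear (i + j + 1))
    (separated_chainSide (isTurnWord_linear _)) h3 (splitsAs_linear (i + j))

theorem iso_chainCL₂ (hT : T.IsTree) (hs : Separated T side) {i j h : ℕ}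
    (hcard : Fintype.card ι = h) (h2 : SplitsAs T side (bentLeft i) (line j)) :
    Nonempty (hexagonAssembly T side ≃g chainCL₂ 1 (h - 2)) := by
  have hN := h2.size_add_size hT hs
  rw [size_line, size_bentLeft, hcard] at hN
  obtain rfl : h = i + j + 2 := by omega
  have h3 := SplitsAs.of_bentLeft hs h2
  rw [line, line, straight_straight] at h3
  exact nonempty_iso_of_splitsAs hT hs (isTree_word₂ (i + j))
    (separated_chainSide (isTurnWord_word₂ _)) h3 (splitsAs_word₂ (i + j))

theorem iso_chainCL₃ (hT : T.IsTree) (hs : Separated T side) {i j h : ℕ}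
    (hcard : Fintype.card ι = h) (h2 : SplitsAs T side (bentLeft i) (bentLeft j)) :
    Nonempty (hexagonAssembly T side ≃g chainCL₃ 1 (h - 4) 1) := by
  have hN := h2.size_add_size hT hs
  rw [size_bentLeft, size_bentLeft, hcard] at hN
  obtain rfl : h = i + j + 4 := by omega
  have h3 := SplitsAs.of_bentLeft hs h2
  rw [bentLeft, straight_straight] at h3
  exact nonempty_iso_of_splitsAs hT hs (isTree_word₃ (i + j))
    (separated_chainSide (isTurnWord_word₃ _)) h3 (splitsAs_word₃ (i + j))

theorem iso_of_minimalShape (hT : T.IsTree) (hs : Separated T side) {p q : Branch} {h : ℕ}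
    (hcard : Fintype.card ι = h) (h2 : SplitsAs T side p q) (hpq : MinimalShape p q) :
    Nonempty (hexagonAssembly T side ≃g chainCL₂ 1 (h - 2)) ∨
      Nonempty (hexagonAssembly T side ≃g chainCL₃ 1 (h - 4) 1) := by
  have bent_line : ∀ {p q : Branch} {i j : ℕ}, SplitsAs T side p q →
      (p = bentLeft i ∨ p = bentRight i) → q = line j →
      Nonempty (hexagonAssembly T side ≃g chainCL₂ 1 (h - 2)) := by
    rintro p q i j h2 (rfl | rfl) rfl
    · exact iso_chainCL₂ hT hs hcard h2
    · have h3 := h2.mirror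
      rw [mirror_bentRight, mirror_line] at h3
      obtain ⟨e⟩ := iso_chainCL₂ hT hs.mirror hcard h3
      exact ⟨(mirrorIso T side).trans e⟩
  cases hpq with
  | bent_line i j hp hq => exact .inl (bent_line h2 hp hq)
  | line_bent i j hp hq => exact .inl (bent_line h2.symm hq hp)
  | zigzag i j h' =>
    right
    rcases h' with ⟨rfl, rfl⟩ | ⟨rfl, rfl⟩
    · exact iso_chainCL₃ hT hs hcard h2
    · have h3 := h2.mirror
      rw [mirror_bentRight, mirror_bentRight] at h3
      obtain ⟨e⟩ := iso_chainCL₃ hT hs.mirror hcard h3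
      exact ⟨(mirrorIso T side).trans e⟩

/-- The bound for tree-like phenylenes. For `h = 4`, the middle alternative still occurs, with a
larger Mostar index than that of `P_L(1, 1, 1)`. -/
theorem mostarIndex_trichotomy {h : ℕ} (h4 : 4 ≤ h) {V : Type*} [Fintype V] {G : SimpleGraph V}
    (hG : IsTreelikePhenylene h G) :
    Nonempty (G ≃g linearChain h) ∨
      (12 * (linearValue h + 2 * (h - 1)) ≤ mostarIndex G ∧
        (mostarIndex G = 12 * (linearValue h + 2 * (h - 1)) →
          Nonempty (G ≃g chainCL₂ 1 (h - 2)) ∨ Nonempty (G ≃g chainCL₃ 1 (h - 4) 1))) ∨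
      (h = 4 ∧ Nonempty (G ≃g branchedPL 1 1 1)) := by
  obtain ⟨T, side, hT, hs, ⟨e⟩⟩ : ∃ (T : SimpleGraph (Fin h)) (side : Fin h → Fin h → ZMod 6),
    T.IsTree ∧ Separated T side ∧ Nonempty (G ≃g hexagonAssembly T side) := hG
  have hcard : Fintype.card (Fin h) = h := Fintype.card_fin h
  obtain ⟨p, q, hp, hq, h2, hb⟩ := exists_balanced_split hT hs (by omega)
  have hne := h2.ne_nil
  have hN := h2.size_add_size hT hs
  rw [hcard] at hN hb
  rw [mostarIndex_congr e, mostarIndex_eq hT hs h2]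
  rcases mostar_bound hp hq hne.1 hne.2 hN (by omega) hb with
    ⟨i, j, rfl, rfl⟩ | ⟨h3, h5⟩ | ⟨h3, rfl, rfl⟩
  · left
    obtain ⟨e'⟩ := iso_linearChain hT hs hcard h2
    exact ⟨e.trans e'⟩
  · right; left
    refine ⟨by linarith, fun h6 => ?_⟩
    exact (iso_of_minimalShape hT hs hcard h2 (h5 (by linarith))).imp
      (fun ⟨e'⟩ => ⟨e.trans e'⟩) (fun ⟨e'⟩ => ⟨e.trans e'⟩)
  · right; right
    obtain ⟨e'⟩ := nonempty_iso_of_splitsAs hT hs isTree_treePL separated_sidePL h2 splitsAs_star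
    exact ⟨by omega, ⟨e.trans e'⟩⟩

end Classification

/-- The bound in the notation with floor and ceiling. -/
theorem twelve_mul_linearValue (h : ℕ) :
    72 * ⌊(h : ℚ) / 2⌋ * ⌈(h : ℚ) / 2⌉ - 24 * ⌊(h : ℚ) / 2⌋ + 24 * ((h : ℤ) - 1) =
      12 * (linearValue h + 2 * (h - 1)) := by
  have h1 : ⌊(h : ℚ) / 2⌋ = (h : ℤ) / 2 := by
    rw [Int.floor_eq_iff]
    have h3 : (2 : ℤ) * ((h : ℤ) / 2) ≤ h := by omega
    have h4 : (h : ℤ) < 2 * ((h : ℤ) / 2) + 2 := by omega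
    have h3' : (2 : ℚ) * (((h : ℤ) / 2 : ℤ) : ℚ) ≤ h := by exact_mod_cast h3
    have h4' : (h : ℚ) < 2 * (((h : ℤ) / 2 : ℤ) : ℚ) + 2 := by exact_mod_cast h4
    constructor <;> linarith
  have h2 : ⌈(h : ℚ) / 2⌉ = ((h : ℤ) + 1) / 2 := by
    rw [Int.ceil_eq_iff]
    have h3 : (h : ℤ) ≤ 2 * (((h : ℤ) + 1) / 2) := by omega
    have h4 : 2 * (((h : ℤ) + 1) / 2) < (h : ℤ) + 2 := by omega
    have h3' : (h : ℚ) ≤ 2 * ((((h : ℤ) + 1) / 2 : ℤ) : ℚ) := by exact_mod_cast h3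
    have h4' : 2 * ((((h : ℤ) + 1) / 2 : ℤ) : ℚ) < (h : ℚ) + 2 := by exact_mod_cast h4
    constructor <;> linarith
  rw [h1, h2, linearValue]; ring

end Phenylene

open Phenylene in
theorem theorem4p4 (h : ℕ) :
    (5 ≤ h →
      (IsTreelikePhenylene h (chainCL₂ 1 (h - 2)) ∧
        IsTreelikePhenylene h (chainCL₃ 1 (h - 4) 1) ∧
        ¬ Nonempty (chainCL₂ 1 (h - 2) ≃g linearChain h) ∧
        ¬ Nonempty (chainCL₃ 1 (h - 4) 1 ≃g linearChain h)) ∧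
      mostarIndex (chainCL₂ 1 (h - 2)) =
        72 * ⌊(h : ℚ) / 2⌋ * ⌈(h : ℚ) / 2⌉ - 24 * ⌊(h : ℚ) / 2⌋ + 24 * ((h : ℤ) - 1) ∧
      mostarIndex (chainCL₃ 1 (h - 4) 1) =
        72 * ⌊(h : ℚ) / 2⌋ * ⌈(h : ℚ) / 2⌉ - 24 * ⌊(h : ℚ) / 2⌋ + 24 * ((h : ℤ) - 1) ∧
      ∀ (V : Type*) [Fintype V] (G : SimpleGraph V), IsTreelikePhenylene h G →
        ¬ Nonempty (G ≃g linearChain h) →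
        72 * ⌊(h : ℚ) / 2⌋ * ⌈(h : ℚ) / 2⌉ - 24 * ⌊(h : ℚ) / 2⌋ + 24 * ((h : ℤ) - 1)
            ≤ mostarIndex G ∧
        (mostarIndex G =
            72 * ⌊(h : ℚ) / 2⌋ * ⌈(h : ℚ) / 2⌉ - 24 * ⌊(h : ℚ) / 2⌋ + 24 * ((h : ℤ) - 1) ↔
          Nonempty (G ≃g chainCL₂ 1 (h - 2)) ∨ Nonempty (G ≃g chainCL₃ 1 (h - 4) 1))) ∧
    (h = 4 →
      (IsTreelikePhenylene h (branchedPL 1 1 1) ∧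
        ¬ Nonempty (branchedPL 1 1 1 ≃g linearChain h)) ∧
      mostarIndex (branchedPL 1 1 1) = 288 ∧
      ∀ (V : Type*) [Fintype V] (G : SimpleGraph V), IsTreelikePhenylene h G →
        ¬ Nonempty (G ≃g linearChain h) →
        288 ≤ mostarIndex G ∧
        (mostarIndex G = 288 ↔ Nonempty (G ≃g branchedPL 1 1 1))) := by
  rw [twelve_mul_linearValue]
  constructor
  · intro h5
    have m1 := mostarIndex_linearChain (show 4 ≤ h by omega)
    have m2 := mostarIndex_chainCL₂ (show 4 ≤ h by omega)
    have m3 := mostarIndex_chainCL₃ (show 4 ≤ h by omega)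
    refine ⟨⟨?_, ?_, ?_, ?_⟩, m2, m3, ?_⟩
    · exact isTreelikePhenylene_chain (isTurnWord_word₂ _) (by simp) (by simp; omega)
    · exact isTreelikePhenylene_chain (isTurnWord_word₃ _) (by simp) (by simp; omega)
    · rintro ⟨e⟩
      have := mostarIndex_congr e
      rw [m1, m2] at this
      omega
    · rintro ⟨e⟩
      have := mostarIndex_congr e
      rw [m1, m3] at this
      omega
    · intro V _ G hG hL
      rcases mostarIndex_trichotomy (by omega) hG with h1 | ⟨h1, h2⟩ | ⟨h1, -⟩
      · exact absurd h1 hL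
      · refine ⟨h1, h2, ?_⟩
        rintro (⟨⟨e⟩⟩ | ⟨⟨e⟩⟩)
        · rw [mostarIndex_congr e, m2]
        · rw [mostarIndex_congr e, m3]
      · omega
  · rintro rfl
    have m1 := mostarIndex_linearChain (le_refl 4)
    have hL4 : Branch.linearValue (4 : ℕ) = 20 := rfl
    rw [hL4] at m1
    refine ⟨⟨isTreelikePhenylene_hexagonAssembly isTree_treePL separated_sidePL (by decide), ?_⟩,
      mostarIndex_star, ?_⟩
    · rintro ⟨e⟩
      have := mostarIndex_congr e
      rw [m1, mostarIndex_star] at this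
      omega
    · intro V _ G hG hL
      rcases mostarIndex_trichotomy le_rfl hG with h1 | ⟨h1, -⟩ | ⟨-, ⟨e⟩⟩
      · exact absurd h1 hL
      · rw [hL4] at h1
        push_cast at h1
        refine ⟨by omega, fun h2 => by omega, ?_⟩
        rintro ⟨e⟩
        rw [mostarIndex_congr e, mostarIndex_star]
      · rw [mostarIndex_congr e, mostarIndex_star]
        exact ⟨le_rfl, fun _ => ⟨e⟩, fun _ => rfl⟩
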